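/- **Conventions.** An ordinal graph is a small category $\Lambda$ (composition written $ef$ when $s(e)=r(f)$, vertices identified with identity morphisms) with a functor $d:\Lambda\to\mathrm{Ord}$, $d(ef)=d(e)+d(f)$, such that for all $e\in\Lambda$ and $\alpha\le d(e)$ there are unique $f,g$ with $e=fg$, $d(f)=\alpha$. Put $\Lambda_\alpha=\{e:d(e)<\omega^\alpha\}$ (again an ordinal graph) and $\Lambda^{\beta}=\{e:d(e)=\beta\}$; $\Lambda_0$ is the set of vertices. A vertex $v$ is $\alpha$-regular if $v\Lambda^{\omega^\alpha}=\{e\in\Lambda^{\omega^\alpha}:r(e)=v\}$ is finite and for every $e\in\Lambda_\alpha$ with $r(e)=v$ there is $f\in\Lambda^{\omega^\alpha}$ with $r(f)=s(e)$. $\mathcal O(\Lambda)$ is the C*-algebra universal for partial isometries $T_e$, $e\in\Lambda_0\cup\bigcup_\alpha\Lambda^{\omega^\alpha}$, with (1) $T_e^*T_e=T_{s(e)}$; (2) $T_eT_f=T_{ef}$ if $s(e)=r(f)$ and $d(e)<d(f)$; (3) $T_e^*T_f=0$ if $e\Lambda\cap f\Lambda=\emptyset$; (4) $T_v=\sum_{e\in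 v\Lambda^{\omega^\alpha}}T_eT_e^*$ if $v$ is $\alpha$-regular. $\Lambda$ is a directed graph if $\Lambda=\Lambda_1$, i.e. all lengths are finite; then $\mathcal O(\Lambda)$ is its graph algebra. Let $X_0$ be the Hilbert $\mathcal O(\Lambda_0)$-module completing the space of finitely supported $x:\Lambda^1\to\mathcal O(\Lambda_0)$ with $T_{s(e)}x(e)=x(e)$ for all $e$, with $(x\cdot a)(e)=x(e)a$ and $\langle x,y\rangle=\sum_e x(e)^*y(e)$. It is a C*-correspondence through the *-homomorphism $\varphi_0:\mathcal O(\Lambda_0)\to\mathcal L(X_0)$ with $(\varphi_0(T_v)x)(e)=x(e)$ if $r(e)=v$ and $0$ otherwise. Let $\delta_e\in X_0$ have value $T_{s(e)}$ at $e$ and $0$ elsewhere. Let $Y$ be the usual graph correspondence over $c_0(\Lambda_0)$, the completion of $c_c(\Lambda^1)$ with $$(h\cdot f)(e)=h(r(e))f(e),\qquad (f\cdot h)(e)=f(e)h(s(e)),\qquad \langle f,g\rangle(v)=\sum_{s(e)=v}\overline{f(e)}g(e).$$ For a C*-correspondence $(X,\varphi)$ over $A$, $\mathcal O(X)$ is the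 Cuntz–Pimsner algebra, universal for representations $(\psi,\pi)$ with $(\psi,\pi)^{(1)}(\varphi(a))=\pi(a)$ for all $a\in J_X=(\ker\varphi)^\perp\cap\varphi^{-1}(\mathcal K(X))$; its universal representation is $(\psi_u,\pi_u)$. **Statement.** Let $\Lambda$ be a directed graph. Then: 1. There is a *-isomorphism $\theta:\mathcal O(\Lambda_0)\to c_0(\Lambda_0)$ with $\theta(T_v)=1_{\{v\}}$ for every vertex $v$. 2. There is a linear bijection $U:X_0\to Y$ with $U(\delta_e)=1_{\{e\}}$ for every edge $e$ which is an isomorphism of correspondences over $\theta$: $\langle Ux,Uy\rangle=\theta(\langle x,y\rangle)$, $U(x\cdot a)=U(x)\cdot\theta(a)$ and $U(a\cdot x)=\theta(a)\cdot U(x)$ for all $x,y\in X_0$ and $a\in\mathcal O(\Lambda_0)$. 3. There is a *-isomorphism $\Phi:\mathcal O(X_0)\to\mathcal O(\Lambda)$ with $\Phi(\pi_u(T_v))=T_v$ for every vertex $v$ and $\Phi(\psi_u(\delta_e))=T_e$ for every edge $e$. -/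

import Mathlib

noncomputable section

open scoped ENNReal

/-! ## Right Hilbert modules -/

/-- A right pre-Hilbert module over a C*-algebra `A`: a complex vector space with a right action of
`A` and a definite `A`-valued inner product, conjugate-linear in the first variable. An element of
a C*-algebra is positive exactly when it has the form `star b * b`. (Bilinearity and associativity
of the right action follow from these axioms.) -/
class PreHilbertModule (A : outParam Type*) (E : Type*) [NonUnitalCStarAlgebra A]
    [AddCommGroup E] [Module ℂ E] where
  /-- the right action `x · a` -/
  act : E → A → E
  /-- the inner product `⟨x, y⟩` -/
  ip : E → E → A
  ip_add_right : ∀ x y z, ip x (y + z) = ip x y + ip x z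
  ip_smul_right : ∀ (c : ℂ) x y, ip x (c • y) = c • ip x y
  ip_act_right : ∀ x y a, ip x (act y a) = ip x y * a
  star_ip : ∀ x y, star (ip x y) = ip y x
  ip_self_pos : ∀ x, ∃ b, ip x x = star b * b
  eq_zero_of_ip_self : ∀ x, ip x x = 0 → x = 0

/-- A right Hilbert module over `A`: a pre-Hilbert module which is a Banach space for the norm
`‖x‖ = ‖⟨x, x⟩‖ ^ (1/2)`. -/
class HilbertModule (A : outParam Type*) (X : Type*) [NonUnitalCStarAlgebra A]
    [NormedAddCommGroup X] [NormedSpace ℂ X] extends PreHilbertModule A X where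
  norm_sq : ∀ x : X, ‖x‖ ^ 2 = ‖ip x x‖
  complete : CompleteSpace X

namespace PreHilbertModule

variable {A E : Type*} [NonUnitalCStarAlgebra A] [AddCommGroup E] [Module ℂ E]
  [PreHilbertModule A E]

theorem ip_add_left (x y z : E) : ip (x + y) z = ip x z + ip y z := by
  rw [← star_ip z, ip_add_right, star_add, star_ip, star_ip]

theorem ip_smul_left (c : ℂ) (x y : E) : ip (c • x) y = star c • ip x y := by
  rw [← star_ip y, ip_smul_right, star_smul, star_ip]

theorem ip_act_left (x y : E) (a : A) : ip (act x a) y = star a * ip x y := by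
  rw [← star_ip y, ip_act_right, star_mul, star_ip]

/-- The inner product as a biadditive map. -/
def ipHom : E →+ E →+ A :=
  AddMonoidHom.mk' (fun x => AddMonoidHom.mk' (ip x) (ip_add_right x))
    (fun x y => by ext z; exact ip_add_left x y z)

theorem ipHom_apply (x y : E) : ipHom x y = ip x y := rfl

theorem ip_zero_right (x : E) : ip x (0 : E) = 0 := map_zero (ipHom x)

theorem ip_sub_right (x y z : E) : ip x (y - z) = ip x y - ip x z := map_sub (ipHom x) y z

theorem ext_ip {x y : E} (h : ∀ z : E, ip z x = ip z y) : x = y := by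
  rw [← sub_eq_zero]
  apply eq_zero_of_ip_self
  rw [ip_sub_right, h, sub_self]

variable (A E) in
/-- The same data in the left-handed convention of `CStarModule`, used to transfer the
Cauchy-Schwarz inequality. -/
@[reducible]
def toCStarModule :
    letI : PartialOrder Aᵐᵒᵖ := CStarAlgebra.spectralOrder _
    letI : SMul Aᵐᵒᵖ E := ⟨fun a x => act x a.unop⟩
    letI : Norm E := ⟨fun x => √‖ip x x‖⟩
    CStarModule Aᵐᵒᵖ E :=
  letI : PartialOrder Aᵐᵒᵖ := CStarAlgebra.spectralOrder _
  letI : StarOrderedRing Aᵐᵒᵖ := CStarAlgebra.spectralOrderedRing _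
  letI : SMul Aᵐᵒᵖ E := ⟨fun a x => act x a.unop⟩
  letI : Norm E := ⟨fun x => √‖ip x x‖⟩
  { inner := fun x y => MulOpposite.op (ip x y)
    inner_add_right := by intro x y z; simp [ip_add_right]
    inner_self_nonneg := by
      intro x
      obtain ⟨b, hb⟩ := ip_self_pos x
      rw [hb, MulOpposite.op_mul, MulOpposite.op_star]
      exact mul_star_self_nonneg _
    inner_self := by
      intro x
      rw [MulOpposite.op_eq_zero_iff]
      exact ⟨eq_zero_of_ip_self x, by rintro rfl; exact ip_zero_right _⟩
    inner_op_smul_right := by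
      intro a x y
      change MulOpposite.op (ip x (act y a.unop)) = _
      rw [ip_act_right]; rfl
    inner_smul_right_complex := by intro z x y; rw [ip_smul_right]; rfl
    star_inner := by intro x y; rw [← MulOpposite.op_star, star_ip]
    norm_eq_sqrt_norm_inner_self := fun x => rfl }

variable (A E) in
/-- The norm `‖x‖ = ‖⟨x, x⟩‖ ^ (1/2)` of a pre-Hilbert module. -/
@[reducible]
def normedGroup : NormedAddCommGroup E :=
  letI : PartialOrder Aᵐᵒᵖ := CStarAlgebra.spectralOrder _
  letI : StarOrderedRing Aᵐᵒᵖ := CStarAlgebra.spectralOrderedRing _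
  letI : SMul Aᵐᵒᵖ E := ⟨fun a x => act x a.unop⟩
  letI : Norm E := ⟨fun x => √‖ip x x‖⟩
  letI := toCStarModule A E
  CStarModule.normedAddCommGroup Aᵐᵒᵖ

attribute [local instance] normedGroup

variable (A E) in
/-- The norm of a pre-Hilbert module is a norm of complex vector spaces. -/
@[reducible]
def normedSpc : NormedSpace ℂ E :=
  letI : PartialOrder Aᵐᵒᵖ := CStarAlgebra.spectralOrder _
  letI : StarOrderedRing Aᵐᵒᵖ := CStarAlgebra.spectralOrderedRing _
  letI : SMul Aᵐᵒᵖ E := ⟨fun a x => act x a.unop⟩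
  letI : Norm E := ⟨fun x => √‖ip x x‖⟩
  letI := toCStarModule A E
  NormedSpace.ofCore (CStarModule.normedSpaceCore Aᵐᵒᵖ)

attribute [local instance] normedSpc

theorem norm_sq_pre (x : E) : ‖x‖ ^ 2 = ‖ip x x‖ := Real.sq_sqrt (norm_nonneg _)

theorem norm_ip_le (x y : E) : ‖ip x y‖ ≤ ‖x‖ * ‖y‖ := by
  let : PartialOrder Aᵐᵒᵖ := CStarAlgebra.spectralOrder _
  let : StarOrderedRing Aᵐᵒᵖ := CStarAlgebra.spectralOrderedRing _
  let : SMul Aᵐᵒᵖ E := ⟨fun a x => act x a.unop⟩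
  let : Norm E := ⟨fun x => √‖ip x x‖⟩
  let := toCStarModule A E
  exact CStarModule.norm_inner_le (A := Aᵐᵒᵖ) E (x := x) (y := y)

theorem continuous_ip_pre : Continuous fun p : E × E => (ipHom p.1 p.2 : A) := by
  let L : E →L⋆[ℂ] E →L[ℂ] A := LinearMap.mkContinuous₂
    (LinearMap.mk₂'ₛₗ (starRingEnd ℂ) (RingHom.id ℂ) ip ip_add_left
      (fun c x y => ip_smul_left c x y) ip_add_right (fun c x y => ip_smul_right c x y)) 1
    (fun x y => by rw [one_mul]; exact norm_ip_le x y)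
  have : Continuous fun p : E × E => L p.1 p.2 := by fun_prop
  exact this

theorem norm_act_le (x : E) (a : A) : ‖act x a‖ ≤ ‖x‖ * ‖a‖ := by
  refine (sq_le_sq₀ (norm_nonneg _) (by positivity)).mp ?_
  rw [norm_sq_pre, ip_act_right, ip_act_left, mul_pow, norm_sq_pre]
  calc ‖star a * ip x x * a‖ ≤ ‖star a * ip x x‖ * ‖a‖ := norm_mul_le _ _
    _ ≤ ‖star a‖ * ‖ip x x‖ * ‖a‖ := by gcongr; exact norm_mul_le _ _
    _ = ‖ip x x‖ * ‖a‖ ^ 2 := by rw [norm_star]; ring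

/-- The right action of a fixed algebra element as a linear map. -/
def actLin (a : A) : E →ₗ[ℂ] E where
  toFun x := act x a
  map_add' x y := ext_ip fun z => by simp [ip_act_right, ip_add_right, add_mul]
  map_smul' c x := ext_ip fun z => by simp [ip_act_right, ip_smul_right, smul_mul_assoc]

theorem actLin_apply (a : A) (x : E) : actLin a x = act x a := rfl

/-! ### Completion -/

variable (A E) in
/-- The completion of a pre-Hilbert module in its norm. -/
def Completed : Type _ := UniformSpace.Completion E

namespace Completed

instance : NormedAddCommGroup (Completed A E) :=
  inferInstanceAs (NormedAddCommGroup (UniformSpace.Completion E))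

instance : NormedSpace ℂ (Completed A E) :=
  inferInstanceAs (NormedSpace ℂ (UniformSpace.Completion E))

instance : CompleteSpace (Completed A E) :=
  inferInstanceAs (CompleteSpace (UniformSpace.Completion E))

variable (A E) in
/-- The canonical map of a pre-Hilbert module into its completion. -/
def of : E →ₗ[ℂ] Completed A E :=
  (UniformSpace.Completion.toComplₗᵢ : E →ₗᵢ[ℂ] UniformSpace.Completion E).toLinearMap

variable (A E) in
/-- The canonical map as an isometry. -/
def ofIso : E →ₗᵢ[ℂ] Completed A E :=
  (UniformSpace.Completion.toComplₗᵢ : E →ₗᵢ[ℂ] UniformSpace.Completion E)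

theorem ofIso_apply (x : E) : ofIso A E x = of A E x := rfl

theorem norm_of (x : E) : ‖of A E x‖ = ‖x‖ := (ofIso A E).norm_map x

theorem isDenseInducing_ofIso : IsDenseInducing (ofIso A E) :=
  UniformSpace.Completion.isDenseInducing_coe (α := E)

theorem isUniformInducing_ofIso : IsUniformInducing (ofIso A E) :=
  (ofIso A E).isometry.isUniformInducing

theorem denseRange_of : DenseRange (of A E) := isDenseInducing_ofIso.dense

/-- The extension of the inner product to the completion. -/
def inn (x y : Completed A E) : A :=
  (isDenseInducing_ofIso.prodMap isDenseInducing_ofIso).extend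
    (fun p : E × E => (ipHom p.1 p.2 : A)) (x, y)

theorem continuous_inn : Continuous fun p : Completed A E × Completed A E => inn p.1 p.2 := by
  exact IsDenseInducing.extend_Z_bilin (e := (ofIso A E : E →+ Completed A E))
    (f := (ofIso A E : E →+ Completed A E)) isDenseInducing_ofIso isDenseInducing_ofIso
    (φ := (ipHom : E →+ E →+ A)) continuous_ip_pre

theorem inn_of (x y : E) : inn (of A E x) (of A E y) = ip x y :=
  (isDenseInducing_ofIso.prodMap isDenseInducing_ofIso).extend_eq continuous_ip_pre (x, y)

/-- The extension to the completion of a bounded linear operator on a pre-Hilbert module. -/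
def extendLin (T : E →ₗ[ℂ] E) (C : ℝ) (h : ∀ x, ‖T x‖ ≤ C * ‖x‖) :
    Completed A E →L[ℂ] Completed A E :=
  ((ofIso A E).toContinuousLinearMap ∘L T.mkContinuous C h).extend
    (ofIso A E).toContinuousLinearMap

theorem extendLin_of (T : E →ₗ[ℂ] E) (C : ℝ) (h : ∀ x, ‖T x‖ ≤ C * ‖x‖) (x : E) :
    extendLin T C h (of A E x) = of A E (T x) :=
  ContinuousLinearMap.extend_eq (e := (ofIso A E).toContinuousLinearMap)
    ((ofIso A E).toContinuousLinearMap ∘L T.mkContinuous C h)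
    denseRange_of isUniformInducing_ofIso x

theorem ind {p : Completed A E → Prop} (hp : IsClosed {x | p x}) (h : ∀ x, p (of A E x)) :
    ∀ x, p x := fun x => denseRange_of.induction_on x hp h

theorem norm_le_of_ip (T : E →ₗ[ℂ] E) (C : ℝ)
    (h : ∀ x, ‖ip (T x) (T x)‖ ≤ C ^ 2 * ‖ip x x‖) (x : E) : ‖T x‖ ≤ |C| * ‖x‖ := by
  refine (sq_le_sq₀ (norm_nonneg _) (by positivity)).mp ?_
  rw [norm_sq_pre, mul_pow, norm_sq_pre, sq_abs]
  exact h x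

theorem inn_continuous {Z : Type*} [TopologicalSpace Z] {f g : Z → Completed A E}
    (hf : Continuous f) (hg : Continuous g) : Continuous fun z => inn (f z) (g z) :=
  continuous_inn.comp (hf.prodMk hg)

theorem norm_sq_inn (x : Completed A E) : ‖x‖ ^ 2 = ‖inn x x‖ := by
  refine ind (p := fun x => ‖x‖ ^ 2 = ‖inn x x‖) (isClosed_eq (continuous_norm.pow 2)
    (inn_continuous continuous_id' continuous_id').norm) (fun x => ?_) x
  rw [inn_of, norm_of, norm_sq_pre]

theorem inn_add (x y z : Completed A E) : inn x (y + z) = inn x y + inn x z := by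
  refine ind (isClosed_eq (inn_continuous continuous_id' continuous_const)
    ((inn_continuous continuous_id' continuous_const).add
      (inn_continuous continuous_id' continuous_const))) (fun x => ?_) x
  refine ind (isClosed_eq (inn_continuous continuous_const (continuous_add_const z))
    ((inn_continuous continuous_const continuous_id').add
      continuous_const)) (fun y => ?_) y
  refine ind (isClosed_eq (inn_continuous continuous_const (continuous_const_add _))
    (continuous_const.add
      (inn_continuous continuous_const continuous_id'))) (fun z => ?_) z
  change inn (of A E x) (of A E y + of A E z) =
    inn (of A E x) (of A E y) + inn (of A E x) (of A E z)
  rw [← map_add, inn_of, inn_of, inn_of, ip_add_right]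

theorem inn_smul (c : ℂ) (x y : Completed A E) : inn x (c • y) = c • inn x y := by
  refine ind (isClosed_eq (inn_continuous continuous_id' continuous_const)
    ((inn_continuous continuous_id' continuous_const).const_smul c)) (fun x => ?_) x
  refine ind (isClosed_eq (inn_continuous continuous_const (continuous_const_smul c))
    ((inn_continuous continuous_const continuous_id').const_smul c)) (fun y => ?_) y
  change inn (of A E x) (c • of A E y) = c • inn (of A E x) (of A E y)
  rw [← map_smul, inn_of, inn_of, ip_smul_right]

/-- The extension of the right action to the completion. -/
def actC (x : Completed A E) (a : A) : Completed A E :=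
  extendLin (actLin a) ‖a‖ (fun x => by rw [mul_comm]; exact norm_act_le x a) x

theorem inn_actC (x y : Completed A E) (a : A) : inn x (actC y a) = inn x y * a := by
  refine ind (isClosed_eq (inn_continuous continuous_id' continuous_const)
    ((inn_continuous continuous_id' continuous_const).mul continuous_const)) (fun x => ?_) x
  refine ind (isClosed_eq (inn_continuous continuous_const (ContinuousLinearMap.continuous _))
    ((inn_continuous continuous_const continuous_id').mul continuous_const)) (fun y => ?_) y
  change inn (of A E x) (extendLin _ _ _ (of A E y)) = inn (of A E x) (of A E y) * a
  rw [extendLin_of, inn_of, inn_of, actLin_apply, ip_act_right]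

theorem star_inn (x y : Completed A E) : star (inn x y) = inn y x := by
  refine ind (isClosed_eq (inn_continuous continuous_id' continuous_const).star
    (inn_continuous continuous_const continuous_id')) (fun x => ?_) x
  refine ind (isClosed_eq (inn_continuous continuous_const continuous_id').star
    (inn_continuous continuous_id' continuous_const)) (fun y => ?_) y
  rw [inn_of, inn_of, star_ip]

theorem inn_pos (x : Completed A E) : ∃ b, inn x x = star b * b := by
  let _ : PartialOrder A := CStarAlgebra.spectralOrder _
  have _ : StarOrderedRing A := CStarAlgebra.spectralOrderedRing _
  refine CStarAlgebra.nonneg_iff_eq_star_mul_self.mp ?_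
  refine ind (isClosed_le continuous_const (inn_continuous continuous_id' continuous_id'))
    (fun x => ?_) x
  rw [inn_of]
  exact CStarAlgebra.nonneg_iff_eq_star_mul_self.mpr (ip_self_pos x)

/-- The completion of a pre-Hilbert module is a Hilbert module. -/
instance : HilbertModule A (Completed A E) where
  act := actC
  ip := inn
  ip_add_right := inn_add
  ip_smul_right := inn_smul
  ip_act_right := inn_actC
  star_ip := star_inn
  ip_self_pos := inn_pos
  eq_zero_of_ip_self x h := by
    have := norm_sq_inn x
    rw [h, norm_zero] at this
    simpa using this
  norm_sq := norm_sq_inn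
  complete := inferInstance

theorem ip_of (x y : E) : ip (of A E x) (of A E y) = ip x y := inn_of x y

theorem act_of (x : E) (a : A) : act (of A E x) a = of A E (act x a) := extendLin_of _ _ _ x

end Completed

end PreHilbertModule

/-! ## Adjointable and compact operators -/

namespace HilbertModule

open PreHilbertModule

variable {A X : Type*} [NonUnitalCStarAlgebra A] [NormedAddCommGroup X] [NormedSpace ℂ X]
  [HilbertModule A X]

theorem norm_ip (x y : X) : ‖ip x y‖ ≤ ‖x‖ * ‖y‖ := by
  have h : ∀ z : X, √‖ip z z‖ = ‖z‖ := fun z => by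
    rw [← norm_sq, Real.sqrt_sq (norm_nonneg _)]
  rw [← h x, ← h y]
  exact norm_ip_le x y

theorem norm_act (x : X) (a : A) : ‖act x a‖ ≤ ‖x‖ * ‖a‖ := by
  have h : ∀ z : X, √‖ip z z‖ = ‖z‖ := fun z => by
    rw [← norm_sq, Real.sqrt_sq (norm_nonneg _)]
  rw [← h x, ← h (act x a)]
  exact norm_act_le x a

theorem continuous_ip {Z : Type*} [TopologicalSpace Z] {f g : Z → X}
    (hf : Continuous f) (hg : Continuous g) : Continuous fun z => ip (f z) (g z) := by
  let L : X →L⋆[ℂ] X →L[ℂ] A := LinearMap.mkContinuous₂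
    (LinearMap.mk₂'ₛₗ (starRingEnd ℂ) (RingHom.id ℂ) ip ip_add_left
      (fun c x y => ip_smul_left c x y) ip_add_right (fun c x y => ip_smul_right c x y)) 1
    (fun x y => by rw [one_mul]; exact norm_ip x y)
  have : Continuous fun z => L (f z) (g z) := by fun_prop
  exact this

/-- The operator `z ↦ x · ⟨y, z⟩`. -/
def thetaOp (x y : X) : X →L[ℂ] X :=
  LinearMap.mkContinuous
    { toFun := fun z => act x (ip y z)
      map_add' := fun z w => ext_ip fun v => by
        rw [ip_act_right, ip_add_right, ip_add_right, ip_act_right, ip_act_right, mul_add]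
      map_smul' := fun c z => ext_ip fun v => by
        rw [ip_act_right, ip_smul_right, RingHom.id_apply, ip_smul_right, ip_act_right,
          mul_smul_comm] }
    (‖x‖ * ‖y‖) fun z => by
      refine (norm_act x (ip y z)).trans ?_
      rw [mul_assoc]
      gcongr
      exact norm_ip y z

theorem thetaOp_apply (x y z : X) : thetaOp x y z = act x (ip y z) := rfl

variable (A X) in
/-- The bounded operators `T` on `X` which have an adjoint `S`, meaning `⟨T x, y⟩ = ⟨x, S y⟩`. -/
def adjointable : Subalgebra ℂ (X →L[ℂ] X) where
  carrier := {T | ∃ S : X →L[ℂ] X, ∀ x y : X, ip (T x) y = ip x (S y)}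
  mul_mem' := by
    rintro T T' ⟨S, h⟩ ⟨S', h'⟩
    exact ⟨S' * S, fun x y => (h _ _).trans (h' _ _)⟩
  add_mem' := by
    rintro T T' ⟨S, h⟩ ⟨S', h'⟩
    refine ⟨S + S', fun x y => ?_⟩
    change ip (T x + T' x) y = ip x (S y + S' y)
    rw [ip_add_left, ip_add_right, h, h']
  algebraMap_mem' c := by
    refine ⟨algebraMap ℂ (X →L[ℂ] X) (star c), fun x y => ?_⟩
    change ip (c • x) y = ip x (star c • y)
    rw [ip_smul_left, ip_smul_right]

variable (A X) in
/-- The C*-algebra `L(X)` of adjointable operators on a Hilbert module. -/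
abbrev Adj : Type _ := adjointable A X

namespace Adj

/-- The operator underlying an element of `L(X)`. -/
def op (T : Adj A X) : X →L[ℂ] X := T.1

/-- The element of `L(X)` given by an operator and its adjoint. -/
def mk (T S : X →L[ℂ] X) (h : ∀ x y : X, ip (T x) y = ip x (S y)) : Adj A X :=
  ⟨T, S, h⟩

theorem op_mk (T S : X →L[ℂ] X) (h : ∀ x y : X, ip (T x) y = ip x (S y)) :
    op (mk T S h) = T := rfl

/-- The involution of `L(X)` takes an operator to its (unique) adjoint. -/
instance : Star (Adj A X) where
  star T := mk T.2.choose T.1 fun x y => by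
    rw [← star_ip y, ← star_ip (T.1 y), T.2.choose_spec y x]

theorem ip_op (T : Adj A X) (x y : X) : ip (op T x) y = ip x (op (star T) y) :=
  T.2.choose_spec x y

@[ext]
theorem ext_op {S T : Adj A X} (h : ∀ x, op S x = op T x) : S = T :=
  Subtype.ext (ContinuousLinearMap.ext h)

theorem star_mk (T S : X →L[ℂ] X) (h : ∀ x y : X, ip (T x) y = ip x (S y)) :
    star (mk T S h) = mk S T (fun x y => by rw [← star_ip y, ← star_ip (T y), h]) := by
  ext x
  refine ext_ip fun z => ?_
  rw [← ip_op, op_mk, op_mk, h]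

theorem ip_op_right (T : Adj A X) (x y : X) : ip x (op T y) = ip (op (star T) x) y := by
  rw [← star_ip, ip_op, star_ip]

theorem op_mul (S T : Adj A X) (x : X) : op (S * T) x = op S (op T x) := rfl

theorem op_add (S T : Adj A X) (x : X) : op (S + T) x = op S x + op T x := rfl

theorem op_smul (c : ℂ) (T : Adj A X) (x : X) : op (c • T) x = c • op T x := rfl

theorem op_zero (x : X) : op (0 : Adj A X) x = 0 := rfl

instance : StarRing (Adj A X) where
  star_involutive T := by
    ext x
    refine ext_ip fun z => ?_
    rw [← ip_op, ← ip_op_right]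
  star_mul S T := by
    ext x
    refine ext_ip fun z => ?_
    rw [← ip_op, op_mul, op_mul, ip_op, ip_op]
  star_add S T := by
    ext x
    refine ext_ip fun z => ?_
    rw [← ip_op, op_add, op_add, ip_add_left, ip_add_right, ip_op, ip_op]

instance : StarModule ℂ (Adj A X) where
  star_smul c T := by
    ext x
    refine ext_ip fun z => ?_
    rw [← ip_op, op_smul, op_smul, ip_smul_left, ip_smul_right, ip_op]

theorem norm_op_sq_le (T : Adj A X) : ‖op T‖ ^ 2 ≤ ‖op (star T * T)‖ := by
  rw [← Real.le_sqrt (norm_nonneg _) (norm_nonneg _)]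
  refine ContinuousLinearMap.opNorm_le_bound _ (Real.sqrt_nonneg _) fun x => ?_
  refine (sq_le_sq₀ (norm_nonneg _) (by positivity)).mp ?_
  rw [norm_sq, ip_op, ← op_mul, mul_pow, Real.sq_sqrt (norm_nonneg _)]
  calc ‖ip x (op (star T * T) x)‖ ≤ ‖x‖ * ‖op (star T * T) x‖ := norm_ip _ _
    _ ≤ ‖x‖ * (‖op (star T * T)‖ * ‖x‖) := by gcongr; exact ContinuousLinearMap.le_opNorm _ _
    _ = _ := by ring

theorem norm_op_star_le (T : Adj A X) : ‖op T‖ ≤ ‖op (star T)‖ := by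
  by_cases h : ‖op T‖ = 0
  · rw [h]; exact norm_nonneg _
  have h0 : 0 < ‖op T‖ := lt_of_le_of_ne (norm_nonneg _) (Ne.symm h)
  refine le_of_mul_le_mul_right ?_ h0
  rw [← sq]
  exact (norm_op_sq_le T).trans (ContinuousLinearMap.opNorm_comp_le (op (star T)) (op T))

theorem norm_eq (T : Adj A X) : ‖T‖ = ‖op T‖ := rfl

theorem norm_op_star (T : Adj A X) : ‖op (star T)‖ = ‖op T‖ := by
  refine le_antisymm ?_ (norm_op_star_le T)
  have := norm_op_star_le (star T)
  rwa [star_star] at this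

instance : CStarRing (Adj A X) where
  norm_mul_self_le T := by
    rw [norm_eq, norm_eq, ← sq]
    exact norm_op_sq_le T

instance : CompleteSpace (Adj A X) := by
  have : CompleteSpace X := HilbertModule.complete (A := A)
  refine Metric.complete_of_cauchySeq_tendsto fun u hu => ?_
  have h1 : CauchySeq fun n => op (u n) := hu.map uniformContinuous_subtype_val
  have h2 : CauchySeq fun n => op (star (u n)) := by
    rw [Metric.cauchySeq_iff] at h1 ⊢
    intro ε hε
    obtain ⟨N, hN⟩ := h1 ε hε
    refine ⟨N, fun m hm n hn => ?_⟩
    have h3 : op (star (u m)) - op (star (u n)) = op (star (u m - u n)) := by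
      rw [star_sub]; rfl
    rw [dist_eq_norm, h3, norm_op_star]
    have := hN m hm n hn
    rwa [dist_eq_norm] at this
  obtain ⟨T, hT⟩ := cauchySeq_tendsto_of_complete h1
  obtain ⟨S, hS⟩ := cauchySeq_tendsto_of_complete h2
  refine ⟨mk T S fun x y => ?_, tendsto_subtype_rng.mpr hT⟩
  have hc1 : Continuous fun R : X →L[ℂ] X => ip (R x) y :=
    continuous_ip (ContinuousLinearMap.apply ℂ X x).continuous continuous_const
  have hc2 : Continuous fun R : X →L[ℂ] X => ip x (R y) :=
    continuous_ip continuous_const (ContinuousLinearMap.apply ℂ X y).continuous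
  have t1 := (hc1.tendsto T).comp hT
  have t2 := (hc2.tendsto S).comp hS
  refine tendsto_nhds_unique t1 (t2.congr fun n => ?_)
  exact (ip_op (u n) x y).symm

instance : CStarAlgebra (Adj A X) where

/-- The operator `θ_{x,y}`, given by `z ↦ x · ⟨y, z⟩`. -/
def theta (x y : X) : Adj A X :=
  mk (thetaOp x y) (thetaOp y x) fun z w => by
    rw [thetaOp_apply, thetaOp_apply, ip_act_left, ip_act_right, star_ip]

theorem mul_theta (T : Adj A X) (x y : X) : T * theta x y = theta (op T x) y := by
  ext z
  refine ext_ip fun w => ?_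
  change ip w (op T (act x (ip y z))) = ip w (act (op T x) (ip y z))
  rw [ip_op_right, ip_act_right, ip_act_right, ip_op_right]

theorem star_theta (x y : X) : star (theta x y : Adj A X) = theta y x := star_mk _ _ _

variable (A X) in
/-- The linear span of the operators `θ_{x,y}`. -/
def finiteRank : Submodule ℂ (Adj A X) := Submodule.span ℂ {T | ∃ x y : X, T = theta x y}

theorem mul_mem_finiteRank (T : Adj A X) {S : Adj A X} (hS : S ∈ finiteRank A X) :
    T * S ∈ finiteRank A X := by
  induction hS using Submodule.span_induction with
  | mem S h =>
    obtain ⟨x, y, rfl⟩ := h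
    exact Submodule.subset_span ⟨_, _, mul_theta T x y⟩
  | zero => rw [mul_zero]; exact zero_mem _
  | add S S' _ _ h h' => rw [mul_add]; exact add_mem h h'
  | smul c S _ h => rw [mul_smul_comm]; exact Submodule.smul_mem _ _ h

theorem star_mem_finiteRank {S : Adj A X} (hS : S ∈ finiteRank A X) :
    star S ∈ finiteRank A X := by
  induction hS using Submodule.span_induction with
  | mem S h =>
    obtain ⟨x, y, rfl⟩ := h
    exact Submodule.subset_span ⟨_, _, star_theta x y⟩
  | zero => rw [star_zero]; exact zero_mem _
  | add S S' _ _ h h' => rw [star_add]; exact add_mem h h'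
  | smul c S _ h => rw [star_smul]; exact Submodule.smul_mem _ _ h

variable (A X) in
/-- The algebra `K(X)` of compact operators: the closed linear span of the operators `θ_{x,y}`. -/
def compacts : NonUnitalStarSubalgebra ℂ (Adj A X) where
  toSubmodule := (finiteRank A X).topologicalClosure
  mul_mem' {S T} _ hT :=
    map_mem_closure (f := fun T => S * T) (by fun_prop) hT fun _ h => mul_mem_finiteRank S h
  star_mem' {S} hS :=
    map_mem_closure (f := fun T : Adj A X => star T) continuous_star hS
      fun _ h => star_mem_finiteRank h

theorem theta_mem_compacts (x y : X) : theta x y ∈ compacts A X :=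
  subset_closure (Submodule.subset_span ⟨x, y, rfl⟩)

end Adj

end HilbertModule

namespace PreHilbertModule.Completed

open HilbertModule

variable {A E : Type*} [NonUnitalCStarAlgebra A] [AddCommGroup E] [Module ℂ E]
  [PreHilbertModule A E]

/-- A pair of mutually adjoint linear operators on a pre-Hilbert module which are bounded in its
norm extends to an adjointable operator on the completion. -/
def extendAdj (T S : E →ₗ[ℂ] E) (C D : ℝ) (hT : ∀ x, ‖ip (T x) (T x)‖ ≤ C ^ 2 * ‖ip x x‖)
    (hS : ∀ x, ‖ip (S x) (S x)‖ ≤ D ^ 2 * ‖ip x x‖) (h : ∀ x y, ip (T x) y = ip x (S y)) :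
    Adj A (Completed A E) :=
  Adj.mk (extendLin T |C| (norm_le_of_ip T C hT)) (extendLin S |D| (norm_le_of_ip S D hS))
    fun x y => by
      refine ind (isClosed_eq (inn_continuous (ContinuousLinearMap.continuous _) continuous_const)
        (inn_continuous continuous_id' continuous_const)) (fun x => ?_) x
      refine ind (isClosed_eq (inn_continuous continuous_const continuous_id')
        (inn_continuous continuous_const (ContinuousLinearMap.continuous _))) (fun y => ?_) y
      rw [extendLin_of, extendLin_of, inn_of, inn_of, h]

theorem extendAdj_of (T S : E →ₗ[ℂ] E) (C D : ℝ)
    (hT : ∀ x, ‖ip (T x) (T x)‖ ≤ C ^ 2 * ‖ip x x‖)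
    (hS : ∀ x, ‖ip (S x) (S x)‖ ≤ D ^ 2 * ‖ip x x‖) (h : ∀ x y, ip (T x) y = ip x (S y)) (x : E) :
    Adj.op (extendAdj T S C D hT hS h) (of A E x) = of A E (T x) :=
  extendLin_of _ _ _ x

theorem star_extendAdj (T S : E →ₗ[ℂ] E) (C D : ℝ)
    (hT : ∀ x, ‖ip (T x) (T x)‖ ≤ C ^ 2 * ‖ip x x‖)
    (hS : ∀ x, ‖ip (S x) (S x)‖ ≤ D ^ 2 * ‖ip x x‖) (h : ∀ x y, ip (T x) y = ip x (S y)) (x : E) :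
    Adj.op (star (extendAdj T S C D hT hS h)) (of A E x) = of A E (S x) := by
  rw [extendAdj, Adj.star_mk, Adj.op_mk, extendLin_of]

theorem norm_proj_le (P : E →ₗ[ℂ] E) (h : ∀ x y, ip (P x) y = ip x (P y))
    (hP : ∀ x, P (P x) = P x) (x : E) : ‖ip (P x) (P x)‖ ≤ 1 ^ 2 * ‖ip x x‖ := by
  have hs : ∀ y : E, √‖ip y y‖ ^ 2 = ‖ip y y‖ := fun y => Real.sq_sqrt (norm_nonneg _)
  have h1 : ‖ip (P x) (P x)‖ ≤ √‖ip x x‖ * √‖ip (P x) (P x)‖ := by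
    have h2 : ip (P x) (P x) = ip x (P x) := by rw [h, hP]
    have h3 := norm_ip_le x (P x)
    rwa [← h2] at h3
  rw [one_pow, one_mul]
  nlinarith [hs x, hs (P x), Real.sqrt_nonneg ‖ip x x‖, Real.sqrt_nonneg ‖ip (P x) (P x)‖,
    sq_nonneg (√‖ip x x‖ - √‖ip (P x) (P x)‖)]

theorem adj_ext {S T : Adj A (Completed A E)}
    (h : ∀ x : E, Adj.op S (of A E x) = Adj.op T (of A E x)) : S = T :=
  Adj.ext_op (ind (isClosed_eq (ContinuousLinearMap.continuous _)
    (ContinuousLinearMap.continuous _)) h)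

end PreHilbertModule.Completed

/-! ## Universal C*-algebras -/

/-- A system of relations on a family of generators indexed by `G`, to be satisfied in C*-algebras,
which bounds the norm of each generator. -/
structure CStarRelations.{u} (G : Type u) where
  /-- the families satisfying the relations -/
  Holds : ∀ (B : Type u) [NonUnitalCStarAlgebra B], (G → B) → Prop
  /-- a bound for the norm of each generator -/
  bound : G → ℝ
  norm_le : ∀ (B : Type u) [NonUnitalCStarAlgebra B] (f : G → B), Holds B f →
    ∀ g, ‖f g‖ ≤ bound g

namespace CStarRelations

universe u

variable {G : Type u}

/-- The (not necessarily associative) polynomials in symbols `g` and `g*`. -/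
abbrev Word (G : Type u) : Type u := FreeNonUnitalNonAssocAlgebra ℂ (G ⊕ G)

/-- Evaluation of words at a family of elements of a C*-algebra. -/
def eval {B : Type*} [NonUnitalCStarAlgebra B] (f : G → B) : Word G →ₙₐ[ℂ] B :=
  FreeNonUnitalNonAssocAlgebra.lift ℂ (Sum.elim f fun g => star (f g))

theorem eval_inl {B : Type*} [NonUnitalCStarAlgebra B] (f : G → B) (g : G) :
    eval f (FreeNonUnitalNonAssocAlgebra.of ℂ (Sum.inl g)) = f g :=
  FreeNonUnitalNonAssocAlgebra.lift_of_apply ℂ _ _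

theorem eval_inr {B : Type*} [NonUnitalCStarAlgebra B] (f : G → B) (g : G) :
    eval f (FreeNonUnitalNonAssocAlgebra.of ℂ (Sum.inr g)) = star (f g) :=
  FreeNonUnitalNonAssocAlgebra.lift_of_apply ℂ _ _

theorem map_eval {B C F : Type*} [NonUnitalCStarAlgebra B] [NonUnitalCStarAlgebra C]
    [FunLike F B C] [NonUnitalAlgHomClass F ℂ B C] [StarHomClass F B C]
    (φ : F) (f : G → B) (w : Word G) : φ (eval f w) = eval (fun g => φ (f g)) w := by
  have : ((φ : B →ₙₐ[ℂ] C).comp (eval f)) = eval fun g => φ (f g) := by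
    refine FreeNonUnitalNonAssocAlgebra.hom_ext ℂ (fun g => ?_)
    rcases g with g | g
    · change φ (eval f _) = eval _ _
      rw [eval_inl, eval_inl]
    · change φ (eval f _) = eval _ _
      rw [eval_inr, eval_inr, map_star]
  exact DFunLike.congr_fun this w

theorem mem_adjoin_iff {B : Type*} [NonUnitalCStarAlgebra B] (f : G → B) {b : B}
    (hb : b ∈ NonUnitalStarAlgebra.adjoin ℂ (Set.range f)) : ∃ w, eval f w = b := by
  refine NonUnitalAlgebra.adjoin_induction (p := fun b _ => ∃ w, eval f w = b)
    (fun x hx => ?_) ?_ ?_ ?_ ?_ hb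
  · rcases hx with ⟨g, rfl⟩ | ⟨g, hg⟩
    · exact ⟨_, eval_inl f g⟩
    · refine ⟨_, (eval_inr f g).trans ?_⟩
      rw [hg, star_star]
  · rintro _ _ _ _ ⟨v, rfl⟩ ⟨w, rfl⟩
    exact ⟨v + w, map_add _ _ _⟩
  · exact ⟨0, map_zero _⟩
  · rintro _ _ _ _ ⟨v, rfl⟩ ⟨w, rfl⟩
    exact ⟨v * w, map_mul _ _ _⟩
  · rintro c _ _ ⟨v, rfl⟩
    exact ⟨c • v, map_smul _ _ _⟩

variable (R : CStarRelations G)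

/-- The functions `w ↦ ‖f(w)‖` on words coming from families `f` which satisfy the relations. -/
def IsRepNorm (p : Word G → ℝ) : Prop :=
  ∃ (B : Type u) (_ : NonUnitalCStarAlgebra B) (f : G → B), R.Holds B f ∧
    ∀ w, p w = ‖eval f w‖

/-- An index set for the families satisfying the relations: families which give the same norms of
words are identified. -/
def Index : Type u := {p : Word G → ℝ // R.IsRepNorm p}

/-- The C*-algebra of the family chosen for an index. -/
def Fiber (i : R.Index) : Type u := i.2.choose

instance (i : R.Index) : NonUnitalCStarAlgebra (R.Fiber i) := i.2.choose_spec.choose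

/-- The family chosen for an index. -/
def fam (i : R.Index) : G → R.Fiber i := i.2.choose_spec.choose_spec.choose

theorem fam_holds (i : R.Index) : R.Holds (R.Fiber i) (R.fam i) :=
  i.2.choose_spec.choose_spec.choose_spec.1

theorem norm_fam (i : R.Index) (w : Word G) : ‖eval (R.fam i) w‖ = i.1 w :=
  (i.2.choose_spec.choose_spec.choose_spec.2 w).symm

/-- The diagonal family in the product of the C*-algebras of all families. -/
def diag (g : G) : lp R.Fiber ∞ :=
  ⟨fun i => R.fam i g, memℓp_infty ⟨R.bound g, by
    rintro _ ⟨i, rfl⟩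
    exact R.norm_le _ _ (R.fam_holds i) g⟩⟩

/-- The C*-subalgebra of the product generated by the diagonal family. -/
def sub : NonUnitalStarSubalgebra ℂ (lp R.Fiber ∞) :=
  (NonUnitalStarAlgebra.adjoin ℂ (Set.range R.diag)).topologicalClosure

/-- The universal C*-algebra of a system of relations. -/
def Universal : Type u := R.sub

instance : NonUnitalCStarAlgebra R.Universal :=
  NonUnitalStarSubalgebra.nonUnitalCStarAlgebra R.sub
    (h_closed := NonUnitalStarSubalgebra.isClosed_topologicalClosure _)

/-- The canonical generators of the universal C*-algebra. -/
def gen (g : G) : R.Universal :=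
  ⟨R.diag g, subset_closure (NonUnitalStarAlgebra.subset_adjoin ℂ _ ⟨g, rfl⟩)⟩

/-- Evaluation of an element of the product at an index. -/
def evalAt (i : R.Index) : lp R.Fiber ∞ →⋆ₙₐ[ℂ] R.Fiber i where
  toFun x := x i
  map_smul' _ _ := rfl
  map_zero' := rfl
  map_add' _ _ := rfl
  map_mul' _ _ := rfl
  map_star' _ := rfl

variable {B : Type u} [NonUnitalCStarAlgebra B]

/-- The closure of the graph of the representation given by a family `f`. -/
def graph (f : G → B) : NonUnitalStarSubalgebra ℂ (lp R.Fiber ∞ × B) :=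
  (NonUnitalStarAlgebra.adjoin ℂ (Set.range fun g => (R.diag g, f g))).topologicalClosure

variable {R} {f : G → B}

theorem norm_graph (hf : R.Holds B f) {z : lp R.Fiber ∞ × B} (hz : z ∈ R.graph f) :
    ‖z.2‖ ≤ ‖z.1‖ := by
  refine closure_minimal (s := (NonUnitalStarAlgebra.adjoin ℂ
    (Set.range fun g => (R.diag g, f g)) : Set (lp R.Fiber ∞ × B)))
    (t := {z | ‖z.2‖ ≤ ‖z.1‖}) (fun z hz => ?_)
    (isClosed_le continuous_snd.norm continuous_fst.norm) hz
  obtain ⟨w, rfl⟩ := mem_adjoin_iff _ hz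
  let i : R.Index := ⟨fun w => ‖eval f w‖, B, inferInstance, f, hf, fun _ => rfl⟩
  have h1 : (eval (fun g => (R.diag g, f g)) w).2 = eval f w :=
    map_eval (NonUnitalStarAlgHom.snd ℂ (lp R.Fiber ∞) B) _ w
  have h2 : (eval (fun g => (R.diag g, f g)) w).1 = eval R.diag w :=
    map_eval (NonUnitalStarAlgHom.fst ℂ (lp R.Fiber ∞) B) _ w
  have h3 : (eval R.diag w) i = eval (R.fam i) w := map_eval (R.evalAt i) _ w
  change ‖(eval (fun g => (R.diag g, f g)) w).2‖ ≤ ‖(eval (fun g => (R.diag g, f g)) w).1‖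
  rw [h1, h2]
  calc ‖eval f w‖ = ‖eval (R.fam i) w‖ := (R.norm_fam i w).symm
    _ = ‖(eval R.diag w) i‖ := by rw [h3]
    _ ≤ _ := lp.norm_apply_le_norm ENNReal.top_ne_zero _ i

theorem graph_unique (hf : R.Holds B f) {x : lp R.Fiber ∞} {b c : B} (hb : (x, b) ∈ R.graph f)
    (hc : (x, c) ∈ R.graph f) : b = c := by
  have := norm_graph hf (sub_mem hb hc)
  rw [← sub_eq_zero, ← norm_le_zero_iff]
  simpa using this

theorem graph_exists (hf : R.Holds B f) (x : R.Universal) : ∃ b, (x.1, b) ∈ R.graph f := by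
  have hcl : IsClosed (Prod.fst '' (R.graph f : Set (lp R.Fiber ∞ × B))) := by
    have hgc : IsClosed (R.graph f : Set (lp R.Fiber ∞ × B)) :=
      NonUnitalStarSubalgebra.isClosed_topologicalClosure _
    have hcs : CompleteSpace (R.graph f) := hgc.completeSpace_coe
    have hiso : Isometry fun z : R.graph f => z.1.1 := by
      refine Isometry.of_dist_eq fun y z => ?_
      have := norm_graph hf (sub_mem y.2 z.2)
      rw [dist_eq_norm, Subtype.dist_eq, dist_eq_norm, Prod.norm_def, max_eq_left this]
      rfl
    have := hiso.isClosedEmbedding.isClosed_range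
    convert this using 1
    ext y
    simp
  have hsub : (NonUnitalStarAlgebra.adjoin ℂ (Set.range R.diag) : Set (lp R.Fiber ∞)) ⊆
      Prod.fst '' (R.graph f : Set (lp R.Fiber ∞ × B)) := by
    have : NonUnitalStarAlgebra.adjoin ℂ (Set.range R.diag) ≤
        NonUnitalStarSubalgebra.map (NonUnitalStarAlgHom.fst ℂ (lp R.Fiber ∞) B) (R.graph f) := by
      refine NonUnitalStarAlgebra.adjoin_le ?_
      rintro _ ⟨g, rfl⟩
      exact ⟨(R.diag g, f g), subset_closure (NonUnitalStarAlgebra.subset_adjoin ℂ _ ⟨g, rfl⟩), rfl⟩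
    exact this
  obtain ⟨z, hz, h⟩ := closure_minimal hsub hcl x.2
  exact ⟨z.2, by rw [← h]; exact hz⟩

/-- The universal property: a family satisfying the relations defines a *-homomorphism on the
universal C*-algebra. -/
def lift (hf : R.Holds B f) : R.Universal →⋆ₙₐ[ℂ] B where
  toFun x := (graph_exists hf x).choose
  map_smul' c x := graph_unique hf (graph_exists hf (c • x)).choose_spec
    (SMulMemClass.smul_mem c (graph_exists hf x).choose_spec)
  map_zero' := graph_unique hf (graph_exists hf 0).choose_spec (zero_mem (R.graph f))
  map_add' x y := graph_unique hf (graph_exists hf (x + y)).choose_spec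
    (add_mem (graph_exists hf x).choose_spec (graph_exists hf y).choose_spec)
  map_mul' x y := graph_unique hf (graph_exists hf (x * y)).choose_spec
    (mul_mem (graph_exists hf x).choose_spec (graph_exists hf y).choose_spec)
  map_star' x := graph_unique hf (graph_exists hf (star x)).choose_spec
    (star_mem (graph_exists hf x).choose_spec)

theorem lift_gen (hf : R.Holds B f) (g : G) : lift hf (R.gen g) = f g :=
  graph_unique hf (graph_exists hf (R.gen g)).choose_spec
    (subset_closure (NonUnitalStarAlgebra.subset_adjoin ℂ _ ⟨g, rfl⟩))

/-- The projection of the universal C*-algebra to the algebra of a chosen family. -/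
def proj (i : R.Index) : R.Universal →⋆ₙₐ[ℂ] R.Fiber i where
  toFun x := x.1 i
  map_smul' _ _ := rfl
  map_zero' := rfl
  map_add' _ _ := rfl
  map_mul' _ _ := rfl
  map_star' _ := rfl

theorem proj_gen (i : R.Index) (g : G) : proj i (R.gen g) = R.fam i g := rfl

theorem ext_proj {x y : R.Universal} (h : ∀ i, proj i x = proj i y) : x = y :=
  Subtype.ext (lp.ext (funext h))

end CStarRelations

/-! ## C*-correspondences and Cuntz-Pimsner algebras

A C*-correspondence over `A` is a Hilbert `A`-module `X` with a *-homomorphism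
`φ : A →⋆ₙₐ[ℂ] L(X)`. -/

namespace Correspondence

open PreHilbertModule HilbertModule

universe u

variable {A X : Type u} [NonUnitalCStarAlgebra A] [NormedAddCommGroup X] [NormedSpace ℂ X]
  [HilbertModule A X] (φ : A →⋆ₙₐ[ℂ] Adj A X)

/-- The Katsura ideal `J_X = (ker φ)^⊥ ∩ φ⁻¹(K(X))`. -/
def katsuraIdeal : Set A :=
  {a | (∀ b, φ b = 0 → a * b = 0) ∧ φ a ∈ Adj.compacts A X}

/-- Representations `(ψ, π)` of a correspondence in a C*-algebra. -/
structure IsRepresentation {B : Type*} [NonUnitalCStarAlgebra B] (ψ : X →ₗ[ℂ] B)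
    (π : A →⋆ₙₐ[ℂ] B) : Prop where
  right : ∀ x a, ψ x * π a = ψ (act x a)
  left : ∀ a x, π a * ψ x = ψ (Adj.op (φ a) x)
  ip : ∀ x y, star (ψ x) * ψ y = π (ip x y)

/-- A *-homomorphism `κ` on `K(X)` with `κ(θ_{x,y}) = ψ(x)ψ(y)*`. There is exactly one when
`(ψ, π)` is a representation, and it is denoted `(ψ, π)^(1)`. -/
def IsInduced {B : Type*} [NonUnitalCStarAlgebra B] (ψ : X →ₗ[ℂ] B)
    (κ : Adj.compacts A X →⋆ₙₐ[ℂ] B) : Prop :=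
  ∀ x y : X, κ ⟨Adj.theta x y, Adj.theta_mem_compacts x y⟩ = ψ x * star (ψ y)

/-- Covariant representations: `(ψ, π)^(1)(φ(a)) = π(a)` for all `a` in the Katsura ideal. -/
def IsCovariant {B : Type*} [NonUnitalCStarAlgebra B] (ψ : X →ₗ[ℂ] B) (π : A →⋆ₙₐ[ℂ] B) : Prop :=
  IsRepresentation φ ψ π ∧ ∃ κ : Adj.compacts A X →⋆ₙₐ[ℂ] B, IsInduced ψ κ ∧
    ∀ a (ha : a ∈ katsuraIdeal φ), κ ⟨φ a, ha.2⟩ = π a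

/-- The relations of the Cuntz-Pimsner algebra: the generators are the elements of `X` and of `A`,
and a family satisfies the relations when it is a covariant representation. -/
def relations : CStarRelations (X ⊕ A) where
  Holds B _ f := ∃ (ψ : X →ₗ[ℂ] B) (π : A →⋆ₙₐ[ℂ] B), IsCovariant φ ψ π ∧ f = Sum.elim ψ π
  bound := Sum.elim norm norm
  norm_le B _ f := by
    rintro ⟨ψ, π, h, rfl⟩ (x | a)
    · refine (sq_le_sq₀ (norm_nonneg _) (norm_nonneg _)).mp ?_
      change ‖ψ x‖ ^ 2 ≤ ‖x‖ ^ 2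
      rw [norm_sq x, sq, ← CStarRing.norm_star_mul_self, h.1.ip]
      exact NonUnitalStarAlgHom.norm_apply_le π _
    · exact NonUnitalStarAlgHom.norm_apply_le π a

/-- The Cuntz-Pimsner algebra `O(X)`. -/
abbrev CuntzPimsner : Type u := (relations φ).Universal

/-- The map `ψ_u : X → O(X)` of the universal covariant representation. -/
def psiU (x : X) : CuntzPimsner φ := (relations φ).gen (Sum.inl x)

/-- The map `π_u : A → O(X)` of the universal covariant representation. -/
def piU (a : A) : CuntzPimsner φ := (relations φ).gen (Sum.inr a)

/-- `(θ, U)` is an isomorphism from the correspondence `(X, φ)` over `A` to the correspondence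
`(X', φ')` over `A'`. -/
structure IsIso {A' X' : Type*} [NonUnitalCStarAlgebra A'] [NormedAddCommGroup X']
    [NormedSpace ℂ X'] [HilbertModule A' X'] (φ' : A' →⋆ₙₐ[ℂ] Adj A' X')
    (θ : A ≃⋆ₐ[ℂ] A') (U : X ≃ₗ[ℂ] X') : Prop where
  ip : ∀ x y, PreHilbertModule.ip (U x) (U y) = θ (PreHilbertModule.ip x y)
  right : ∀ x a, U (act x a) = act (U x) (θ a)
  left : ∀ a x, U (Adj.op (φ a) x) = Adj.op (φ' (θ a)) (U x)

end Correspondence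

/-! ## Ordinal graphs -/

open CategoryTheory Ordinal

/-- An ordinal graph: a small category with a functor `d` into the ordinals (a category with one
object, composition being addition) which has the factorization property. A product `fg` of
morphisms with `s(f) = r(g)` is the composite `g ≫ f`. -/
structure OrdinalGraph.{u, w} where
  /-- the objects (vertices) -/
  Vert : Type u
  [cat : SmallCategory Vert]
  /-- the length of a morphism -/
  deg : ∀ {a b : Vert}, (a ⟶ b) → Ordinal.{w}
  deg_id : ∀ a : Vert, deg (𝟙 a) = 0
  deg_comp : ∀ {a b c : Vert} (g : a ⟶ b) (f : b ⟶ c), deg (g ≫ f) = deg f + deg g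
  factor : ∀ {a b : Vert} (e : a ⟶ b) (α : Ordinal.{w}), α ≤ deg e →
    ∃! p : Σ c : Vert, (a ⟶ c) × (c ⟶ b), deg p.2.2 = α ∧ p.2.1 ≫ p.2.2 = e

namespace OrdinalGraph

universe u w

attribute [instance] OrdinalGraph.cat

/-- A morphism of the category, with its source and range. -/
@[ext]
structure Path (Λ : OrdinalGraph.{u, w}) : Type u where
  /-- the source `s(e)` -/
  src : Λ.Vert
  /-- the range `r(e)` -/
  rng : Λ.Vert
  /-- the morphism -/
  hom : src ⟶ rng

variable {Λ : OrdinalGraph.{u, w}}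

/-- The length of a path. -/
def Path.d (p : Λ.Path) : Ordinal.{w} := Λ.deg p.hom

variable (Λ) in
/-- The identity morphism of a vertex, identified with the vertex. -/
def idPath (v : Λ.Vert) : Λ.Path := ⟨v, v, 𝟙 v⟩

/-- `Comp e f g` says that `e` and `f` are composable (`s(e) = r(f)`) and `ef = g`. -/
inductive Comp : Λ.Path → Λ.Path → Λ.Path → Prop
  | mk {a b c : Λ.Vert} (f : a ⟶ b) (e : b ⟶ c) : Comp ⟨b, c, e⟩ ⟨a, b, f⟩ ⟨a, c, f ≫ e⟩

theorem Comp.deg {e f g : Λ.Path} (h : Comp e f g) : g.d = e.d + f.d := by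
  cases h; exact Λ.deg_comp _ _

variable (Λ) in
/-- The ordinal graph `Λ_α` of morphisms of length less than `ω ^ α`. -/
def below (α : Ordinal.{w}) : OrdinalGraph.{u, w} where
  Vert := Λ.Vert
  cat :=
    { Hom := fun a b => {e : a ⟶ b // Λ.deg e < ω ^ α}
      id := fun a => ⟨𝟙 a, by rw [Λ.deg_id]; exact opow_pos α omega0_pos⟩
      comp := fun f g => ⟨f.1 ≫ g.1, by
        rw [Λ.deg_comp]; exact isPrincipal_add_omega0_opow α g.2 f.2⟩
      id_comp := fun f => Subtype.ext (Category.id_comp f.1)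
      comp_id := fun f => Subtype.ext (Category.comp_id f.1)
      assoc := fun f g h => Subtype.ext (Category.assoc f.1 g.1 h.1) }
  deg e := Λ.deg e.1
  deg_id a := Λ.deg_id a
  deg_comp g f := Λ.deg_comp g.1 f.1
  factor {a b} e β hβ := by
    obtain ⟨⟨c, g, f⟩, ⟨h1, h2⟩, h3⟩ := Λ.factor e.1 β hβ
    have hd : Λ.deg e.1 = Λ.deg f + Λ.deg g := by rw [← h2]; exact Λ.deg_comp _ _
    have hf : Λ.deg f < ω ^ α := lt_of_le_of_lt (hd ▸ le_self_add) e.2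
    have hg : Λ.deg g < ω ^ α := lt_of_le_of_lt (hd ▸ le_add_self) e.2
    refine ⟨⟨c, ⟨g, hg⟩, ⟨f, hf⟩⟩, ⟨h1, Subtype.ext h2⟩, ?_⟩
    rintro ⟨c', ⟨g', hg'⟩, ⟨f', hf'⟩⟩ ⟨h1', h2'⟩
    have := h3 ⟨c', g', f'⟩ ⟨h1', congrArg Subtype.val h2'⟩
    cases this
    rfl

variable (Λ) in
/-- A directed graph is an ordinal graph `Λ` with `Λ = Λ_1`. -/
def IsDirectedGraph : Prop := ∀ e : Λ.Path, e.d < ω ^ (1 : Ordinal.{w})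

theorem eq_idPath (e : Λ.Path) (he : e.d = 0) : e = Λ.idPath e.rng := by
  obtain ⟨a, b, e⟩ := e
  change Λ.deg e = 0 at he
  have h := (Λ.factor e 0 zero_le).unique (y₁ := ⟨a, 𝟙 a, e⟩) (y₂ := ⟨b, e, 𝟙 b⟩)
    ⟨he, Category.id_comp e⟩ ⟨Λ.deg_id b, Category.comp_id e⟩
  cases h
  rfl

theorem idPath_d (v : Λ.Vert) : (Λ.idPath v).d = 0 := Λ.deg_id v

/-- A vertex `v` is `α`-source-regular if for every `e ∈ vΛ_α` there is `f ∈ s(e)Λ^(ω^α)`. -/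
def SourceRegular (α : Ordinal.{w}) (v : Λ.Vert) : Prop :=
  ∀ e : Λ.Path, e.rng = v → e.d < ω ^ α → ∃ f : Λ.Path, f.rng = e.src ∧ f.d = ω ^ α

/-- A vertex `v` is `α`-row-finite if `vΛ^(ω^α)` is finite. -/
def RowFinite (α : Ordinal.{w}) (v : Λ.Vert) : Prop :=
  {f : Λ.Path | f.rng = v ∧ f.d = ω ^ α}.Finite

/-- `α`-regular vertices. -/
def Regular (α : Ordinal.{w}) (v : Λ.Vert) : Prop := SourceRegular α v ∧ RowFinite α v

/-! ### The C*-algebra of an ordinal graph -/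

variable (Λ) in
/-- The generators of `O(Λ)`: vertices, and paths whose length is a power of `ω`. -/
abbrev Gen : Type u := {e : Λ.Path // e.d = 0 ∨ ∃ α : Ordinal.{w}, e.d = ω ^ α}

variable (Λ) in
/-- The generator of a vertex. -/
def vertGen (v : Λ.Vert) : Λ.Gen := ⟨Λ.idPath v, Or.inl (idPath_d v)⟩

variable (Λ) in
/-- The set `Λ^(ω^α)`. -/
abbrev Edge (α : Ordinal.{w}) : Type u := {e : Λ.Path // e.d = ω ^ α}

/-- The generator of a path whose length is a power of `ω`. -/
def edgeGen {α : Ordinal.{w}} (e : Λ.Edge α) : Λ.Gen := ⟨e.1, Or.inr ⟨α, e.2⟩⟩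

/-- Cuntz-Krieger families for an ordinal graph in a C*-algebra. In (4) the sum is over the finite
set `vΛ^(ω^α)`. -/
structure IsCuntzKrieger {B : Type*} [NonUnitalCStarAlgebra B] (T : Λ.Gen → B) : Prop where
  partial_isometry : ∀ e, T e * star (T e) * T e = T e
  rel1 : ∀ e : Λ.Gen, star (T e) * T e = T (Λ.vertGen e.1.src)
  rel2 : ∀ e f g : Λ.Gen, Comp e.1 f.1 g.1 → e.1.d < f.1.d → T e * T f = T g
  rel3 : ∀ e f : Λ.Gen, (¬ ∃ g h k : Λ.Path, Comp e.1 g k ∧ Comp f.1 h k) → star (T e) * T f = 0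
  rel4 : ∀ (α : Ordinal.{w}) (v : Λ.Vert), Regular α v →
    T (Λ.vertGen v) = ∑ᶠ e : {e : Λ.Edge α // e.1.rng = v}, T (edgeGen e.1) * star (T (edgeGen e.1))

/-- In relation (2) the product of two generators is a generator. -/
theorem Comp.isGen {e f : Λ.Gen} {g : Λ.Path} (h : Comp e.1 f.1 g) (hd : e.1.d < f.1.d) :
    ∃ g' : Λ.Gen, g'.1 = g := by
  rcases f.2 with h0 | ⟨α, hα⟩
  · rw [h0] at hd
    exact absurd hd (not_lt.mpr zero_le)
  · refine ⟨⟨g, Or.inr ⟨α, ?_⟩⟩, rfl⟩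
    rw [h.deg, hα]
    exact add_omega0_opow (hα ▸ hd)

theorem IsCuntzKrieger.norm_le {B : Type*} [NonUnitalCStarAlgebra B] {T : Λ.Gen → B}
    (h : IsCuntzKrieger T) (e : Λ.Gen) : ‖T e‖ ≤ 1 := by
  have hv : ∀ v, ‖T (Λ.vertGen v)‖ ≤ 1 := fun v => by
    have h1 : ‖T (Λ.vertGen v)‖ * ‖T (Λ.vertGen v)‖ = ‖T (Λ.vertGen v)‖ := by
      rw [← CStarRing.norm_star_mul_self, h.rel1]; rfl
    nlinarith [norm_nonneg (T (Λ.vertGen v))]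
  have h2 : ‖T e‖ * ‖T e‖ ≤ 1 := by
    rw [← CStarRing.norm_star_mul_self, h.rel1]; exact hv _
  nlinarith [norm_nonneg (T e)]

variable (Λ) in
/-- The relations of `O(Λ)`. -/
def relations : CStarRelations Λ.Gen where
  Holds _ _ T := IsCuntzKrieger T
  bound _ := 1
  norm_le _ _ _ h e := h.norm_le e

variable (Λ) in
/-- The C*-algebra `O(Λ)`, universal for Cuntz-Krieger families. -/
abbrev O : Type u := Λ.relations.Universal

variable (Λ) in
/-- The canonical generators `T_e` of `O(Λ)`. -/
def T (e : Λ.Gen) : Λ.O := Λ.relations.gen e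

/-! ### The Hilbert module `X_α` -/

open PreHilbertModule HilbertModule

variable (Λ) in
/-- The module of finitely supported functions `f : Λ^(ω^α) → O(Λ_α)` such that
`T_{s(e)} f(e) = f(e)`. -/
def preX (α : Ordinal.{w}) : Submodule ℂ (Λ.Edge α →₀ (Λ.below α).O) where
  carrier := {f | ∀ e, (Λ.below α).T ((Λ.below α).vertGen e.1.src) * f e = f e}
  add_mem' {f g} hf hg e := by rw [Finsupp.add_apply, mul_add, hf, hg]
  zero_mem' e := by rw [Finsupp.zero_apply, mul_zero]
  smul_mem' c f hf e := by rw [Finsupp.smul_apply, mul_smul_comm, hf]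

variable (Λ) in
/-- The canonical generators of `O(Λ)` form a Cuntz-Krieger family. -/
theorem isCuntzKrieger_T : IsCuntzKrieger Λ.T where
  partial_isometry e := CStarRelations.ext_proj fun i => by
    simp only [map_mul, map_star, T, CStarRelations.proj_gen]
    exact (Λ.relations.fam_holds i).partial_isometry e
  rel1 e := CStarRelations.ext_proj fun i => by
    simp only [map_mul, map_star, T, CStarRelations.proj_gen]
    exact (Λ.relations.fam_holds i).rel1 e
  rel2 e f g h hd := CStarRelations.ext_proj fun i => by
    simp only [map_mul, T, CStarRelations.proj_gen]
    exact (Λ.relations.fam_holds i).rel2 e f g h hd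
  rel3 e f h := CStarRelations.ext_proj fun i => by
    simp only [map_mul, map_star, map_zero, T, CStarRelations.proj_gen]
    exact (Λ.relations.fam_holds i).rel3 e f h
  rel4 α v h := CStarRelations.ext_proj fun i => by
    have hfin : Finite {e : Λ.Edge α // e.1.rng = v} := by
      have : Finite {f : Λ.Path | f.rng = v ∧ f.d = ω ^ α} := h.2
      refine Finite.of_injective (β := {f : Λ.Path | f.rng = v ∧ f.d = ω ^ α})
        (fun e => ⟨e.1.1, e.2, e.1.2⟩) fun e e' hee => ?_
      exact Subtype.ext (Subtype.ext (Subtype.mk.inj hee))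
    rw [← AddMonoidHom.coe_coe, AddMonoidHom.map_finsum _ (Set.toFinite _)]
    simp only [AddMonoidHom.coe_coe, map_mul, map_star, T, CStarRelations.proj_gen]
    exact (Λ.relations.fam_holds i).rel4 α v h

theorem T_vert_mul_self (v : Λ.Vert) :
    Λ.T (Λ.vertGen v) * Λ.T (Λ.vertGen v) = Λ.T (Λ.vertGen v) := by
  have h := (isCuntzKrieger_T Λ).rel1 (Λ.vertGen v)
  have hs : star (Λ.T (Λ.vertGen v)) = Λ.T (Λ.vertGen v) := by
    change star (Λ.T (Λ.vertGen v)) * _ = Λ.T (Λ.vertGen v) at h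
    rw [← h, star_mul, star_star]
  rwa [hs] at h

variable {α : Ordinal.{w}}

theorem preX_ext {x y : Λ.preX α} (h : ∀ e, x.1 e = y.1 e) : x = y :=
  Subtype.ext (Finsupp.ext h)

/-- The right action `(x · a)(e) = x(e) a` on `X_α°`. -/
def preXAct (x : Λ.preX α) (a : (Λ.below α).O) : Λ.preX α :=
  ⟨x.1.mapRange (fun b => b * a) (zero_mul a), fun e =>
    (mul_assoc _ _ _).symm.trans (congrArg (fun b => b * a) (x.2 e))⟩

/-- The inner product `⟨x, y⟩ = ∑ x(e)* y(e)` on `X_α°`. -/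
def preXInner (x y : Λ.preX α) : (Λ.below α).O := y.1.sum fun e b => star (x.1 e) * b

theorem preXInner_eq (x y : Λ.preX α) {s : Finset (Λ.Edge α)} (h : y.1.support ⊆ s) :
    preXInner x y = ∑ e ∈ s, star (x.1 e) * y.1 e :=
  Finsupp.sum_of_support_subset _ h _ fun _ _ => mul_zero _

instance : PreHilbertModule (Λ.below α).O (Λ.preX α) where
  act := preXAct
  ip := preXInner
  ip_add_right x y z := Finsupp.sum_add_index' (fun _ => mul_zero _) fun _ _ _ => mul_add _ _ _
  ip_smul_right c x y := by
    refine (Finsupp.sum_smul_index' (g := y.1) (b := c)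
      (h := fun e b => star (x.1 e) * b) fun _ => mul_zero _).trans ?_
    simp only [mul_smul_comm]
    exact Finsupp.smul_sum.symm
  ip_act_right x y a := by
    rw [preXInner_eq x (preXAct y a) (s := y.1.support)
      (Finsupp.support_mapRange (hf := zero_mul a)), preXInner,
      Finsupp.sum, Finset.sum_mul]
    refine Finset.sum_congr rfl fun e _ => ?_
    rw [mul_assoc]; rfl
  star_ip x y := by
    classical
    rw [preXInner_eq x y (s := x.1.support ∪ y.1.support) Finset.subset_union_right,
      preXInner_eq y x (s := x.1.support ∪ y.1.support) Finset.subset_union_left, star_sum]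
    refine Finset.sum_congr rfl fun e _ => ?_
    rw [star_mul, star_star]
  ip_self_pos x := by
    let _ : PartialOrder (Λ.below α).O := CStarAlgebra.spectralOrder _
    have _ : StarOrderedRing (Λ.below α).O := CStarAlgebra.spectralOrderedRing _
    refine CStarAlgebra.nonneg_iff_eq_star_mul_self.mp ?_
    exact Finset.sum_nonneg fun e _ => star_mul_self_nonneg _
  eq_zero_of_ip_self x h := by
    let _ : PartialOrder (Λ.below α).O := CStarAlgebra.spectralOrder _
    have _ : StarOrderedRing (Λ.below α).O := CStarAlgebra.spectralOrderedRing _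
    rw [preXInner, Finsupp.sum,
      Finset.sum_eq_zero_iff_of_nonneg fun e _ => star_mul_self_nonneg _] at h
    refine preX_ext fun e => ?_
    by_cases he : e ∈ x.1.support
    · exact CStarRing.star_mul_self_eq_zero_iff _ |>.mp (h e he)
    · exact Finsupp.notMem_support_iff.mp he

variable (Λ) in
/-- The Hilbert module `X_α` over `O(Λ_α)`. -/
abbrev X (α : Ordinal.{w}) : Type u := Completed (Λ.below α).O (Λ.preX α)

/-- The element `δ_e` of `X_α°`, with value `T_{s(e)}` at `e` and `0` elsewhere. -/
def preDelta (e : Λ.Edge α) : Λ.preX α :=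
  ⟨Finsupp.single e ((Λ.below α).T ((Λ.below α).vertGen e.1.src)), fun f => by
    classical
    rw [Finsupp.single_apply]
    split_ifs with h
    · subst h; exact T_vert_mul_self _
    · exact mul_zero _⟩

/-- The element `δ_e` of `X_α`. -/
def delta (e : Λ.Edge α) : Λ.X α := Completed.of _ _ (preDelta e)

/-! ### The left action on `X_0` -/

open scoped Classical in
/-- The operator on `X_0°` given by `x ↦ x(e)` for `r(e) = v` and `0` for `r(e) ≠ v`. -/
def cutLin (v : Λ.Vert) : Λ.preX α →ₗ[ℂ] Λ.preX α where
  toFun x := ⟨x.1.filter fun e => e.1.rng = v, fun e => by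
    rw [Finsupp.filter_apply]
    split_ifs
    · exact x.2 e
    · exact mul_zero _⟩
  map_add' x y := Subtype.ext Finsupp.filter_add
  map_smul' c x := Subtype.ext Finsupp.filter_smul

open scoped Classical in
theorem cutLin_apply (v : Λ.Vert) (x : Λ.preX α) (e : Λ.Edge α) :
    (cutLin v x).1 e = if e.1.rng = v then x.1 e else 0 := Finsupp.filter_apply _ _ _

theorem ip_cutLin (v : Λ.Vert) (x y : Λ.preX α) : ip (cutLin v x) y = ip x (cutLin v y) := by
  classical
  change preXInner _ _ = preXInner _ _
  rw [preXInner_eq _ y subset_rfl, preXInner_eq x (cutLin v y) (s := y.1.support)]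
  · refine Finset.sum_congr rfl fun e _ => ?_
    rw [cutLin_apply, cutLin_apply]
    split_ifs <;> simp
  · exact (Finsupp.support_filter _ _).trans_subset (Finset.filter_subset _ _)

theorem cutLin_cutLin (v : Λ.Vert) (x : Λ.preX α) : cutLin v (cutLin v x) = cutLin v x := by
  classical
  refine preX_ext fun e => ?_
  rw [cutLin_apply, cutLin_apply]
  split_ifs <;> rfl

theorem cutLin_of_ne {v v' : Λ.Vert} (h : v ≠ v') (x : Λ.preX α) :
    cutLin v (cutLin v' x) = 0 := by
  classical
  refine preX_ext fun e => ?_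
  rw [cutLin_apply, cutLin_apply]
  split_ifs with h1 h2
  · exact absurd (h1.symm.trans h2) h
  · rfl
  · rfl

/-- The extension of `cutLin v` to an adjointable operator. -/
def cut (v : Λ.Vert) : Adj (Λ.below α).O (Λ.X α) :=
  Completed.extendAdj (cutLin v) (cutLin v) 1 1
    (Completed.norm_proj_le _ (ip_cutLin v) (cutLin_cutLin v))
    (Completed.norm_proj_le _ (ip_cutLin v) (cutLin_cutLin v)) (ip_cutLin v)

theorem cut_of (v : Λ.Vert) (x : Λ.preX α) :
    Adj.op (cut v) (Completed.of _ _ x) = Completed.of _ _ (cutLin v x) :=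
  Completed.extendAdj_of _ _ _ _ _ _ _ x

theorem star_cut (v : Λ.Vert) : star (cut v : Adj (Λ.below α).O (Λ.X α)) = cut v :=
  Completed.adj_ext fun x => by
    rw [cut_of, cut, Completed.star_extendAdj]

theorem cut_mul_cut (v : Λ.Vert) : (cut v * cut v : Adj (Λ.below α).O (Λ.X α)) = cut v :=
  Completed.adj_ext fun x => by
    rw [Adj.op_mul, cut_of, cut_of, cutLin_cutLin]

theorem cut_mul_cut_of_ne {v v' : Λ.Vert} (h : v ≠ v') :
    (cut v * cut v' : Adj (Λ.below α).O (Λ.X α)) = 0 :=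
  Completed.adj_ext fun x => by
    rw [Adj.op_mul, cut_of, cut_of, cutLin_of_ne h, map_zero, Adj.op_zero]

theorem star_cut_mul_cut (v : Λ.Vert) :
    (star (cut v) * cut v : Adj (Λ.below α).O (Λ.X α)) = cut v := by
  rw [star_cut, cut_mul_cut]

theorem star_cut_mul_cut' (v : Λ.Vert) :
    (cut v * star (cut v) * cut v : Adj (Λ.below α).O (Λ.X α)) = cut v := by
  rw [star_cut, cut_mul_cut, cut_mul_cut]

theorem star_cut_mul_cut_of_ne {v v' : Λ.Vert} (h : v ≠ v') :
    (star (cut v) * cut v' : Adj (Λ.below α).O (Λ.X α)) = 0 := by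
  rw [star_cut, cut_mul_cut_of_ne h]

theorem d_below_zero (e : (Λ.below 0).Path) : e.d = 0 := by
  have h : Λ.deg e.hom.1 < ω ^ (0 : Ordinal) := e.hom.2
  have h1 : ω ^ (0 : Ordinal.{w}) = 1 := opow_zero _
  exact Order.lt_one_iff.mp (h.trans_eq h1)

variable (Λ) in
/-- The operators `cut v`, indexed by the generators of `O(Λ_0)`, which are vertices. -/
def cutFam (e : (Λ.below 0).Gen) : Adj (Λ.below 0).O (Λ.X 0) := cut (Λ := Λ) e.1.rng

variable (Λ) in
/-- The operators `cut v` form a Cuntz-Krieger family for `Λ_0`. -/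
theorem isCuntzKrieger_cut : IsCuntzKrieger Λ.cutFam where
  partial_isometry e := star_cut_mul_cut' (Λ := Λ) e.1.rng
  rel1 e := by
    have h : e.1.src = e.1.rng := by
      conv_lhs => rw [eq_idPath e.1 (d_below_zero e.1)]
      rfl
    exact (star_cut_mul_cut (Λ := Λ) e.1.rng).trans (congrArg (cut (Λ := Λ)) h.symm)
  rel2 e f g _ hd := by
    rw [d_below_zero, d_below_zero] at hd
    exact absurd hd (lt_irrefl _)
  rel3 e f h := by
    refine star_cut_mul_cut_of_ne (Λ := Λ) fun hr => h ?_
    rw [eq_idPath e.1 (d_below_zero e.1), eq_idPath f.1 (d_below_zero f.1), hr]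
    exact ⟨_, _, _, .mk (𝟙 f.1.rng) (𝟙 f.1.rng), .mk (𝟙 f.1.rng) (𝟙 f.1.rng)⟩
  rel4 β v h := by
    obtain ⟨f, _, hf⟩ := h.1 ((Λ.below 0).idPath v) rfl
      (by rw [idPath_d]; exact opow_pos β omega0_pos)
    rw [d_below_zero] at hf
    exact absurd hf (opow_pos β omega0_pos).ne

variable (Λ) in
/-- The left action `φ_0 : O(Λ_0) → L(X_0)`, determined by the operators `φ_0(T_v)`. -/
def leftAction : (Λ.below 0).O →⋆ₙₐ[ℂ] Adj (Λ.below 0).O (Λ.X 0) :=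
  CStarRelations.lift (R := (Λ.below 0).relations) (isCuntzKrieger_cut Λ)

open scoped Classical in
/-- `(φ_0(T_v) x)(e)` is `x(e)` if `e ∈ vΛ` and `0` otherwise. -/
theorem leftAction_T (v : Λ.Vert) (x : Λ.preX 0) :
    ∃ y : Λ.preX 0, Adj.op (Λ.leftAction ((Λ.below 0).T ((Λ.below 0).vertGen v)))
      (Completed.of _ _ x) = Completed.of _ _ y ∧
      ∀ e, y.1 e = if e.1.rng = v then x.1 e else 0 := by
  refine ⟨cutLin v x, ?_, cutLin_apply v x⟩
  have : Λ.leftAction ((Λ.below 0).T ((Λ.below 0).vertGen v)) = cut v :=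
    CStarRelations.lift_gen _ _
  rw [this, cut_of]

/-! ### The C*-correspondence of a directed graph -/

/-- The set of vertices is regarded as a discrete space. -/
instance : TopologicalSpace Λ.Vert := ⊥

instance : DiscreteTopology Λ.Vert := ⟨rfl⟩

open scoped ZeroAtInfty

variable (Λ) in
/-- The C*-algebra `c_0(Λ_0)` of functions on the vertices vanishing at infinity. -/
abbrev c0 : Type u := C₀(Λ.Vert, ℂ)

/-- A finitely supported function as an element of `c_0(Λ_0)`. -/
def c0Of (F : Λ.Vert → ℂ) (hF : F.support.Finite) : C₀(Λ.Vert, ℂ) where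
  toFun := F
  continuous_toFun := continuous_of_discreteTopology
  zero_at_infty' := by
    rw [Filter.cocompact_eq_cofinite]
    refine tendsto_const_nhds.congr' ?_
    filter_upwards [hF.compl_mem_cofinite] with v hv
    exact (Function.notMem_support.mp hv).symm

open scoped Classical in
/-- The indicator function `1_v` of a vertex. -/
def c0Single (v : Λ.Vert) : C₀(Λ.Vert, ℂ) :=
  c0Of (Pi.single v 1) ((Set.finite_singleton v).subset Pi.support_single_subset)

variable (Λ) in
/-- The space `c_c(Λ^1)` of finitely supported functions on the edges. -/
abbrev preY : Type u := Λ.Edge 0 →₀ ℂ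

/-- Pointwise multiplication of a finitely supported function on edges by a function on edges. -/
def mulFun (k : Λ.Edge 0 → ℂ) : Λ.preY →ₗ[ℂ] Λ.preY where
  toFun f := Finsupp.onFinset f.support (fun e => k e * f e)
    fun _ he => Finsupp.mem_support_iff.mpr (right_ne_zero_of_mul he)
  map_add' _ _ := Finsupp.ext fun _ => mul_add _ _ _
  map_smul' _ _ := Finsupp.ext fun _ => mul_left_comm _ _ _

theorem support_mulFun (k : Λ.Edge 0 → ℂ) (f : Λ.preY) :
    (mulFun k f).support ⊆ f.support := fun _ he =>
  Finsupp.mem_support_iff.mpr (right_ne_zero_of_mul (Finsupp.mem_support_iff.mp he))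

open scoped Classical in
/-- The function `v ↦ ∑_{s(e) = v} conj(f(e)) g(e)`. -/
def preYFun (f g : Λ.preY) (v : Λ.Vert) : ℂ :=
  ∑ e ∈ g.support with e.1.src = v, star (f e) * g e

open scoped Classical in
theorem preYFun_eq (f g : Λ.preY) (v : Λ.Vert) {s : Finset (Λ.Edge 0)}
    (h : g.support ⊆ s) : preYFun f g v = ∑ e ∈ s with e.1.src = v, star (f e) * g e := by
  refine Finset.sum_subset (Finset.filter_subset_filter _ h) fun e he he' => ?_
  rw [Finset.mem_filter] at he he'
  have : g e = 0 := by
    by_contra h0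
    exact he' ⟨Finsupp.mem_support_iff.mpr h0, he.2⟩
  rw [this, mul_zero]

theorem preYFun_finite (f g : Λ.preY) : (preYFun f g).support.Finite := by
  classical
  refine (g.support.image fun e => e.1.src).finite_toSet.subset fun v hv => ?_
  obtain ⟨e, he, _⟩ := Finset.exists_ne_zero_of_sum_ne_zero hv
  rw [Finset.mem_filter] at he
  exact Finset.mem_coe.mpr (Finset.mem_image.mpr ⟨e, he⟩)

open scoped Classical in
theorem preYFun_self (f : Λ.preY) (v : Λ.Vert) :
    preYFun f f v = ((∑ e ∈ f.support with e.1.src = v, ‖f e‖ ^ 2 : ℝ) : ℂ) := by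
  rw [preYFun, Complex.ofReal_sum]
  refine Finset.sum_congr rfl fun e _ => ?_
  rw [Complex.ofReal_pow]
  exact Complex.conj_mul' _

/-- On `c_c(Λ^1)`: `(f · h)(e) = f(e) h(s(e))` and `⟨f, g⟩(v) = ∑_{s(e) = v} conj(f(e)) g(e)`. -/
instance : PreHilbertModule C₀(Λ.Vert, ℂ) Λ.preY where
  act f h := mulFun (fun e => h e.1.src) f
  ip f g := c0Of (preYFun f g) (preYFun_finite f g)
  ip_add_right f g h := by
    classical
    ext v
    change preYFun f _ v = preYFun f g v + preYFun f h v
    rw [preYFun_eq f g v (s := g.support ∪ h.support) Finset.subset_union_left,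
      preYFun_eq f h v (s := g.support ∪ h.support) Finset.subset_union_right,
      preYFun_eq f _ v (s := g.support ∪ h.support) Finsupp.support_add,
      ← Finset.sum_add_distrib]
    exact Finset.sum_congr rfl fun e _ => mul_add _ _ _
  ip_smul_right c f g := by
    classical
    ext v
    change preYFun f _ v = c * preYFun f g v
    rw [preYFun_eq f _ v (s := g.support) Finsupp.support_smul, preYFun, Finset.mul_sum]
    exact Finset.sum_congr rfl fun e _ => mul_left_comm _ _ _
  ip_act_right f g h := by
    classical
    ext v
    change preYFun f _ v = preYFun f g v * h v
    rw [preYFun_eq f _ v (s := g.support) (support_mulFun _ g), preYFun,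
      Finset.sum_mul]
    refine Finset.sum_congr rfl fun e he => ?_
    rw [← (Finset.mem_filter.mp he).2]
    change star _ * (h e.1.src * _) = _
    ring
  star_ip f g := by
    classical
    ext v
    change star (preYFun f g v) = preYFun g f v
    rw [preYFun_eq f g v (s := f.support ∪ g.support) Finset.subset_union_right,
      preYFun_eq g f v (s := f.support ∪ g.support) Finset.subset_union_left,
      star_sum]
    refine Finset.sum_congr rfl fun e _ => ?_
    rw [star_mul, star_star]
  ip_self_pos f := by
    classical
    refine ⟨c0Of (fun v => (√(∑ e ∈ f.support with e.1.src = v,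
      ‖f e‖ ^ 2) : ℂ)) ((preYFun_finite f f).subset fun v hv => ?_), ?_⟩
    · intro h0
      rw [preYFun_self, Complex.ofReal_eq_zero] at h0
      exact hv (by beta_reduce; rw [h0, Real.sqrt_zero, Complex.ofReal_zero])
    · ext v
      change preYFun f f v = star (Complex.ofReal _) * Complex.ofReal _
      rw [preYFun_self]
      change _ = starRingEnd ℂ (Complex.ofReal _) * Complex.ofReal _
      rw [Complex.conj_ofReal, ← Complex.ofReal_mul, Real.mul_self_sqrt (by positivity)]
  eq_zero_of_ip_self f h := by
    classical
    refine Finsupp.ext fun e => ?_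
    have h1 : preYFun f f e.1.src = 0 := DFunLike.congr_fun h e.1.src
    rw [preYFun_self, Complex.ofReal_eq_zero,
      Finset.sum_eq_zero_iff_of_nonneg fun _ _ => by positivity] at h1
    by_contra h0
    have := h1 e (Finset.mem_filter.mpr ⟨Finsupp.mem_support_iff.mpr h0, rfl⟩)
    exact h0 (norm_eq_zero.mp (pow_eq_zero_iff two_ne_zero |>.mp this))

variable (Λ) in
/-- The Hilbert module over `c_0(Λ_0)` of the directed graph, the closure of `c_c(Λ^1)`. -/
abbrev Y : Type u := Completed C₀(Λ.Vert, ℂ) Λ.preY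

/-- The indicator function of an edge, as an element of `Y`. -/
def edgeVec (e : Λ.Edge 0) : Λ.Y :=
  Completed.of C₀(Λ.Vert, ℂ) Λ.preY (Finsupp.single e 1)

/-- The left action `(h · f)(e) = h(r(e)) f(e)` on `c_c(Λ^1)`. -/
def preYLeft (h : C₀(Λ.Vert, ℂ)) : Λ.preY →ₗ[ℂ] Λ.preY := mulFun fun e => h e.1.rng

theorem preYLeft_apply (h : C₀(Λ.Vert, ℂ)) (f : Λ.preY) (e : Λ.Edge 0) :
    preYLeft h f e = h e.1.rng * f e := rfl

theorem ip_preYLeft (h : C₀(Λ.Vert, ℂ)) (f g : Λ.preY) :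
    ip (preYLeft h f) g = ip f (preYLeft (star h) g) := by
  classical
  ext v
  change preYFun _ g v = preYFun f _ v
  rw [preYFun_eq f (preYLeft (star h) g) v (s := g.support) (support_mulFun _ g), preYFun]
  refine Finset.sum_congr rfl fun e _ => ?_
  change star (h e.1.rng * _) * _ = _ * (star (h e.1.rng) * _)
  rw [star_mul]
  ring

theorem norm_preYLeft (h : C₀(Λ.Vert, ℂ)) (f : Λ.preY) :
    ‖ip (preYLeft h f) (preYLeft h f)‖ ≤ ‖h‖ ^ 2 * ‖ip f f‖ := by
  classical
  have hn : ∀ (k : C₀(Λ.Vert, ℂ)) v, ‖k v‖ ≤ ‖k‖ := fun k v => by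
    rw [← ZeroAtInftyContinuousMap.norm_toBCF_eq_norm]
    exact k.toBCF.norm_coe_le_norm v
  rw [← ZeroAtInftyContinuousMap.norm_toBCF_eq_norm]
  refine (BoundedContinuousFunction.norm_le (by positivity)).mpr fun v => ?_
  change ‖preYFun (preYLeft h f) (preYLeft h f) v‖ ≤ _
  have h1 : ‖preYFun f f v‖ ≤ ‖ip f f‖ := hn (ip f f) v
  refine le_trans ?_ (mul_le_mul_of_nonneg_left h1 (by positivity))
  rw [preYFun_eq (preYLeft h f) (preYLeft h f) v (s := f.support) (support_mulFun _ f), preYFun_self,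
    Complex.norm_real, Real.norm_of_nonneg (by positivity), Finset.mul_sum]
  refine (norm_sum_le _ _).trans (Finset.sum_le_sum fun e _ => ?_)
  change ‖star (h e.1.rng * _) * (h e.1.rng * _)‖ ≤ _
  rw [norm_mul, norm_star, norm_mul, ← sq, mul_pow]
  gcongr
  exact hn h _

/-- The extension of the left action of one function to `Y`. -/
def graphActionOp (h : C₀(Λ.Vert, ℂ)) : Adj C₀(Λ.Vert, ℂ) Λ.Y :=
  Completed.extendAdj (preYLeft h) (preYLeft (star h)) ‖h‖ ‖star h‖ (norm_preYLeft h)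
    (norm_preYLeft (star h)) (ip_preYLeft h)

theorem graphActionOp_of (h : C₀(Λ.Vert, ℂ)) (f : Λ.preY) :
    Adj.op (graphActionOp h) (Completed.of _ _ f) = Completed.of _ _ (preYLeft h f) :=
  Completed.extendAdj_of _ _ _ _ _ _ _ f

variable (Λ) in
/-- The left action of `c_0(Λ_0)` on `Y`. -/
def graphAction : C₀(Λ.Vert, ℂ) →⋆ₙₐ[ℂ] Adj C₀(Λ.Vert, ℂ) Λ.Y where
  toFun := graphActionOp
  map_smul' c h := Completed.adj_ext fun f => by
    rw [Adj.op_smul, graphActionOp_of, MonoidHom.id_apply, graphActionOp_of, ← map_smul]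
    exact congrArg _ (Finsupp.ext fun e => mul_assoc _ _ _)
  map_zero' := Completed.adj_ext fun f => by
    rw [graphActionOp_of, Adj.op_zero, ← map_zero (Completed.of C₀(Λ.Vert, ℂ) Λ.preY)]
    exact congrArg _ (Finsupp.ext fun e => zero_mul _)
  map_add' h k := Completed.adj_ext fun f => by
    rw [Adj.op_add, graphActionOp_of, graphActionOp_of, graphActionOp_of, ← map_add]
    exact congrArg _ (Finsupp.ext fun e => add_mul _ _ _)
  map_mul' h k := Completed.adj_ext fun f => by
    rw [Adj.op_mul, graphActionOp_of, graphActionOp_of, graphActionOp_of]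
    exact congrArg _ (Finsupp.ext fun e => mul_assoc _ _ _)
  map_star' h := Completed.adj_ext fun f => by
    rw [graphActionOp_of, graphActionOp, Completed.star_extendAdj]

end OrdinalGraph

end

noncomputable section

open scoped ENNReal

/-! ## Star homomorphisms between C*-algebras -/

/-! Every path in Λ_0 is a vertex, and no vertex of Λ_0 is regular for any exponent, because
regularity would produce a path of positive length. So relation (4) is vacuous and O(Λ_0) is the
universal algebra of mutually orthogonal projections T_v. Sending T_v to 1_v gives a homomorphism to
c_0(Λ_0). It is isometric on finite combinations, where both norms are the largest coefficient, and
its closed range contains every 1_v (`norm_toC0`, `bijective_toC0`).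

The condition T_{s(e)} x(e) = x(e) forces x(e) to be a scalar multiple of T_{s(e)}. Hence finitely
supported elements of X_0 are finitely supported scalar functions on the edges. This identification
preserves inner products over θ and extends to the completions (`ip_preXEquiv`, `isIso_XEquiv`).

The third isomorphism comes from two mutually inverse homomorphisms, each given by a universal
property. A Cuntz-Krieger family T yields a representation with ψ(δ_e) = T_e and π(T_v) = T_v;
conversely π_u(T_v) and ψ_u(δ_e) form a Cuntz-Krieger family in O(X_0). Relations (1)-(3) are the
inner products of the δ_e and the left action on them. Relation (4) is covariance: if vΛ^1 is
finite, then φ_0(T_v) is the sum of the operators θ_{δ_e,δ_e} over vΛ^1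
(`leftAction_vertProj_eq_sum`).

What links the two is the Katsura ideal. Since φ_0(a)δ_e = a(r(e))δ_e, where a(v) is the value of
θ(a) at v, every T_v with v 0-regular lies in the ideal, and conversely an element of the ideal is
nonzero only at 0-regular vertices (`vertProj_mem_katsuraIdeal`, `regular_of_mem_katsuraIdeal`). As
a lies in the closed span of the T_v with a(v) ≠ 0, covariance on the whole ideal reduces to
covariance at these T_v.

Covariance also requires the homomorphism (ψ, π)^(1) to exist on the compact operators for an
arbitrary representation. It is obtained as a closed graph, and the essential estimate is
`IsRepresentation.norm_snd_le_of_mem`. -/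

theorem NonUnitalStarAlgHom.continuous_cstar {A B : Type*} [NonUnitalCStarAlgebra A]
    [NonUnitalCStarAlgebra B] (φ : A →⋆ₙₐ[ℂ] B) : Continuous φ :=
  AddMonoidHomClass.continuous_of_bound φ 1 fun x => by
    rw [one_mul]; exact NonUnitalStarAlgHom.norm_apply_le φ x

/-! ### Density of the generators of a universal C*-algebra -/

namespace CStarRelations

universe u

variable {G : Type u} {R : CStarRelations G}

variable (R) in
-- The universal algebra is the closure, inside the product of all families, of what the diagonal
-- family generates. The inclusion carries the algebra generated by the `gen g` onto that one, and
-- the subspace topology is induced, so density passes to the subalgebra.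
theorem dense_adjoin_gen :
    Dense (NonUnitalStarAlgebra.adjoin ℂ (Set.range R.gen) : Set R.Universal) := by
  intro x
  let v : R.sub →⋆ₙₐ[ℂ] lp R.Fiber ∞ := NonUnitalStarSubalgebraClass.subtype R.sub
  have hv : NonUnitalStarSubalgebra.map v (NonUnitalStarAlgebra.adjoin ℂ (Set.range R.gen)) =
      NonUnitalStarAlgebra.adjoin ℂ (Set.range R.diag) := by
    refine (NonUnitalStarAlgHom.map_adjoin v _).trans (congrArg _ ?_)
    exact (Set.range_comp v R.gen).symm
  have hi : Topology.IsInducing (Subtype.val : R.sub → lp R.Fiber ∞) := .subtypeVal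
  refine (hi.closure_eq_preimage_closure_image _).ge ?_
  have h1 : x.1 ∈ closure (NonUnitalStarAlgebra.adjoin ℂ (Set.range R.diag) : Set _) := x.2
  rw [← hv] at h1
  exact h1

/-- The uniqueness half of the universal property: *-homomorphisms are continuous, so they are
determined on a dense *-subalgebra. -/
theorem hom_ext {B : Type*} [NonUnitalCStarAlgebra B] {φ ψ : R.Universal →⋆ₙₐ[ℂ] B}
    (h : ∀ g, φ (R.gen g) = ψ (R.gen g)) : φ = ψ := by
  refine DFunLike.coe_injective (Continuous.ext_on (dense_adjoin_gen R) φ.continuous_cstar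
    ψ.continuous_cstar fun x hx => ?_)
  have : NonUnitalStarAlgebra.adjoin ℂ (Set.range R.gen) ≤ NonUnitalStarAlgHom.equalizer φ ψ :=
    NonUnitalStarAlgebra.adjoin_le (by rintro _ ⟨g, rfl⟩; exact h g)
  exact this hx

end CStarRelations

/-! ## Orthogonal projections -/

/-- Orthogonality makes c ↦ ∑ c_i p_i a *-homomorphism from the C*-algebra ℂ^s with the supremum
norm, and *-homomorphisms are contractive. -/
theorem norm_sum_smul_projections_le {ι B : Type*} [NonUnitalCStarAlgebra B] (s : Finset ι)
    (p : ι → B) (hs : ∀ i, star (p i) = p i) (hp : ∀ i, p i * p i = p i)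
    (ho : ∀ i j, i ≠ j → p i * p j = 0) (c : ι → ℂ) {M : ℝ} (hM : 0 ≤ M)
    (hc : ∀ i ∈ s, ‖c i‖ ≤ M) : ‖∑ i ∈ s, c i • p i‖ ≤ M := by
  classical
  let φ : (s → ℂ) →⋆ₙₐ[ℂ] B :=
    { toFun := fun c => ∑ i, c i • p i
      map_smul' := fun a c => by simp [Finset.smul_sum, smul_smul]
      map_zero' := by simp
      map_add' := fun c d => by simp [add_smul, Finset.sum_add_distrib]
      map_mul' := fun c d => by
        rw [Finset.sum_mul_sum]
        refine Finset.sum_congr rfl fun i _ => ?_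
        rw [Finset.sum_eq_single_of_mem i (Finset.mem_univ i) fun j _ hj => by
          rw [smul_mul_smul_comm, ho _ _ fun h => hj (Subtype.ext h).symm, smul_zero]]
        rw [smul_mul_smul_comm, hp]
        rfl
      map_star' := fun c => by simp [star_sum, hs] }
  have h1 : φ (fun i => c i) = ∑ i ∈ s, c i • p i := Finset.sum_coe_sort s fun i => c i • p i
  rw [← h1]
  refine (NonUnitalStarAlgHom.norm_apply_le φ _).trans ?_
  exact (pi_norm_le_iff_of_nonneg hM).mpr fun i => hc i i.2

/-! ## Extension of maps to the completion of a pre-Hilbert module -/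

namespace PreHilbertModule.Completed

variable {A E : Type*} [NonUnitalCStarAlgebra A] [AddCommGroup E] [Module ℂ E]
  [PreHilbertModule A E]

attribute [local instance] normedGroup normedSpc

section

variable {Z : Type*} [NormedAddCommGroup Z] [NormedSpace ℂ Z] [CompleteSpace Z]

/-- The extension to the completion of a bounded linear map into a Banach space. -/
def extendTo (T : E →ₗ[ℂ] Z) (C : ℝ) (h : ∀ x, ‖T x‖ ≤ C * ‖of A E x‖) :
    Completed A E →L[ℂ] Z :=
  (T.mkContinuous C fun x => by rw [← norm_of]; exact h x).extend
    (ofIso A E).toContinuousLinearMap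

theorem extendTo_of (T : E →ₗ[ℂ] Z) (C : ℝ) (h : ∀ x, ‖T x‖ ≤ C * ‖of A E x‖) (x : E) :
    extendTo T C h (of A E x) = T x :=
  ContinuousLinearMap.extend_eq (e := (ofIso A E).toContinuousLinearMap) _
    denseRange_of isUniformInducing_ofIso x

end

theorem norm_of_sq (x : E) : ‖of A E x‖ ^ 2 = ‖ip x x‖ := by
  rw [HilbertModule.norm_sq, ip_of]

variable {B F : Type*} [NonUnitalCStarAlgebra B] [AddCommGroup F] [Module ℂ F]
  [PreHilbertModule B F]

theorem norm_of_map (u : E →ₗ[ℂ] F) (θ : A ≃⋆ₐ[ℂ] B)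
    (h : ∀ x y, ip (u x) (u y) = θ (ip x y)) (x : E) : ‖of B F (u x)‖ = ‖of A E x‖ := by
  rw [← sq_eq_sq₀ (norm_nonneg _) (norm_nonneg _), norm_of_sq, norm_of_sq, h,
    NonUnitalStarAlgHom.norm_map θ θ.injective]

/-- The extension to the completions of a linear map which preserves the inner products up to an
isomorphism of the coefficient algebras. -/
def map (u : E →ₗ[ℂ] F) (θ : A ≃⋆ₐ[ℂ] B) (h : ∀ x y, ip (u x) (u y) = θ (ip x y)) :
    Completed A E →L[ℂ] Completed B F :=
  extendTo (of B F ∘ₗ u) 1 fun x => by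
    rw [one_mul, LinearMap.comp_apply, norm_of_map u θ h]

theorem map_of (u : E →ₗ[ℂ] F) (θ : A ≃⋆ₐ[ℂ] B) (h : ∀ x y, ip (u x) (u y) = θ (ip x y)) (x : E) :
    map u θ h (of A E x) = of B F (u x) := extendTo_of _ _ _ x

theorem ip_map (u : E →ₗ[ℂ] F) (θ : A ≃⋆ₐ[ℂ] B) (h : ∀ x y, ip (u x) (u y) = θ (ip x y))
    (x y : Completed A E) : ip (map u θ h x) (map u θ h y) = θ (ip x y) := by
  have hθ : Continuous θ := (θ : A →⋆ₙₐ[ℂ] B).continuous_cstar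
  refine ind (isClosed_eq (HilbertModule.continuous_ip (map u θ h).continuous continuous_const)
    (hθ.comp (HilbertModule.continuous_ip continuous_id' continuous_const))) (fun x => ?_) x
  refine ind (isClosed_eq (HilbertModule.continuous_ip continuous_const (map u θ h).continuous)
    (hθ.comp (HilbertModule.continuous_ip continuous_const continuous_id'))) (fun y => ?_) y
  rw [map_of, map_of, ip_of, h]
  exact congrArg θ (ip_of x y).symm

/-- The isomorphism of the completions defined by an isomorphism of pre-Hilbert modules over
isomorphic C*-algebras. -/
def mapEquiv (u : E ≃ₗ[ℂ] F) (θ : A ≃⋆ₐ[ℂ] B) (h : ∀ x y, ip (u x) (u y) = θ (ip x y)) :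
    Completed A E ≃ₗ[ℂ] Completed B F :=
  have h' : ∀ x y, ip (u.symm x) (u.symm y) = θ.symm (ip x y) := fun x y => by
    rw [StarAlgEquiv.eq_symm_apply, ← h, u.apply_symm_apply, u.apply_symm_apply]
  LinearEquiv.ofLinearMap (map u.toLinearMap θ h).toLinearMap
    (map u.symm.toLinearMap θ.symm h').toLinearMap
    (LinearMap.ext (ind (isClosed_eq
      ((map u.toLinearMap θ h).continuous.comp (map u.symm.toLinearMap θ.symm h').continuous)
      continuous_id') fun x => by
        change map u.toLinearMap θ h (map u.symm.toLinearMap θ.symm h' _) = _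
        rw [map_of, map_of]; exact congrArg _ (u.apply_symm_apply x)))
    (LinearMap.ext (ind (isClosed_eq
      ((map u.symm.toLinearMap θ.symm h').continuous.comp (map u.toLinearMap θ h).continuous)
      continuous_id') fun x => by
        change map u.symm.toLinearMap θ.symm h' (map u.toLinearMap θ h _) = _
        rw [map_of, map_of]; exact congrArg _ (u.symm_apply_apply x)))

theorem mapEquiv_of (u : E ≃ₗ[ℂ] F) (θ : A ≃⋆ₐ[ℂ] B) (h : ∀ x y, ip (u x) (u y) = θ (ip x y))
    (x : E) : mapEquiv u θ h (of A E x) = of B F (u x) := map_of u.toLinearMap θ h x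

theorem continuous_mapEquiv (u : E ≃ₗ[ℂ] F) (θ : A ≃⋆ₐ[ℂ] B)
    (h : ∀ x y, ip (u x) (u y) = θ (ip x y)) : Continuous (mapEquiv u θ h) :=
  (map u.toLinearMap θ h).continuous

theorem ip_mapEquiv (u : E ≃ₗ[ℂ] F) (θ : A ≃⋆ₐ[ℂ] B) (h : ∀ x y, ip (u x) (u y) = θ (ip x y))
    (x y : Completed A E) : ip (mapEquiv u θ h x) (mapEquiv u θ h y) = θ (ip x y) :=
  ip_map u.toLinearMap θ h x y

/-- The inner product determines the right action. Every test vector is in the image because the map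
is surjective, so no further density argument is needed. -/
theorem mapEquiv_act (u : E ≃ₗ[ℂ] F) (θ : A ≃⋆ₐ[ℂ] B) (h : ∀ x y, ip (u x) (u y) = θ (ip x y))
    (x : Completed A E) (a : A) :
    mapEquiv u θ h (act x a) = act (mapEquiv u θ h x) (θ a) := by
  refine ext_ip fun z => ?_
  obtain ⟨z, rfl⟩ := (mapEquiv u θ h).surjective z
  rw [ip_mapEquiv, ip_act_right, ip_act_right, ip_mapEquiv, map_mul]

end PreHilbertModule.Completed

/-! ## Representations of a correspondence -/

namespace Correspondence

open PreHilbertModule HilbertModule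

universe u

variable {A X : Type u} {B : Type*} [NonUnitalCStarAlgebra A] [NormedAddCommGroup X] [NormedSpace ℂ X]
  [HilbertModule A X] [NonUnitalCStarAlgebra B] {φ : A →⋆ₙₐ[ℂ] Adj A X} {ψ : X →ₗ[ℂ] B}
  {π : A →⋆ₙₐ[ℂ] B}

theorem IsRepresentation.norm_le (h : IsRepresentation φ ψ π) (x : X) : ‖ψ x‖ ≤ ‖x‖ := by
  refine (sq_le_sq₀ (norm_nonneg _) (norm_nonneg _)).mp ?_
  rw [norm_sq x, sq, ← CStarRing.norm_star_mul_self, h.ip]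
  exact NonUnitalStarAlgHom.norm_apply_le π _

theorem IsRepresentation.continuous (h : IsRepresentation φ ψ π) : Continuous ψ :=
  AddMonoidHomClass.continuous_of_bound ψ 1 fun x => by rw [one_mul]; exact h.norm_le x

variable (ψ) in
/-- The linear span of the pairs `(θ_{x,y}, ψ(x)ψ(y)*)`. -/
def inducedSpan : Submodule ℂ (Adj A X × B) :=
  Submodule.span ℂ {z | ∃ x y : X, z = (Adj.theta x y, ψ x * star (ψ y))}

theorem star_mem_inducedSpan {z : Adj A X × B} (hz : z ∈ inducedSpan ψ) :
    star z ∈ inducedSpan ψ := by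
  induction hz using Submodule.span_induction with
  | mem z h =>
    obtain ⟨x, y, rfl⟩ := h
    refine Submodule.subset_span ⟨y, x, Prod.ext (Adj.star_theta x y) ?_⟩
    change star (ψ x * star (ψ y)) = _
    rw [star_mul, star_star]
  | zero => rw [star_zero]; exact zero_mem _
  | add z z' _ _ h h' => rw [star_add]; exact add_mem h h'
  | smul c z _ h => rw [star_smul]; exact Submodule.smul_mem _ _ h

/-- The identity ψ(y)ψ(w)*ψ(x) = ψ(y · ⟨w, x⟩), extended linearly: the second coordinate of a pair
in the span acts on ψ(X) as the first acts on X. It makes the span multiplicative and lets the norm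
of the operator control products. -/
theorem IsRepresentation.mul_psi_of_mem (h : IsRepresentation φ ψ π) {z : Adj A X × B}
    (hz : z ∈ inducedSpan ψ) (x : X) : z.2 * ψ x = ψ (Adj.op z.1 x) := by
  induction hz using Submodule.span_induction with
  | mem z hz =>
    obtain ⟨y, w, rfl⟩ := hz
    change ψ y * star (ψ w) * ψ x = ψ (act y (PreHilbertModule.ip w x))
    rw [mul_assoc, h.ip, h.right]
  | zero => simp [Adj.op_zero]
  | add z z' _ _ h h' => rw [Prod.snd_add, add_mul, h, h', ← map_add]; rfl
  | smul c z _ h => rw [Prod.smul_snd, smul_mul_assoc, h, ← map_smul]; rfl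

theorem IsRepresentation.mul_mem_inducedSpan (h : IsRepresentation φ ψ π) {z w : Adj A X × B}
    (hz : z ∈ inducedSpan ψ) (hw : w ∈ inducedSpan ψ) : z * w ∈ inducedSpan ψ := by
  induction hw using Submodule.span_induction with
  | mem w hw =>
    obtain ⟨x, y, rfl⟩ := hw
    refine Submodule.subset_span ⟨Adj.op z.1 x, y, Prod.ext (Adj.mul_theta _ _ _) ?_⟩
    change z.2 * (ψ x * star (ψ y)) = _
    rw [← mul_assoc, h.mul_psi_of_mem hz]
  | zero => rw [mul_zero]; exact zero_mem _
  | add z z' _ _ h h' => rw [mul_add]; exact add_mem h h'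
  | smul c z _ h => rw [mul_smul_comm]; exact Submodule.smul_mem _ _ h

/-- Multiplication by a fixed element of the span is controlled by the norm of the operator. -/
theorem IsRepresentation.exists_norm_mul_le (h : IsRepresentation φ ψ π) {w : Adj A X × B}
    (hw : w ∈ inducedSpan ψ) :
    ∃ C : ℝ, ∀ z ∈ inducedSpan ψ, ‖z.2 * w.2‖ ≤ ‖z.1‖ * C := by
  induction hw using Submodule.span_induction with
  | mem w hw =>
    obtain ⟨x, y, rfl⟩ := hw
    refine ⟨‖x‖ * ‖y‖, fun z hz => ?_⟩
    change ‖z.2 * (ψ x * star (ψ y))‖ ≤ _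
    rw [← mul_assoc, h.mul_psi_of_mem hz, ← mul_assoc]
    refine (norm_mul_le _ _).trans ?_
    rw [norm_star]
    gcongr
    · exact (h.norm_le _).trans ((Adj.op z.1).le_opNorm x)
    · exact h.norm_le y
  | zero => exact ⟨0, fun z _ => by simp⟩
  | add w w' _ _ h h' =>
    obtain ⟨C, hC⟩ := h
    obtain ⟨D, hD⟩ := h'
    refine ⟨C + D, fun z hz => ?_⟩
    rw [Prod.snd_add, mul_add, mul_add]
    exact (norm_add_le _ _).trans (add_le_add (hC z hz) (hD z hz))
  | smul c w _ h =>
    obtain ⟨C, hC⟩ := h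
    refine ⟨‖c‖ * C, fun z hz => ?_⟩
    rw [Prod.smul_snd, mul_smul_comm, norm_smul, mul_left_comm]
    exact mul_le_mul_of_nonneg_left (hC z hz) (norm_nonneg c)

/-- Repeated squaring with the C*-identity: the square of a self-adjoint element has the square of
its norm. -/
theorem norm_pow_two_pow_of_isSelfAdjoint {D : Type*} [NonUnitalCStarAlgebra D] (s : ℕ → D)
    (h0 : star (s 0) = s 0) (hs : ∀ n, s (n + 1) = s n * s n) (n : ℕ) :
    ‖s n‖ = ‖s 0‖ ^ 2 ^ n := by
  have hstar : ∀ n, star (s n) = s n := fun n => by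
    induction n with
    | zero => exact h0
    | succ n ih => rw [hs, star_mul, ih]
  induction n with
  | zero => simp
  | succ n ih =>
    have : ‖s n * s n‖ = ‖s n‖ * ‖s n‖ := by
      rw [← CStarRing.norm_star_mul_self, hstar]
    rw [hs, this, ih, ← pow_add, pow_succ, mul_two]

/-- A constant factor disappears after taking 2^n-th roots: if a > b > 0, then (a / b)^(2^n) exceeds
every C. -/
theorem le_of_forall_pow_le_mul {a b C : ℝ} (hb : 0 ≤ b)
    (h : ∀ n : ℕ, a ^ 2 ^ n ≤ b ^ 2 ^ n * C) : a ≤ b := by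
  by_contra! hab
  rcases hb.eq_or_lt with rfl | hb
  · have := h 0
    simp only [pow_zero, pow_one, zero_mul] at this
    exact absurd this hab.not_ge
  · have h1 : 1 < a / b := (one_lt_div hb).mpr hab
    have ht : Filter.Tendsto (fun n : ℕ => (a / b) ^ 2 ^ n) Filter.atTop Filter.atTop :=
      (tendsto_pow_atTop_atTop_of_one_lt h1).comp
        (tendsto_pow_atTop_atTop_of_one_lt one_lt_two)
    obtain ⟨n, hn⟩ := (ht.eventually_gt_atTop C).exists
    refine absurd (h n) (not_le.mpr ?_)
    rw [div_pow, lt_div_iff₀ (by positivity)] at hn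
    linarith

/-- A spectral-radius argument. Operator norms bound products with a fixed right factor, up to a
constant depending on that factor. Applied to high powers of z z* with the last factor z* held
fixed, this compares the powers of the two coordinates up to one constant, which the 2^n-th roots
remove. In particular (ψ, π)^(1) is well defined and contractive on finite-rank operators, with no
injectivity of π assumed. -/
theorem IsRepresentation.norm_snd_le_of_mem (h : IsRepresentation φ ψ π) {z : Adj A X × B}
    (hz : z ∈ inducedSpan ψ) : ‖z.2‖ ≤ ‖z.1‖ := by
  -- s n is (z z*)^(2^n), and t n is (z z*)^(2^n - 1) z, so that t n times z* is s n.
  let s : ℕ → Adj A X × B := fun n => Nat.rec (z * star z) (fun _ v => v * v) n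
  let t : ℕ → Adj A X × B := fun n => Nat.rec z (fun k v => s k * v) n
  have hz' := star_mem_inducedSpan hz
  have hs : ∀ n, s n ∈ inducedSpan ψ := fun n => by
    induction n with
    | zero => exact h.mul_mem_inducedSpan hz hz'
    | succ n ih => exact h.mul_mem_inducedSpan ih ih
  have ht : ∀ n, t n ∈ inducedSpan ψ := fun n => by
    induction n with
    | zero => exact hz
    | succ n ih => exact h.mul_mem_inducedSpan (hs n) ih
  have hst : ∀ n, t n * star z = s n := fun n => by
    induction n with
    | zero => rfl
    | succ n ih =>
      change s n * t n * star z = s n * s n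
      rw [mul_assoc, ih]
  have hss : star (s 0) = s 0 := by
    change star (z * star z) = z * star z
    rw [star_mul, star_star]
  have h1 : ∀ n, ‖(s n).1‖ = (‖z.1‖ ^ 2) ^ 2 ^ n := fun n => by
    rw [norm_pow_two_pow_of_isSelfAdjoint (fun n => (s n).1) (congrArg Prod.fst hss)
      (fun _ => rfl) n, sq, ← CStarRing.norm_self_mul_star]
    rfl
  have h2 : ∀ n, ‖(s n).2‖ = (‖z.2‖ ^ 2) ^ 2 ^ n := fun n => by
    rw [norm_pow_two_pow_of_isSelfAdjoint (fun n => (s n).2) (congrArg Prod.snd hss)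
      (fun _ => rfl) n, sq, ← CStarRing.norm_self_mul_star]
    rfl
  have h3 : ∀ n, ‖(t n).1‖ * ‖z.1‖ ≤ (‖z.1‖ ^ 2) ^ 2 ^ n := fun n => by
    induction n with
    | zero => simp [t, sq]
    | succ n ih =>
      calc ‖(s n * t n).1‖ * ‖z.1‖ ≤ ‖(s n).1‖ * ‖(t n).1‖ * ‖z.1‖ := by
            gcongr; exact norm_mul_le _ _
        _ ≤ ‖(s n).1‖ * (‖z.1‖ ^ 2) ^ 2 ^ n := by rw [mul_assoc]; gcongr
        _ = _ := by rw [h1, ← pow_add, pow_succ 2 n, mul_two]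
  -- The constant belongs to the fixed right factor z*, so it is the same for all n.
  obtain ⟨C, hC⟩ := h.exists_norm_mul_le hz'
  have h4 : ∀ n, (‖z.2‖ ^ 2) ^ 2 ^ n ≤ ‖(t n).1‖ * |C| := fun n => by
    rw [← h2, ← hst]
    exact (hC _ (ht n)).trans (mul_le_mul_of_nonneg_left (le_abs_self C) (norm_nonneg _))
  -- The constant used below divides by the norm of z.1. When that norm is zero, the bound for n = 0
  -- already gives z.2 = 0.
  rcases (norm_nonneg z.1).eq_or_lt with h0 | h0
  · have := h4 0
    change _ ≤ ‖z.1‖ * |C| at this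
    rw [← h0, zero_mul, pow_zero, pow_one] at this
    rw [← h0]
    nlinarith [norm_nonneg z.2]
  · refine (sq_le_sq₀ (norm_nonneg _) (norm_nonneg _)).mp
      (le_of_forall_pow_le_mul (C := |C| / ‖z.1‖) (by positivity) fun n => (h4 n).trans ?_)
    rw [mul_div_assoc', le_div_iff₀ h0, mul_right_comm]
    exact mul_le_mul_of_nonneg_right (h3 n) (abs_nonneg C)

variable (ψ) in
/-- The closed linear span of the pairs `(θ_{x,y}, ψ(x)ψ(y)*)`, which is the graph of the
homomorphism induced by a representation. -/
def inducedGraph : Submodule ℂ (Adj A X × B) := (inducedSpan ψ).topologicalClosure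

theorem theta_mem_inducedGraph (x y : X) :
    (Adj.theta x y, ψ x * star (ψ y)) ∈ inducedGraph ψ :=
  subset_closure (Submodule.subset_span ⟨x, y, rfl⟩)

theorem IsRepresentation.norm_snd_le (h : IsRepresentation φ ψ π) {z : Adj A X × B}
    (hz : z ∈ inducedGraph ψ) : ‖z.2‖ ≤ ‖z.1‖ :=
  closure_minimal (s := (inducedSpan ψ : Set (Adj A X × B))) (t := {z | ‖z.2‖ ≤ ‖z.1‖})
    (fun _ hz => h.norm_snd_le_of_mem hz) (isClosed_le continuous_snd.norm continuous_fst.norm) hz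

/-- The difference of the two pairs is (0, b - c), whose second coordinate is bounded by the norm of
the first. -/
theorem IsRepresentation.graph_unique (h : IsRepresentation φ ψ π) {K : Adj A X} {b c : B}
    (hb : (K, b) ∈ inducedGraph ψ) (hc : (K, c) ∈ inducedGraph ψ) : b = c := by
  have := h.norm_snd_le (sub_mem hb hc)
  rw [← sub_eq_zero, ← norm_le_zero_iff]
  simpa using this

/-- On the closed graph the maximum norm of a pair is the norm of its first coordinate, so
projection to that coordinate is isometric and has closed image. The image contains all θ_{x,y},
hence all compact operators. -/
theorem IsRepresentation.graph_exists (h : IsRepresentation φ ψ π) {K : Adj A X}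
    (hK : K ∈ Adj.compacts A X) : ∃ b, (K, b) ∈ inducedGraph ψ := by
  have hcl : IsClosed (Prod.fst '' (inducedGraph ψ : Set (Adj A X × B))) := by
    have hcs : CompleteSpace (inducedGraph ψ) :=
      (Submodule.isClosed_topologicalClosure (inducedSpan ψ)).completeSpace_coe
    have hiso : Isometry fun z : inducedGraph ψ => z.1.1 := by
      refine Isometry.of_dist_eq fun y z => ?_
      have := h.norm_snd_le (sub_mem y.2 z.2)
      rw [dist_eq_norm, Subtype.dist_eq, dist_eq_norm, Prod.norm_def, max_eq_left this]
      rfl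
    have := hiso.isClosedEmbedding.isClosed_range
    rwa [← Function.comp_def Prod.fst Subtype.val, Set.range_comp, Subtype.range_coe] at this
  have hsub : (Adj.finiteRank A X : Set (Adj A X)) ⊆
      Prod.fst '' (inducedGraph ψ : Set (Adj A X × B)) := by
    have : Adj.finiteRank A X ≤ (inducedGraph ψ).map (LinearMap.fst ℂ (Adj A X) B) := by
      refine Submodule.span_le.mpr ?_
      rintro _ ⟨x, y, rfl⟩
      exact ⟨_, theta_mem_inducedGraph x y, rfl⟩
    exact this
  obtain ⟨z, hz, hzK⟩ := closure_minimal hsub hcl hK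
  exact ⟨z.2, by rw [← hzK]; exact hz⟩

theorem IsRepresentation.mul_mem_inducedGraph (h : IsRepresentation φ ψ π) {z w : Adj A X × B}
    (hz : z ∈ inducedGraph ψ) (hw : w ∈ inducedGraph ψ) : z * w ∈ inducedGraph ψ :=
  map_mem_closure₂ continuous_mul hz hw fun _ hz _ hw => h.mul_mem_inducedSpan hz hw

theorem star_mem_inducedGraph {z : Adj A X × B} (hz : z ∈ inducedGraph ψ) :
    star z ∈ inducedGraph ψ :=
  map_mem_closure continuous_star hz fun _ hz => star_mem_inducedSpan hz

/-- The homomorphism `(ψ, π)^(1)` on the compact operators induced by a representation. -/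
def IsRepresentation.induced (h : IsRepresentation φ ψ π) : Adj.compacts A X →⋆ₙₐ[ℂ] B where
  toFun K := (h.graph_exists K.2).choose
  map_smul' c K := h.graph_unique (h.graph_exists (c • K).2).choose_spec
    (Submodule.smul_mem _ c (h.graph_exists K.2).choose_spec)
  map_zero' := h.graph_unique (h.graph_exists (0 : Adj.compacts A X).2).choose_spec
    (zero_mem (inducedGraph ψ))
  map_add' K L := h.graph_unique (h.graph_exists (K + L).2).choose_spec
    (add_mem (h.graph_exists K.2).choose_spec (h.graph_exists L.2).choose_spec)
  map_mul' K L := h.graph_unique (h.graph_exists (K * L).2).choose_spec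
    (h.mul_mem_inducedGraph (h.graph_exists K.2).choose_spec (h.graph_exists L.2).choose_spec)
  map_star' K := h.graph_unique (h.graph_exists (star K).2).choose_spec
    (star_mem_inducedGraph (h.graph_exists K.2).choose_spec)

theorem IsRepresentation.induced_eq (h : IsRepresentation φ ψ π) (K : Adj.compacts A X) {b : B}
    (hb : (K.1, b) ∈ inducedGraph ψ) : h.induced K = b :=
  h.graph_unique (h.graph_exists K.2).choose_spec hb

/-- A representation is covariant if `(φ(a), π(a))` lies in the graph of the induced homomorphism
for all `a` in the Katsura ideal. -/
theorem IsRepresentation.isCovariant (h : IsRepresentation φ ψ π)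
    (hJ : ∀ a ∈ katsuraIdeal φ, (φ a, π a) ∈ inducedGraph ψ) : IsCovariant φ ψ π :=
  ⟨h, h.induced, fun x y => h.induced_eq _ (theta_mem_inducedGraph x y),
    fun a ha => h.induced_eq _ (hJ a ha)⟩

/-! ### The universal covariant representation -/

section Universal

variable (φ)

/-- Each coordinate of the product containing O(X) carries a covariant representation. Identities
between universal elements are therefore verified one coordinate at a time. -/
theorem fam_spec (i : (relations φ).Index) :
    ∃ (ψ : X →ₗ[ℂ] (relations φ).Fiber i) (π : A →⋆ₙₐ[ℂ] (relations φ).Fiber i),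
      IsCovariant φ ψ π ∧ (∀ x, CStarRelations.proj i (psiU φ x) = ψ x) ∧
        ∀ a, CStarRelations.proj i (piU φ a) = π a := by
  obtain ⟨ψ, π, h, hf⟩ := (relations φ).fam_holds i
  exact ⟨ψ, π, h, fun x => congrFun hf (Sum.inl x), fun a => congrFun hf (Sum.inr a)⟩

theorem psiU_add (x y : X) : psiU φ (x + y) = psiU φ x + psiU φ y :=
  CStarRelations.ext_proj fun i => by
    obtain ⟨ψ, π, -, hψ, -⟩ := fam_spec φ i
    rw [map_add, hψ, hψ, hψ, map_add]

theorem psiU_smul (c : ℂ) (x : X) : psiU φ (c • x) = c • psiU φ x :=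
  CStarRelations.ext_proj fun i => by
    obtain ⟨ψ, π, -, hψ, -⟩ := fam_spec φ i
    rw [map_smul, hψ, hψ, map_smul]

/-- `ψ_u` as a linear map. -/
def psiULin : X →ₗ[ℂ] CuntzPimsner φ where
  toFun := psiU φ
  map_add' := psiU_add φ
  map_smul' := psiU_smul φ

/-- `π_u` as a homomorphism. -/
def piUHom : A →⋆ₙₐ[ℂ] CuntzPimsner φ where
  toFun := piU φ
  map_smul' c a := CStarRelations.ext_proj fun i => by
    obtain ⟨ψ, π, -, -, hπ⟩ := fam_spec φ i
    rw [map_smul, hπ, hπ, map_smul]; rfl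
  map_zero' := CStarRelations.ext_proj fun i => by
    obtain ⟨ψ, π, -, -, hπ⟩ := fam_spec φ i
    rw [hπ, map_zero, map_zero]
  map_add' a b := CStarRelations.ext_proj fun i => by
    obtain ⟨ψ, π, -, -, hπ⟩ := fam_spec φ i
    rw [map_add, hπ, hπ, hπ, map_add]
  map_mul' a b := CStarRelations.ext_proj fun i => by
    obtain ⟨ψ, π, -, -, hπ⟩ := fam_spec φ i
    rw [map_mul, hπ, hπ, hπ, map_mul]
  map_star' a := CStarRelations.ext_proj fun i => by
    obtain ⟨ψ, π, -, -, hπ⟩ := fam_spec φ i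
    rw [map_star, hπ, hπ, map_star]

theorem isRepresentation_universal : IsRepresentation φ (psiULin φ) (piUHom φ) where
  right x a := CStarRelations.ext_proj fun i => by
    obtain ⟨ψ, π, h, hψ, hπ⟩ := fam_spec φ i
    change CStarRelations.proj i (psiU φ x * piU φ a) = CStarRelations.proj i (psiU φ _)
    rw [map_mul, hψ, hψ, hπ, h.1.right]
  left a x := CStarRelations.ext_proj fun i => by
    obtain ⟨ψ, π, h, hψ, hπ⟩ := fam_spec φ i
    change CStarRelations.proj i (piU φ a * psiU φ x) = CStarRelations.proj i (psiU φ _)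
    rw [map_mul, hψ, hψ, hπ, h.1.left]
  ip x y := CStarRelations.ext_proj fun i => by
    obtain ⟨ψ, π, h, hψ, hπ⟩ := fam_spec φ i
    change CStarRelations.proj i (star (psiU φ x) * psiU φ y) = CStarRelations.proj i (piU φ _)
    rw [map_mul, map_star, hψ, hψ, hπ, h.1.ip]

end Universal

end Correspondence

open CategoryTheory Ordinal
open PreHilbertModule HilbertModule
open scoped ZeroAtInfty

/-! ### Covariance of the universal representation at finite-rank operators -/

namespace Correspondence

universe u

variable {A X : Type u} [NonUnitalCStarAlgebra A] [NormedAddCommGroup X] [NormedSpace ℂ X]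
  [HilbertModule A X] (φ : A →⋆ₙₐ[ℂ] Adj A X)

/-- In each coordinate the induced homomorphism sends θ_{x,y} to ψ(x)ψ(y)*, so applying it to the
finite sum for φ(a) gives π(a). This is how relation (4) is obtained in O(X_0). -/
theorem piU_eq_sum {ι : Type*} (s : Finset ι) (x y : ι → X) {a : A} (ha : a ∈ katsuraIdeal φ)
    (hs : φ a = ∑ i ∈ s, Adj.theta (x i) (y i)) :
    piU φ a = ∑ i ∈ s, psiU φ (x i) * star (psiU φ (y i)) := by
  refine CStarRelations.ext_proj fun i => ?_
  obtain ⟨ψ, π, h, hψ, hπ⟩ := fam_spec φ i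
  obtain ⟨-, κ, hκ, hJ⟩ := h
  have h1 : (⟨φ a, ha.2⟩ : Adj.compacts A X) =
      ∑ i ∈ s, ⟨Adj.theta (x i) (y i), Adj.theta_mem_compacts _ _⟩ :=
    Subtype.ext (by rw [AddSubmonoidClass.coe_finsetSum]; exact hs)
  rw [hπ, ← hJ a ha, h1, map_sum, map_sum]
  refine Finset.sum_congr rfl fun j _ => ?_
  rw [hκ, map_mul, map_star, hψ, hψ]

end Correspondence

namespace OrdinalGraph

universe u w

variable {Λ : OrdinalGraph.{u, w}}

/-! ### Cuntz-Krieger families -/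

section Family

variable {B : Type*} [NonUnitalCStarAlgebra B] {T : Λ.Gen → B}

theorem IsCuntzKrieger.star_vert (h : IsCuntzKrieger T) (v : Λ.Vert) :
    star (T (Λ.vertGen v)) = T (Λ.vertGen v) := by
  have h1 : star (T (Λ.vertGen v)) * T (Λ.vertGen v) = T (Λ.vertGen v) := h.rel1 (Λ.vertGen v)
  rw [← h1, star_mul, star_star]

theorem IsCuntzKrieger.vert_mul_self (h : IsCuntzKrieger T) (v : Λ.Vert) :
    T (Λ.vertGen v) * T (Λ.vertGen v) = T (Λ.vertGen v) := by
  have h1 : star (T (Λ.vertGen v)) * T (Λ.vertGen v) = T (Λ.vertGen v) := h.rel1 (Λ.vertGen v)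
  rwa [h.star_vert] at h1

theorem Comp.rng_eq {e f g : Λ.Path} (h : Comp e f g) : g.rng = e.rng := by cases h; rfl

theorem comp_idPath_left (e : Λ.Path) : Comp (Λ.idPath e.rng) e e := by
  obtain ⟨a, b, e⟩ := e
  have := Comp.mk (Λ := Λ) e (𝟙 b)
  rwa [Category.comp_id] at this

theorem comp_idPath_right (e : Λ.Path) : Comp e (Λ.idPath e.src) e := by
  obtain ⟨a, b, e⟩ := e
  have := Comp.mk (Λ := Λ) (𝟙 a) e
  rwa [Category.id_comp] at this

/-- Extensions of a vertex have that vertex as range, so distinct vertices have no common extension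
and relation (3) applies. -/
theorem IsCuntzKrieger.vert_mul_vert (h : IsCuntzKrieger T) {v w : Λ.Vert} (hvw : v ≠ w) :
    T (Λ.vertGen v) * T (Λ.vertGen w) = 0 := by
  rw [← h.star_vert v]
  refine h.rel3 _ _ fun ⟨g, k, l, h1, h2⟩ => hvw ?_
  exact h1.rng_eq.symm.trans h2.rng_eq

theorem IsCuntzKrieger.mul_src (h : IsCuntzKrieger T) (e : Λ.Gen) :
    T e * T (Λ.vertGen e.1.src) = T e := by
  rw [← h.rel1, ← mul_assoc, h.partial_isometry]

end Family

/-! ### The algebra `O(Λ_0)` -/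

variable (Λ) in
/-- The generator `T_v` of `O(Λ_0)`. -/
abbrev vertProj (v : Λ.Vert) : (Λ.below 0).O := (Λ.below 0).T ((Λ.below 0).vertGen v)

theorem star_vertProj (v : Λ.Vert) : star (Λ.vertProj v) = Λ.vertProj v :=
  (isCuntzKrieger_T (Λ.below 0)).star_vert v

theorem vertProj_mul_self (v : Λ.Vert) : Λ.vertProj v * Λ.vertProj v = Λ.vertProj v :=
  (isCuntzKrieger_T (Λ.below 0)).vert_mul_self v

theorem vertProj_mul_of_ne {v w : Λ.Vert} (h : v ≠ w) : Λ.vertProj v * Λ.vertProj w = 0 :=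
  (isCuntzKrieger_T (Λ.below 0)).vert_mul_vert h

theorem gen_below_zero (e : (Λ.below 0).Gen) : e = (Λ.below 0).vertGen e.1.rng :=
  Subtype.ext (eq_idPath e.1 (d_below_zero e.1))

variable (Λ) in
-- Products of the T_v are again some T_v or zero and adjoints are unchanged, so their linear span
-- is already a *-algebra and contains everything the generators generate.
theorem dense_span_vertProj : Dense (Submodule.span ℂ (Set.range Λ.vertProj) : Set (Λ.below 0).O) := by
  refine (CStarRelations.dense_adjoin_gen (Λ.below 0).relations).mono fun x hx => ?_
  have hgen : ∀ e, (Λ.below 0).relations.gen e ∈ Submodule.span ℂ (Set.range Λ.vertProj) := by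
    intro e
    rw [gen_below_zero e]
    exact Submodule.subset_span ⟨_, rfl⟩
  have hproj : ∀ v, Λ.vertProj v ∈ Submodule.span ℂ (Set.range Λ.vertProj) :=
    fun v => Submodule.subset_span ⟨v, rfl⟩
  refine NonUnitalStarAlgebra.adjoin_induction ℂ
    (p := fun x _ => x ∈ Submodule.span ℂ (Set.range Λ.vertProj)) ?_ ?_ ?_ ?_ ?_ ?_ hx
  · rintro _ ⟨e, rfl⟩
    exact hgen e
  · exact fun x y _ _ => add_mem
  · exact zero_mem _
  · clear hx x
    intro x y hx0 hy0 hx hy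
    clear hx0 hy0
    induction hx using Submodule.span_induction with
    | mem x hx =>
      obtain ⟨v, rfl⟩ := hx
      induction hy using Submodule.span_induction with
      | mem y hy =>
        obtain ⟨w, rfl⟩ := hy
        by_cases h : v = w
        · subst h; rw [vertProj_mul_self]; exact hproj v
        · rw [vertProj_mul_of_ne h]; exact zero_mem _
      | zero => rw [mul_zero]; exact zero_mem _
      | add x y _ _ h h' => rw [mul_add]; exact add_mem h h'
      | smul c x _ h => rw [mul_smul_comm]; exact Submodule.smul_mem _ _ h
    | zero => rw [zero_mul]; exact zero_mem _
    | add x y _ _ h h' => rw [add_mul]; exact add_mem h h'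
    | smul c x _ h => rw [smul_mul_assoc]; exact Submodule.smul_mem _ _ h
  · exact fun c x _ => Submodule.smul_mem _ c
  · clear hx x
    intro x hx0 hx
    clear hx0
    induction hx using Submodule.span_induction with
    | mem x hx => obtain ⟨v, rfl⟩ := hx; rw [star_vertProj]; exact hproj v
    | zero => rw [star_zero]; exact zero_mem _
    | add x y _ _ h h' => rw [star_add]; exact add_mem h h'
    | smul c x _ h => rw [star_smul]; exact Submodule.smul_mem _ _ h

/-- A closed linear condition holds on `O(Λ_0)` when it holds for the generators `T_v`. -/
theorem mem_of_vertProj_mem {S : Submodule ℂ (Λ.below 0).O} (hS : IsClosed (S : Set (Λ.below 0).O))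
    (h : ∀ v, Λ.vertProj v ∈ S) (a : (Λ.below 0).O) : a ∈ S :=
  closure_minimal (Submodule.span_le.mpr (by rintro _ ⟨v, rfl⟩; exact h v)) hS
    (dense_span_vertProj Λ a)

/-- *-homomorphisms on `O(Λ_0)` are determined by the images of the generators `T_v`. -/
theorem belowZero_hom_ext {B : Type*} [NonUnitalCStarAlgebra B] {φ ψ : (Λ.below 0).O →⋆ₙₐ[ℂ] B}
    (h : ∀ v, φ (Λ.vertProj v) = ψ (Λ.vertProj v)) : φ = ψ :=
  CStarRelations.hom_ext fun e => by rw [gen_below_zero e]; exact h _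

theorem exists_comp_below_zero {e f : (Λ.below 0).Path} (h : e.rng = f.rng) :
    ∃ g k l : (Λ.below 0).Path, Comp e g l ∧ Comp f k l := by
  rw [eq_idPath e (d_below_zero e), eq_idPath f (d_below_zero f), h]
  exact ⟨_, _, _, .mk (𝟙 f.rng) (𝟙 f.rng), .mk (𝟙 f.rng) (𝟙 f.rng)⟩

/-- A family of mutually orthogonal projections indexed by the vertices is a Cuntz-Krieger family
for `Λ_0`. -/
theorem isCuntzKrieger_below_zero {B : Type*} [NonUnitalCStarAlgebra B] {p : Λ.Vert → B}
    (hs : ∀ v, star (p v) = p v) (hp : ∀ v, p v * p v = p v)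
    (ho : ∀ v w, v ≠ w → p v * p w = 0) :
    IsCuntzKrieger (Λ := Λ.below 0) fun e => p e.1.rng where
  partial_isometry e := by
    have h : ∀ v, p v * star (p v) * p v = p v := fun v => by rw [hs, hp, hp]
    exact h e.1.rng
  rel1 e := by
    have h : e.1.src = e.1.rng := by
      conv_lhs => rw [eq_idPath e.1 (d_below_zero e.1)]
      rfl
    have h' : ∀ v, star (p v) * p v = p v := fun v => by rw [hs, hp]
    exact (h' e.1.rng).trans (congrArg p h.symm)
  rel2 e f g _ hd := by
    rw [d_below_zero, d_below_zero] at hd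
    exact absurd hd (lt_irrefl _)
  rel3 e f h := by
    have h' : ∀ v w, v ≠ w → star (p v) * p w = 0 := fun v w hvw => by rw [hs, ho v w hvw]
    exact h' _ _ fun hr => h (exists_comp_below_zero hr)
  rel4 β v h := by
    -- Relation (4) is vacuous: regularity at β would give a path in Λ_0 of length ω^β > 0, while
    -- all lengths there are 0.
    obtain ⟨f, _, hf⟩ := h.1 ((Λ.below 0).idPath v) rfl
      (by rw [idPath_d]; exact opow_pos β omega0_pos)
    rw [d_below_zero] at hf
    exact absurd hf (opow_pos β omega0_pos).ne

/-- The homomorphism on `O(Λ_0)` given by mutually orthogonal projections. -/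
def liftVert {B : Type u} [NonUnitalCStarAlgebra B] (p : Λ.Vert → B)
    (hs : ∀ v, star (p v) = p v) (hp : ∀ v, p v * p v = p v)
    (ho : ∀ v w, v ≠ w → p v * p w = 0) : (Λ.below 0).O →⋆ₙₐ[ℂ] B :=
  CStarRelations.lift (R := (Λ.below 0).relations) (isCuntzKrieger_below_zero hs hp ho)

theorem liftVert_vertProj {B : Type u} [NonUnitalCStarAlgebra B] (p : Λ.Vert → B)
    (hs : ∀ v, star (p v) = p v) (hp : ∀ v, p v * p v = p v)
    (ho : ∀ v w, v ≠ w → p v * p w = 0) (v : Λ.Vert) :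
    liftVert p hs hp ho (Λ.vertProj v) = p v :=
  CStarRelations.lift_gen (R := (Λ.below 0).relations) _ _

/-! ### Indicator functions in c_0(Λ_0) and the isomorphism with O(Λ_0) -/

open scoped Classical in
theorem c0Single_apply (v w : Λ.Vert) : c0Single v w = if w = v then 1 else 0 :=
  Pi.single_apply v (1 : ℂ) w

theorem norm_apply_le_c0 (f : C₀(Λ.Vert, ℂ)) (v : Λ.Vert) : ‖f v‖ ≤ ‖f‖ := by
  rw [← ZeroAtInftyContinuousMap.norm_toBCF_eq_norm]
  exact f.toBCF.norm_coe_le_norm v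

theorem norm_le_c0 {f : C₀(Λ.Vert, ℂ)} {M : ℝ} (hM : 0 ≤ M) (h : ∀ v, ‖f v‖ ≤ M) : ‖f‖ ≤ M := by
  rw [← ZeroAtInftyContinuousMap.norm_toBCF_eq_norm]
  exact (BoundedContinuousFunction.norm_le hM).mpr h

theorem mul_c0Single (f : C₀(Λ.Vert, ℂ)) (v : Λ.Vert) : f * c0Single v = f v • c0Single v := by
  classical
  ext w
  change f w * c0Single v w = f v * c0Single v w
  rw [c0Single_apply]
  split_ifs with h
  · rw [h]
  · rw [mul_zero, mul_zero]

theorem c0Single_mul_self (v : Λ.Vert) : c0Single v * c0Single v = c0Single v := by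
  classical
  rw [mul_c0Single, c0Single_apply, if_pos rfl, one_smul]

theorem c0Single_mul_of_ne (v w : Λ.Vert) (h : v ≠ w) : c0Single v * c0Single w = 0 := by
  classical
  rw [mul_c0Single, c0Single_apply, if_neg h.symm, zero_smul]

theorem star_c0Single (v : Λ.Vert) : star (c0Single v) = c0Single v := by
  classical
  ext w
  change star (c0Single v w) = c0Single v w
  rw [c0Single_apply]
  split_ifs <;> simp

/-- A function vanishing at infinity is in the closed span of the indicator functions of the points
where it does not vanish. -/
theorem mem_closure_span_c0Single (f : C₀(Λ.Vert, ℂ)) :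
    f ∈ (Submodule.span ℂ (c0Single '' {v | f v ≠ 0})).topologicalClosure := by
  classical
  refine Metric.mem_closure_iff.mpr fun ε hε => ?_
  -- The approximant is f cut down to this finite set. The remainder is at most ε / 2 at each
  -- vertex, hence strictly below ε in norm.
  have hfin : {v | ε / 2 ≤ ‖f v‖}.Finite := by
    have h1 := f.zero_at_infty'
    rw [Filter.cocompact_eq_cofinite] at h1
    have h2 := h1.norm.eventually_lt_const (by rw [norm_zero]; exact half_pos hε)
    exact (Filter.eventually_cofinite.mp h2).subset fun v hv => not_lt.mpr hv
  refine ⟨∑ v ∈ hfin.toFinset, f v • c0Single v, sum_mem fun v hv => ?_, ?_⟩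
  · refine Submodule.smul_mem _ _ (Submodule.subset_span ⟨v, fun h0 => ?_, rfl⟩)
    have := hfin.mem_toFinset.mp hv
    rw [Set.mem_ofPred_eq, h0, norm_zero] at this
    linarith
  · rw [dist_eq_norm]
    refine lt_of_le_of_lt (norm_le_c0 (half_pos hε).le fun v => ?_) (half_lt_self hε)
    have h1 : (∑ w ∈ hfin.toFinset, f w • c0Single w) v =
        ∑ w ∈ hfin.toFinset, f w * c0Single w v := by
      let ev : C₀(Λ.Vert, ℂ) →+ ℂ := AddMonoidHom.mk' (fun g => g v) fun _ _ => rfl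
      exact map_sum ev _ _
    rw [ZeroAtInftyContinuousMap.sub_apply, h1]
    simp only [c0Single_apply, mul_ite, mul_one, mul_zero, Finset.sum_ite_eq]
    split_ifs with hv
    · rw [_root_.sub_self, norm_zero]; exact (half_pos hε).le
    · rw [_root_.sub_zero]
      exact (not_le.mp fun h => hv (hfin.mem_toFinset.mpr h)).le

variable (Λ) in
/-- The homomorphism `O(Λ_0) → c_0(Λ_0)` with `T_v ↦ 1_v`. -/
def toC0 : (Λ.below 0).O →⋆ₙₐ[ℂ] Λ.c0 :=
  liftVert c0Single star_c0Single c0Single_mul_self c0Single_mul_of_ne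

theorem toC0_vertProj (v : Λ.Vert) : Λ.toC0 (Λ.vertProj v) = c0Single v :=
  liftVert_vertProj _ _ _ _ v

/-- The image of ∑ c_v T_v takes the value c_v at v, so its norm bounds every coefficient, and for
orthogonal projections the largest coefficient bounds the norm of the sum. The inequality is closed
and passes from the span to all of O(Λ_0). -/
theorem norm_le_norm_toC0 (a : (Λ.below 0).O) : ‖a‖ ≤ ‖Λ.toC0 a‖ := by
  classical
  refine closure_minimal (s := (Submodule.span ℂ (Set.range Λ.vertProj) : Set (Λ.below 0).O))
    (t := {a | ‖a‖ ≤ ‖Λ.toC0 a‖}) (fun a ha => ?_)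
    (isClosed_le continuous_norm Λ.toC0.continuous_cstar.norm) (dense_span_vertProj Λ a)
  obtain ⟨c, rfl⟩ := Finsupp.mem_span_range_iff_exists_finsupp.mp ha
  refine norm_sum_smul_projections_le _ _ star_vertProj vertProj_mul_self
    (fun _ _ h => vertProj_mul_of_ne h) c (norm_nonneg _) fun v hv => ?_
  refine le_of_eq_of_le ?_ (norm_apply_le_c0 _ v)
  let ev : C₀(Λ.Vert, ℂ) →+ ℂ := AddMonoidHom.mk' (fun g => g v) fun _ _ => rfl
  have h1 : Λ.toC0 (∑ w ∈ c.support, c w • Λ.vertProj w) v =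
      ∑ w ∈ c.support, c w * c0Single w v := by
    rw [map_sum]
    refine (map_sum ev _ _).trans (Finset.sum_congr rfl fun w _ => ?_)
    rw [map_smul, toC0_vertProj]
    rfl
  refine congrArg _ (Eq.trans ?_ h1.symm)
  simp only [c0Single_apply, mul_ite, mul_one, mul_zero, Finset.sum_ite_eq, if_pos hv]

theorem norm_toC0 (a : (Λ.below 0).O) : ‖Λ.toC0 a‖ = ‖a‖ :=
  le_antisymm (NonUnitalStarAlgHom.norm_apply_le _ a) (norm_le_norm_toC0 a)

variable (Λ) in
-- An isometry from a complete space has closed range; this range contains the indicator functions,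
-- whose span is dense.
theorem bijective_toC0 : Function.Bijective Λ.toC0 := by
  have hiso : Isometry Λ.toC0 := AddMonoidHomClass.isometry_of_norm _ norm_toC0
  refine ⟨hiso.injective, fun f => ?_⟩
  have hle : Submodule.span ℂ (c0Single '' {v | f v ≠ 0}) ≤
      LinearMap.range (Λ.toC0 : (Λ.below 0).O →ₗ[ℂ] Λ.c0) := by
    refine Submodule.span_le.mpr ?_
    rintro _ ⟨v, -, rfl⟩
    exact ⟨_, toC0_vertProj v⟩
  exact closure_minimal (t := Set.range Λ.toC0) hle hiso.isClosedEmbedding.isClosed_range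
    (mem_closure_span_c0Single f)

variable (Λ) in
/-- The isomorphism `O(Λ_0) ≃ c_0(Λ_0)` with `T_v ↦ 1_v`. -/
def belowZeroEquiv : (Λ.below 0).O ≃⋆ₐ[ℂ] Λ.c0 := StarAlgEquiv.ofBijective Λ.toC0 (bijective_toC0 Λ)

theorem belowZeroEquiv_vertProj (v : Λ.Vert) : Λ.belowZeroEquiv (Λ.vertProj v) = c0Single v :=
  toC0_vertProj v

/-- Through c_0(Λ_0), the T_v are minimal projections, and multiplying by one evaluates an element
at the vertex. This is how scalars are extracted from O(Λ_0). -/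
theorem mul_vertProj (a : (Λ.below 0).O) (v : Λ.Vert) :
    a * Λ.vertProj v = Λ.belowZeroEquiv a v • Λ.vertProj v := by
  refine EquivLike.injective Λ.belowZeroEquiv ?_
  rw [map_mul, map_smul, belowZeroEquiv_vertProj, mul_c0Single]

theorem vertProj_mul (a : (Λ.below 0).O) (v : Λ.Vert) :
    Λ.vertProj v * a = Λ.belowZeroEquiv a v • Λ.vertProj v := by
  rw [← mul_vertProj]
  refine EquivLike.injective Λ.belowZeroEquiv ?_
  rw [map_mul, map_mul, mul_comm]

/-- An element of `O(Λ_0)` lies in the closed span of the `T_v` for which its value at `v` does not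
vanish. -/
theorem mem_closure_span_vertProj (a : (Λ.below 0).O) :
    a ∈ (Submodule.span ℂ (Λ.vertProj '' {v | Λ.belowZeroEquiv a v ≠ 0})).topologicalClosure := by
  have hcont : Continuous Λ.belowZeroEquiv.symm :=
    (Λ.belowZeroEquiv.symm : Λ.c0 →⋆ₙₐ[ℂ] (Λ.below 0).O).continuous_cstar
  have := map_mem_closure hcont (mem_closure_span_c0Single (Λ.belowZeroEquiv a))
    (t := (Submodule.span ℂ (Λ.vertProj '' {v | Λ.belowZeroEquiv a v ≠ 0}) : Set _)) ?_
  · rwa [Λ.belowZeroEquiv.symm_apply_apply] at this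
  · intro f hf
    induction hf using Submodule.span_induction with
    | mem f hf =>
      obtain ⟨v, hv, rfl⟩ := hf
      rw [← belowZeroEquiv_vertProj, Λ.belowZeroEquiv.symm_apply_apply]
      exact Submodule.subset_span ⟨v, hv, rfl⟩
    | zero => rw [map_zero]; exact zero_mem _
    | add f g _ _ h h' => rw [map_add]; exact add_mem h h'
    | smul c f _ h => rw [map_smul]; exact Submodule.smul_mem _ _ h

end OrdinalGraph

namespace OrdinalGraph

universe u w

variable {Λ : OrdinalGraph.{u, w}}

/-! ### The isomorphism `X_0 ≃ Y` -/

theorem vertProj_mul_preX (x : Λ.preX 0) (e : Λ.Edge 0) : Λ.vertProj e.1.src * x.1 e = x.1 e :=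
  x.2 e

open scoped Classical in
-- The constraint T_{s(e)} x(e) = x(e) makes the function θ(x(e)) vanish away from s(e).
theorem belowZeroEquiv_preX (x : Λ.preX 0) (e : Λ.Edge 0) (v : Λ.Vert) :
    Λ.belowZeroEquiv (x.1 e) v =
      if e.1.src = v then Λ.belowZeroEquiv (x.1 e) e.1.src else 0 := by
  split_ifs with h
  · rw [h]
  · rw [← vertProj_mul_preX, map_mul, belowZeroEquiv_vertProj, mul_comm, mul_c0Single]
    change _ * c0Single e.1.src v = 0
    rw [c0Single_apply, if_neg (Ne.symm h), mul_zero]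

theorem preX_eq_smul (x : Λ.preX 0) (e : Λ.Edge 0) :
    x.1 e = Λ.belowZeroEquiv (x.1 e) e.1.src • Λ.vertProj e.1.src := by
  rw [← vertProj_mul, vertProj_mul_preX]

variable (Λ) in
/-- The isomorphism of `X_0°` with `c_c(Λ^1)`. -/
def preXEquiv : Λ.preX 0 ≃ₗ[ℂ] Λ.preY where
  toFun x := Finsupp.onFinset x.1.support (fun e => Λ.belowZeroEquiv (x.1 e) e.1.src)
    fun e he => Finsupp.mem_support_iff.mpr fun h0 => he (by rw [h0, map_zero]; rfl)
  map_add' x y := Finsupp.ext fun e =>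
    congrArg (fun f : Λ.c0 => f e.1.src) (map_add Λ.belowZeroEquiv (x.1 e) (y.1 e))
  map_smul' c x := Finsupp.ext fun e =>
    congrArg (fun f : Λ.c0 => f e.1.src) (map_smul Λ.belowZeroEquiv c (x.1 e))
  invFun f := ⟨Finsupp.onFinset f.support (fun e => f e • Λ.vertProj e.1.src)
    fun e he => Finsupp.mem_support_iff.mpr fun h0 => he (by rw [h0, zero_smul]), fun e => by
      change Λ.vertProj e.1.src * (f e • Λ.vertProj e.1.src) = f e • Λ.vertProj e.1.src
      rw [mul_smul_comm, vertProj_mul_self]⟩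
  left_inv x := preX_ext fun e => (preX_eq_smul x e).symm
  right_inv f := Finsupp.ext fun e => by
    classical
    change Λ.belowZeroEquiv (f e • Λ.vertProj e.1.src) e.1.src = f e
    rw [map_smul, belowZeroEquiv_vertProj]
    change f e * c0Single e.1.src e.1.src = f e
    rw [c0Single_apply, if_pos rfl, mul_one]

theorem preXEquiv_apply (x : Λ.preX 0) (e : Λ.Edge 0) :
    Λ.preXEquiv x e = Λ.belowZeroEquiv (x.1 e) e.1.src := rfl

/-- At a vertex v only the edges with source v contribute to ∑ x(e)* y(e), since θ(x(e)) and θ(y(e))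
are supported at s(e). What remains is the inner product of Y. -/
theorem ip_preXEquiv (x y : Λ.preX 0) :
    ip (Λ.preXEquiv x) (Λ.preXEquiv y) = Λ.belowZeroEquiv (ip x y) := by
  classical
  ext v
  change preYFun (Λ.preXEquiv x) (Λ.preXEquiv y) v =
    Λ.belowZeroEquiv (y.1.sum fun e b => star (x.1 e) * b) v
  have hsupp : (Λ.preXEquiv y).support ⊆ y.1.support := fun e he =>
    Finsupp.mem_support_iff.mpr fun h0 => Finsupp.mem_support_iff.mp he
      (by rw [preXEquiv_apply, h0, map_zero]; rfl)
  rw [preYFun_eq _ _ v hsupp, Finset.sum_filter,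
    Finsupp.sum, map_sum]
  let ev : C₀(Λ.Vert, ℂ) →+ ℂ := AddMonoidHom.mk' (fun g => g v) fun _ _ => rfl
  refine Eq.trans ?_ (map_sum ev _ _).symm
  refine Finset.sum_congr rfl fun e _ => ?_
  rw [map_mul, map_star]
  change _ = star (Λ.belowZeroEquiv (x.1 e) v) * Λ.belowZeroEquiv (y.1 e) v
  rw [belowZeroEquiv_preX x, belowZeroEquiv_preX y, preXEquiv_apply, preXEquiv_apply]
  split_ifs
  · rfl
  · rw [mul_zero]

variable (Λ) in
/-- The isomorphism of `X_0` with the graph correspondence. -/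
def XEquiv : Λ.X 0 ≃ₗ[ℂ] Λ.Y := Completed.mapEquiv Λ.preXEquiv Λ.belowZeroEquiv ip_preXEquiv

theorem XEquiv_of (x : Λ.preX 0) :
    Λ.XEquiv (Completed.of _ _ x) = Completed.of _ _ (Λ.preXEquiv x) :=
  Completed.mapEquiv_of _ _ _ x

theorem preDelta_apply (e f : Λ.Edge 0) [Decidable (e = f)] :
    (preDelta e).1 f = if e = f then Λ.vertProj e.1.src else 0 := by
  classical
  exact (Finsupp.single_apply).trans (by congr)

theorem XEquiv_delta (e : Λ.Edge 0) : Λ.XEquiv (delta e) = edgeVec e := by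
  classical
  refine (XEquiv_of _).trans (congrArg _ (Finsupp.ext fun f => ?_))
  rw [preXEquiv_apply, preDelta_apply, Finsupp.single_apply]
  split_ifs with h
  · subst h
    rw [belowZeroEquiv_vertProj, c0Single_apply, if_pos rfl]
  · rw [map_zero]; rfl

theorem leftAction_vertProj (v : Λ.Vert) : Λ.leftAction (Λ.vertProj v) = cut v :=
  CStarRelations.lift_gen _ _

end OrdinalGraph

/-! ### The left action as a continuous function of the coefficient -/

namespace Correspondence

variable {A X : Type*} [NonUnitalCStarAlgebra A] [NormedAddCommGroup X] [NormedSpace ℂ X]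
  [HilbertModule A X] (φ : A →⋆ₙₐ[ℂ] Adj A X)

/-- The map `a ↦ φ(a) x`. -/
def actOn (x : X) : A →ₗ[ℂ] X where
  toFun a := Adj.op (φ a) x
  map_add' a b := by rw [map_add]; rfl
  map_smul' c a := by rw [map_smul]; rfl

theorem continuous_actOn (x : X) : Continuous (actOn φ x) := by
  have h : Continuous fun T : Adj A X => Adj.op T x :=
    (ContinuousLinearMap.apply ℂ X x).continuous.comp continuous_subtype_val
  exact h.comp φ.continuous_cstar

end Correspondence

namespace OrdinalGraph

open Correspondence

universe u w

variable {Λ : OrdinalGraph.{u, w}}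

/-- The set where two continuous linear maps agree is a closed subspace, and the T_v span a dense
one. -/
theorem belowZero_linear_ext {Z : Type*} [NormedAddCommGroup Z] [NormedSpace ℂ Z]
    {f g : (Λ.below 0).O →ₗ[ℂ] Z} (hf : Continuous f) (hg : Continuous g)
    (h : ∀ v, f (Λ.vertProj v) = g (Λ.vertProj v)) (a : (Λ.below 0).O) : f a = g a :=
  mem_of_vertProj_mem (S := LinearMap.eqLocus f g) (isClosed_eq hf hg) h a

variable (Λ) in
-- Inner products and right actions are preserved by the general extension to completions. For the
-- left action, both sides are continuous and linear in a and continuous in x, which leaves a = T_v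
-- and finitely supported x; there both sides restrict a function to the edges with range v.
theorem isIso_XEquiv :
    Correspondence.IsIso Λ.leftAction Λ.graphAction Λ.belowZeroEquiv Λ.XEquiv where
  ip := Completed.ip_mapEquiv _ _ _
  right := Completed.mapEquiv_act _ _ _
  left a x := by
    have hU : Continuous Λ.XEquiv := Completed.continuous_mapEquiv _ _ _
    have hθ : Continuous Λ.belowZeroEquiv :=
      (Λ.belowZeroEquiv : (Λ.below 0).O →⋆ₙₐ[ℂ] Λ.c0).continuous_cstar
    refine belowZero_linear_ext (f := Λ.XEquiv.toLinearMap ∘ₗ actOn Λ.leftAction x)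
      (g := actOn Λ.graphAction (Λ.XEquiv x) ∘ₗ (Λ.belowZeroEquiv : (Λ.below 0).O →ₗ[ℂ] Λ.c0)) ?_ ?_ ?_ a
    · exact hU.comp (continuous_actOn _ x)
    · exact (continuous_actOn Λ.graphAction (Λ.XEquiv x)).comp hθ
    · intro v
      change Λ.XEquiv (Adj.op (Λ.leftAction (Λ.vertProj v)) x) =
        Adj.op (Λ.graphAction (Λ.belowZeroEquiv (Λ.vertProj v))) (Λ.XEquiv x)
      rw [leftAction_vertProj, belowZeroEquiv_vertProj]
      refine Completed.ind (isClosed_eq (hU.comp (ContinuousLinearMap.continuous _))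
        ((ContinuousLinearMap.continuous _).comp hU)) (fun x => ?_) x
      change Λ.XEquiv (Adj.op (cut v) _) = Adj.op (Λ.graphAction (c0Single v)) (Λ.XEquiv _)
      rw [cut_of, XEquiv_of, XEquiv_of]
      refine Eq.trans (congrArg _ (Finsupp.ext fun e => ?_)) (graphActionOp_of _ _).symm
      classical
      rw [preYLeft_apply, preXEquiv_apply, preXEquiv_apply, cutLin_apply, c0Single_apply]
      split_ifs
      · rw [one_mul]
      · rw [zero_mul, map_zero]; rfl

/-! ### The vectors `δ_e` -/

/-- The only surviving term is x(e)* T_{s(e)}, and the constraint on x(e) absorbs the projection.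
The δ_e thus read off coefficients like an orthogonal basis. -/
theorem ip_of_delta (x : Λ.preX 0) (e : Λ.Edge 0) :
    ip (Completed.of _ _ x : Λ.X 0) (delta e) = star (x.1 e) := by
  classical
  rw [delta, Completed.ip_of]
  change preXInner x (preDelta e) = _
  rw [preXInner_eq x (preDelta e) (s := {e}) Finsupp.support_single_subset, Finset.sum_singleton,
    preDelta_apply, if_pos rfl, ← star_vertProj, ← star_mul, vertProj_mul_preX]

theorem ip_delta_of (x : Λ.preX 0) (e : Λ.Edge 0) :
    ip (delta e) (Completed.of _ _ x : Λ.X 0) = x.1 e := by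
  rw [← star_ip, ip_of_delta, star_star]

theorem ip_delta_self (e : Λ.Edge 0) : ip (delta e) (delta e) = Λ.vertProj e.1.src := by
  classical
  refine (ip_delta_of _ e).trans ?_
  rw [preDelta_apply, if_pos rfl]

theorem ip_delta_of_ne {e f : Λ.Edge 0} (h : e ≠ f) : ip (delta e) (delta f) = 0 := by
  classical
  refine (ip_delta_of _ e).trans ?_
  rw [preDelta_apply, if_neg h.symm]

/-- A projection has norm 0 or 1. A generator of a universal algebra might vanish, but the image 1_v
of T_v in c_0(Λ_0) does not. -/
theorem norm_vertProj (v : Λ.Vert) : ‖Λ.vertProj v‖ = 1 := by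
  classical
  have h0 : Λ.vertProj v ≠ 0 := fun h => by
    have h1 : Λ.belowZeroEquiv (Λ.vertProj v) v = 0 := by rw [h, map_zero]; rfl
    rw [belowZeroEquiv_vertProj, c0Single_apply, if_pos rfl] at h1
    exact one_ne_zero h1
  have h2 : ‖Λ.vertProj v‖ * ‖Λ.vertProj v‖ = ‖Λ.vertProj v‖ := by
    rw [← CStarRing.norm_star_mul_self, star_vertProj, vertProj_mul_self]
  exact (mul_eq_right₀ (norm_ne_zero_iff.mpr h0)).mp h2

theorem norm_delta (e : Λ.Edge 0) : ‖(delta e : Λ.X 0)‖ = 1 := by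
  rw [← sq_eq_sq₀ (norm_nonneg _) zero_le_one, norm_sq, ip_delta_self, norm_vertProj, one_pow]

/-- A finitely supported function on the edges as a combination of the vectors `δ_e`. -/
theorem of_eq_sum (x : Λ.preX 0) {s : Finset (Λ.Edge 0)} (hs : x.1.support ⊆ s) :
    (Completed.of _ _ x : Λ.X 0) = ∑ e ∈ s, act (delta e) (x.1 e) := by
  classical
  have h1 : ∀ e : Λ.Edge 0, act (delta e) (x.1 e) =
      (Completed.of _ _ (preXAct (preDelta e) (x.1 e)) : Λ.X 0) := fun e =>
    Completed.act_of _ _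
  simp only [h1]
  rw [← map_sum]
  refine congrArg _ (preX_ext fun f => ?_)
  have h2 : (∑ e ∈ s, preXAct (preDelta e) (x.1 e)).1 f = ∑ e ∈ s, (preDelta e).1 f * x.1 e := by
    rw [AddSubmonoidClass.coe_finsetSum, Finsupp.finsetSum_apply]
    rfl
  rw [h2]
  simp only [preDelta_apply, ite_mul, zero_mul, Finset.sum_ite_eq']
  split_ifs with h
  · rw [vertProj_mul_preX]
  · exact Finsupp.notMem_support_iff.mp fun h' => h (hs h')

/-- The left action of `O(Λ_0)` on the vectors `δ_e`. -/
theorem leftAction_delta (a : (Λ.below 0).O) (e : Λ.Edge 0) :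
    Adj.op (Λ.leftAction a) (delta e) = Λ.belowZeroEquiv a e.1.rng • (delta e : Λ.X 0) := by
  classical
  let ev : Λ.c0 →ₗ[ℂ] ℂ :=
    { toFun := fun g => g e.1.rng, map_add' := fun _ _ => rfl, map_smul' := fun _ _ => rfl }
  have hev : Continuous ev := AddMonoidHomClass.continuous_of_bound ev 1 fun g => by
    rw [one_mul]; exact norm_apply_le_c0 g _
  have hθ : Continuous Λ.belowZeroEquiv :=
    (Λ.belowZeroEquiv : (Λ.below 0).O →⋆ₙₐ[ℂ] Λ.c0).continuous_cstar
  refine belowZero_linear_ext (f := actOn Λ.leftAction (delta e))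
    (g := (ev ∘ₗ (Λ.belowZeroEquiv : (Λ.below 0).O →ₗ[ℂ] Λ.c0)).smulRight (delta e))
    (continuous_actOn _ _) ((hev.comp hθ).smul continuous_const) (fun v => ?_) a
  change Adj.op (Λ.leftAction (Λ.vertProj v)) (delta e) =
    Λ.belowZeroEquiv (Λ.vertProj v) e.1.rng • (delta e : Λ.X 0)
  rw [leftAction_vertProj, belowZeroEquiv_vertProj, c0Single_apply, delta, cut_of, ← map_smul]
  refine congrArg _ (preX_ext fun f => ?_)
  rw [cutLin_apply]
  change _ = (if e.1.rng = v then (1 : ℂ) else 0) • (preDelta e).1 f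
  rw [preDelta_apply]
  by_cases h : e = f
  · subst h
    split_ifs <;> simp
  · simp [h]

/-- For a vertex `v` with `vΛ^1` finite, `φ_0(T_v)` is the sum of the `θ_{δ_e, δ_e}`. -/
theorem leftAction_vertProj_eq_sum (v : Λ.Vert) [Fintype {e : Λ.Edge 0 // e.1.rng = v}] :
    Λ.leftAction (Λ.vertProj v) =
      ∑ e : {e : Λ.Edge 0 // e.1.rng = v}, Adj.theta (delta e.1) (delta e.1) := by
  classical
  rw [leftAction_vertProj]
  refine Completed.adj_ext fun x => ?_
  let ev : Adj (Λ.below 0).O (Λ.X 0) →+ Λ.X 0 :=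
    AddMonoidHom.mk' (fun T => Adj.op T (Completed.of _ _ x)) fun _ _ => rfl
  refine Eq.trans ?_ (map_sum ev _ _).symm
  -- The expansion runs over the support enlarged by vΛ^1. Terms outside vΛ^1 vanish because the cut
  -- removes them, so it can be compared with the sum over vΛ^1 alone.
  rw [cut_of, of_eq_sum (cutLin v x) (Finset.subset_union_left
    (s₂ := Finset.univ.map (Function.Embedding.subtype fun e : Λ.Edge 0 => e.1.rng = v)))]
  refine Eq.trans ?_ (Finset.sum_map Finset.univ
    (Function.Embedding.subtype fun e : Λ.Edge 0 => e.1.rng = v)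
    fun e => act (delta e) (ip (delta e) (Completed.of _ _ x : Λ.X 0)))
  symm
  refine Finset.sum_subset_zero_on_sdiff Finset.subset_union_right (fun e he => ?_) fun e he => ?_
  · have hv : e.1.rng ≠ v := fun h => (Finset.mem_sdiff.mp he).2
      (Finset.mem_map.mpr ⟨⟨e, h⟩, Finset.mem_univ _, rfl⟩)
    rw [cutLin_apply, if_neg hv]
    exact map_zero (AddMonoidHom.mk' (fun a => act (delta e : Λ.X 0) a) fun a b =>
      ext_ip fun z => by rw [ip_act_right, ip_add_right, ip_act_right, ip_act_right, mul_add])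
  · obtain ⟨e, -, rfl⟩ := Finset.mem_map.mp he
    rw [cutLin_apply, ip_delta_of]
    exact congrArg _ (if_pos e.2).symm

/-! ### The Katsura ideal of `X_0` -/

/-- The maps are contractive uniformly in i, so a limit point differs from a nearby element of the
set by at most ε / 2 in every f i. Decay along the δ_e may therefore be checked on dense subsets. -/
theorem isClosed_setOf_tendsto_zero {ι Z W : Type*} [NormedAddCommGroup Z] [NormedAddCommGroup W]
    (f : ι → Z →+ W) (hf : ∀ i z, ‖f i z‖ ≤ ‖z‖) (l : Filter ι) :
    IsClosed {z | Filter.Tendsto (fun i => f i z) l (nhds 0)} := by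
  refine isClosed_of_closure_subset fun z hz => ?_
  refine Metric.tendsto_nhds.mpr fun ε hε => ?_
  obtain ⟨y, hy, hyz⟩ := Metric.mem_closure_iff.mp hz (ε / 2) (half_pos hε)
  filter_upwards [Metric.tendsto_nhds.mp hy (ε / 2) (half_pos hε)] with i hi
  rw [dist_zero_right] at hi ⊢
  calc ‖f i z‖ = ‖f i (z - y) + f i y‖ := by rw [← map_add, sub_add_cancel]
    _ ≤ ‖z - y‖ + ‖f i y‖ := (norm_add_le _ _).trans (by gcongr; exact hf i _)
    _ < ε / 2 + ε / 2 := by rw [← dist_eq_norm]; exact add_lt_add hyz hi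
    _ = ε := add_halves ε

/-- For finitely supported x the inner product is zero at all but finitely many edges; the general
case follows by closedness, as each δ_e has norm 1. -/
theorem tendsto_ip_delta (x : Λ.X 0) :
    Filter.Tendsto (fun e : Λ.Edge 0 => ip x (delta e)) Filter.cofinite (nhds 0) := by
  let f : Λ.Edge 0 → Λ.X 0 →+ (Λ.below 0).O := fun e =>
    AddMonoidHom.mk' (fun x => ip x (delta e)) fun x y => ip_add_left x y _
  refine Completed.ind (isClosed_setOf_tendsto_zero f (fun e x => ?_) _) (fun x => ?_) x
  · exact (norm_ip x (delta e)).trans_eq (by rw [norm_delta, mul_one])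
  · refine tendsto_const_nhds.congr' ?_
    filter_upwards [x.1.support.finite_toSet.compl_mem_cofinite] with e he
    change 0 = ip (Completed.of _ _ x : Λ.X 0) (delta e)
    rw [ip_of_delta, Finsupp.notMem_support_iff.mp he, star_zero]

/-- Compact operators on `X_0` are small on all but finitely many of the vectors `δ_e`. -/
theorem tendsto_compact_delta {K : Adj (Λ.below 0).O (Λ.X 0)}
    (hK : K ∈ Adj.compacts (Λ.below 0).O (Λ.X 0)) :
    Filter.Tendsto (fun e : Λ.Edge 0 => Adj.op K (delta e)) Filter.cofinite (nhds 0) := by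
  let f : Λ.Edge 0 → Adj (Λ.below 0).O (Λ.X 0) →+ Λ.X 0 := fun e =>
    AddMonoidHom.mk' (fun K => Adj.op K (delta e)) fun _ _ => rfl
  refine closure_minimal (s := (Adj.finiteRank (Λ.below 0).O (Λ.X 0) :
    Set (Adj (Λ.below 0).O (Λ.X 0)))) (fun K hK => ?_)
    (isClosed_setOf_tendsto_zero f (fun e K => ?_) Filter.cofinite) hK
  · change Filter.Tendsto (fun e : Λ.Edge 0 => Adj.op K (delta e)) Filter.cofinite (nhds 0)
    induction hK using Submodule.span_induction with
    | mem K h =>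
      obtain ⟨x, y, rfl⟩ := h
      -- The value of θ_{x,y} at δ_e is x · ⟨y, δ_e⟩, so the decay of ⟨y, δ_e⟩ suffices.
      refine squeeze_zero_norm (fun e => norm_act x (ip y (delta e))) ?_
      have := (tendsto_ip_delta y).norm.const_mul ‖x‖
      rwa [norm_zero, mul_zero] at this
    | zero => exact tendsto_const_nhds
    | add K L _ _ h h' =>
      have h1 := h.add h'
      rw [_root_.add_zero] at h1
      exact h1
    | smul c K _ h =>
      have h1 := h.const_smul c
      rw [smul_zero] at h1
      exact h1
  · exact ((Adj.op K).le_opNorm (delta e)).trans_eq (by rw [norm_delta, mul_one]; rfl)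

theorem finite_edges_of_rowFinite {v : Λ.Vert} (h : RowFinite (0 : Ordinal.{w}) v) :
    Finite {e : Λ.Edge 0 // e.1.rng = v} := by
  have : Finite {f : Λ.Path | f.rng = v ∧ f.d = ω ^ (0 : Ordinal.{w})} := h
  refine Finite.of_injective (β := {f : Λ.Path | f.rng = v ∧ f.d = ω ^ (0 : Ordinal.{w})})
    (fun e => ⟨e.1.1, e.2, e.1.2⟩) fun e e' hee => ?_
  exact Subtype.ext (Subtype.ext (Subtype.mk.inj hee))

/-- Source-regularity gives an edge f in vΛ^1, and φ_0(b)δ_f = b(v)δ_f, so φ_0(b) = 0 forces b(v) =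
0 and T_v b = b(v)T_v = 0. Finiteness of vΛ^1 makes φ_0(T_v) a finite sum of operators θ. -/
theorem vertProj_mem_katsuraIdeal {v : Λ.Vert} (h : Regular (0 : Ordinal.{w}) v) :
    Λ.vertProj v ∈ katsuraIdeal Λ.leftAction := by
  constructor
  · intro b hb
    obtain ⟨f, hf, hd⟩ := h.1 (Λ.idPath v) rfl
      (by rw [idPath_d]; exact opow_pos _ omega0_pos)
    have h1 := leftAction_delta b (⟨f, hd⟩ : Λ.Edge 0)
    rw [hb, Adj.op_zero, eq_comm, smul_eq_zero] at h1
    rw [vertProj_mul]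
    rcases h1 with h1 | h1
    · have h2 : f.rng = v := hf
      rw [h2] at h1
      rw [h1, zero_smul]
    · have h2 := norm_delta (⟨f, hd⟩ : Λ.Edge 0)
      rw [h1, norm_zero] at h2
      exact absurd h2 zero_ne_one
  · have := finite_edges_of_rowFinite h.2
    have := Fintype.ofFinite {e : Λ.Edge 0 // e.1.rng = v}
    rw [leftAction_vertProj_eq_sum]
    exact sum_mem fun e _ => Adj.theta_mem_compacts _ _

/-- If vΛ^1 is empty, then φ_0(T_v) = 0, and orthogonality to the kernel gives a(v)T_v = aT_v = 0.
If it is infinite, then φ_0(a)δ_e has norm |a(v)| for infinitely many e, contradicting the decay of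
compact operators along the δ_e. -/
theorem regular_of_mem_katsuraIdeal {a : (Λ.below 0).O} (ha : a ∈ katsuraIdeal Λ.leftAction)
    {v : Λ.Vert} (hv : Λ.belowZeroEquiv a v ≠ 0) : Regular (0 : Ordinal.{w}) v := by
  classical
  constructor
  · rintro e rfl he
    by_contra! hne
    -- Paths shorter than ω^0 = 1 are vertices, so 0-source-regularity only asks that vΛ^1 be
    -- nonempty.
    have hd : e.d = 0 := Order.lt_one_iff.mp (he.trans_eq (opow_zero _))
    have hsrc : e.src = e.rng := by
      conv_lhs => rw [eq_idPath e hd]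
      rfl
    have h1 : Λ.leftAction (Λ.vertProj e.rng) = 0 := by
      rw [leftAction_vertProj]
      refine Completed.adj_ext fun x => ?_
      rw [cut_of, Adj.op_zero, ← map_zero (Completed.of (Λ.below 0).O (Λ.preX 0))]
      refine congrArg _ (preX_ext fun f => ?_)
      rw [cutLin_apply, if_neg fun h => hne f.1 (h.trans hsrc.symm) f.2]
      rfl
    have h2 := ha.1 _ h1
    rw [mul_vertProj, smul_eq_zero] at h2
    rcases h2 with h2 | h2
    · exact hv h2
    · have h3 := norm_vertProj e.rng
      rw [h2, norm_zero] at h3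
      exact absurd h3 zero_ne_one
  · have h1 := (tendsto_compact_delta ha.2).norm.eventually_lt_const
      (by rw [norm_zero]; exact norm_pos_iff.mpr hv)
    have h2 : {e : Λ.Edge 0 | e.1.rng = v}.Finite := by
      refine (Filter.eventually_cofinite.mp h1).subset fun e he => ?_
      have he' : e.1.rng = v := he
      refine not_lt.mpr (le_of_eq ?_)
      rw [leftAction_delta, norm_smul, norm_delta, mul_one, he']
    refine (h2.image Subtype.val).subset ?_
    rintro f ⟨hf, hd⟩
    exact ⟨⟨f, hd⟩, hf, rfl⟩

end OrdinalGraph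

namespace OrdinalGraph

open Correspondence

universe u w

variable {Λ : OrdinalGraph.{u, w}}

/-! ### Generators of the algebra of a directed graph -/

/-- Recasts a composition with result k as a factorization of the fixed morphism `k.hom`, so that
two such compositions can be compared by unique factorization. -/
theorem Comp.exists_factor {e g k : Λ.Path} (h : Comp e g k) :
    ∃ p : Σ c : Λ.Vert, (k.src ⟶ c) × (c ⟶ k.rng),
      (Λ.deg p.2.2 = e.d ∧ p.2.1 ≫ p.2.2 = k.hom) ∧ e = ⟨p.1, k.rng, p.2.2⟩ := by
  cases h with
  | mk f e => exact ⟨⟨_, f, e⟩, ⟨rfl, rfl⟩, rfl⟩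

/-- Two paths of the same length with a common extension are equal. -/
theorem eq_of_comp {e f g h k : Λ.Path} (he : Comp e g k) (hf : Comp f h k) (hd : e.d = f.d) :
    e = f := by
  obtain ⟨p, hp, rfl⟩ := he.exists_factor
  obtain ⟨q, hq, rfl⟩ := hf.exists_factor
  rw [← hd] at hq
  have hle : Path.d (⟨p.1, k.rng, p.2.2⟩ : Λ.Path) ≤ Λ.deg k.hom := by
    rw [← hp.2, Λ.deg_comp]; exact le_self_add
  rw [(Λ.factor k.hom _ hle).unique hp hq]

theorem edge_d (e : Λ.Edge 0) : e.1.d = 1 := e.2.trans (opow_zero _)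

/-- For α ≥ 1 the length ω^α is at least ω, which is infinite. The generators of O(Λ) are therefore
only vertices and edges. -/
theorem eq_zero_of_isDirectedGraph (hΛ : Λ.IsDirectedGraph) {e : Λ.Path} {α : Ordinal.{w}}
    (h : e.d = ω ^ α) : α = 0 := by
  by_contra h0
  refine absurd (hΛ e) (not_lt.mpr ?_)
  rw [h]
  exact opow_le_opow_right omega0_pos (Order.one_le_iff_pos.mpr (pos_iff_ne_zero.mpr h0))

theorem gen_cases (hΛ : Λ.IsDirectedGraph) (g : Λ.Gen) :
    (∃ v, g = Λ.vertGen v) ∨ ∃ e : Λ.Edge 0, g = edgeGen e := by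
  obtain ⟨e, h⟩ := g
  by_cases h0 : e.d = 0
  · exact Or.inl ⟨e.rng, Subtype.ext (eq_idPath e h0)⟩
  · obtain ⟨α, hα⟩ := h.resolve_left h0
    obtain rfl := eq_zero_of_isDirectedGraph hΛ hα
    exact Or.inr ⟨⟨e, hα⟩, rfl⟩

theorem Comp.eq_of_idPath {v : Λ.Vert} {f g : Λ.Path} (h : Comp (Λ.idPath v) f g) :
    f.rng = v ∧ g = f := by
  unfold idPath at h
  cases h
  exact ⟨rfl, by rw [Category.comp_id]⟩

/-! ### The representation of `X_0` defined by a Cuntz-Krieger family -/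

section Representation

variable {B : Type u} [NonUnitalCStarAlgebra B] {T : Λ.Gen → B} (hT : IsCuntzKrieger T)

/-- The homomorphism on `O(Λ_0)` given by a Cuntz-Krieger family. -/
def repPi : (Λ.below 0).O →⋆ₙₐ[ℂ] B :=
  liftVert (fun v => T (Λ.vertGen v)) hT.star_vert hT.vert_mul_self
    fun _ _ h => hT.vert_mul_vert h

theorem repPi_vertProj (v : Λ.Vert) : repPi hT (Λ.vertProj v) = T (Λ.vertGen v) :=
  liftVert_vertProj _ _ _ _ v

/-- The map `x ↦ ∑ T_e π(x(e))` on `X_0°` given by a Cuntz-Krieger family. -/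
def prePsi : Λ.preX 0 →ₗ[ℂ] B :=
  Finsupp.lsum ℂ (fun e : Λ.Edge 0 => LinearMap.mulLeft ℂ (T (edgeGen e)) ∘ₗ
    (repPi hT : (Λ.below 0).O →ₗ[ℂ] B)) ∘ₗ (Λ.preX 0).subtype

theorem prePsi_eq (x : Λ.preX 0) {s : Finset (Λ.Edge 0)} (h : x.1.support ⊆ s) :
    prePsi hT x = ∑ e ∈ s, T (edgeGen e) * repPi hT (x.1 e) := by
  change x.1.sum (fun e b => T (edgeGen e) * repPi hT b) = _
  refine Finsupp.sum_of_support_subset _ h _ fun e _ => ?_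
  rw [map_zero, mul_zero]

/-- Edges have equal length, so by unique factorization distinct ones have no common extension, and
relation (3) applies. -/
theorem IsCuntzKrieger.star_edge_mul_edge_of_ne {B : Type*} [NonUnitalCStarAlgebra B]
    {T : Λ.Gen → B} (hT : IsCuntzKrieger T) {e f : Λ.Edge 0} (h : e ≠ f) :
    star (T (edgeGen e)) * T (edgeGen f) = 0 :=
  hT.rel3 _ _ fun ⟨_, _, _, h1, h2⟩ => h (Subtype.ext (eq_of_comp h1 h2 (e.2.trans f.2.symm)))

theorem IsCuntzKrieger.vert_mul_edge {B : Type*} [NonUnitalCStarAlgebra B]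
    {T : Λ.Gen → B} (hT : IsCuntzKrieger T) (e : Λ.Edge 0) :
    T (Λ.vertGen e.1.rng) * T (edgeGen e) = T (edgeGen e) :=
  hT.rel2 _ _ _ (comp_idPath_left e.1) (by
    change (Λ.idPath e.1.rng).d < e.1.d
    rw [idPath_d, edge_d]; exact zero_lt_one)

theorem IsCuntzKrieger.vert_mul_edge_of_ne {B : Type*} [NonUnitalCStarAlgebra B]
    {T : Λ.Gen → B} (hT : IsCuntzKrieger T) {v : Λ.Vert} {e : Λ.Edge 0} (h : e.1.rng ≠ v) :
    T (Λ.vertGen v) * T (edgeGen e) = 0 := by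
  rw [← hT.vert_mul_edge, ← mul_assoc, hT.vert_mul_vert h.symm, zero_mul]

/-- Distinct edges have orthogonal ranges, so the cross terms vanish. On the diagonal T_e*T_e =
π(T_{s(e)}), which y(e) absorbs. -/
theorem star_prePsi_mul (x y : Λ.preX 0) :
    star (prePsi hT x) * prePsi hT y = repPi hT (ip x y) := by
  classical
  have h1 : ip x y = ∑ e ∈ x.1.support ∪ y.1.support, star (x.1 e) * y.1 e :=
    preXInner_eq x y Finset.subset_union_right
  rw [h1, prePsi_eq hT x Finset.subset_union_left, prePsi_eq hT y Finset.subset_union_right,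
    star_sum, Finset.sum_mul_sum, map_sum]
  refine Finset.sum_congr rfl fun e he => ?_
  rw [Finset.sum_eq_single_of_mem e he fun f _ hf => ?_]
  · rw [star_mul, mul_assoc, ← mul_assoc (star (T _)), hT.rel1]
    change _ * (T (Λ.vertGen e.1.src) * _) = _
    rw [← repPi_vertProj hT, ← map_mul, vertProj_mul_preX, map_mul, map_star]
  · rw [star_mul, mul_assoc, ← mul_assoc (star (T _)), hT.star_edge_mul_edge_of_ne hf.symm,
      zero_mul, mul_zero]

theorem norm_prePsi_le (x : Λ.preX 0) :
    ‖prePsi hT x‖ ≤ 1 * ‖Completed.of (Λ.below 0).O (Λ.preX 0) x‖ := by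
  rw [one_mul, ← sq_le_sq₀ (norm_nonneg _) (norm_nonneg _), Completed.norm_of_sq, sq,
    ← CStarRing.norm_star_mul_self, star_prePsi_mul]
  exact NonUnitalStarAlgHom.norm_apply_le _ _

/-- The map `X_0 → B` given by a Cuntz-Krieger family in `B`. -/
def repPsi : Λ.X 0 →L[ℂ] B := Completed.extendTo (prePsi hT) 1 (norm_prePsi_le hT)

theorem repPsi_of (x : Λ.preX 0) : repPsi hT (Completed.of _ _ x) = prePsi hT x :=
  Completed.extendTo_of _ _ _ x

theorem repPsi_delta (e : Λ.Edge 0) : repPsi hT (delta e) = T (edgeGen e) := by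
  classical
  rw [delta, repPsi_of, prePsi_eq hT (preDelta e) (s := {e}) Finsupp.support_single_subset,
    Finset.sum_singleton, preDelta_apply, if_pos rfl, repPi_vertProj]
  exact hT.mul_src (edgeGen e)

/-- By continuity every identity reduces to finitely supported vectors, and the left one also to a =
T_v. There T_v T_e is T_e or 0 according to whether r(e) = v, which matches the action of φ_0(T_v).
-/
theorem isRepresentation_rep :
    IsRepresentation Λ.leftAction (repPsi hT).toLinearMap (repPi hT) where
  right x a := by
    have hact : Continuous fun x : Λ.X 0 => act x a :=
      AddMonoidHomClass.continuous_of_bound (actLin a : Λ.X 0 →ₗ[ℂ] Λ.X 0) ‖a‖ fun x => by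
        rw [mul_comm]; exact norm_act x a
    refine Completed.ind (isClosed_eq ((repPsi hT).continuous.mul continuous_const)
      ((repPsi hT).continuous.comp hact)) (fun x => ?_) x
    change repPsi hT _ * _ = repPsi hT (act _ a)
    rw [Completed.act_of, repPsi_of, repPsi_of, prePsi_eq hT x subset_rfl,
      prePsi_eq hT (act x a) (s := x.1.support) (Finsupp.support_mapRange (hf := zero_mul a)),
      Finset.sum_mul]
    refine Finset.sum_congr rfl fun e _ => ?_
    rw [mul_assoc, ← map_mul]
    rfl
  left a x := by
    refine belowZero_linear_ext (f := LinearMap.mulRight ℂ (repPsi hT x) ∘ₗ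
        (repPi hT : (Λ.below 0).O →ₗ[ℂ] B))
      (g := (repPsi hT).toLinearMap ∘ₗ actOn Λ.leftAction x)
      ((repPi hT).continuous_cstar.mul continuous_const)
      ((repPsi hT).continuous.comp (continuous_actOn _ x)) (fun v => ?_) a
    change repPi hT (Λ.vertProj v) * repPsi hT x =
      repPsi hT (Adj.op (Λ.leftAction (Λ.vertProj v)) x)
    rw [leftAction_vertProj, repPi_vertProj]
    refine Completed.ind (isClosed_eq (continuous_const.mul (repPsi hT).continuous)
      ((repPsi hT).continuous.comp (ContinuousLinearMap.continuous _))) (fun x => ?_) x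
    classical
    change T (Λ.vertGen v) * repPsi hT _ = repPsi hT (Adj.op (cut v) _)
    rw [cut_of, repPsi_of, repPsi_of, prePsi_eq hT x subset_rfl, prePsi_eq hT (cutLin v x)
      (s := x.1.support) ((Finsupp.support_filter _ _).trans_subset (Finset.filter_subset _ _)),
      Finset.mul_sum]
    refine Finset.sum_congr rfl fun e _ => ?_
    rw [cutLin_apply, ← mul_assoc]
    split_ifs with h
    · rw [← h, hT.vert_mul_edge]
    · rw [hT.vert_mul_edge_of_ne h, zero_mul, map_zero, mul_zero]
  ip x y := by
    refine Completed.ind (isClosed_eq ((repPsi hT).continuous.star.mul continuous_const)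
      ((repPi hT).continuous_cstar.comp (continuous_ip continuous_id' continuous_const)))
      (fun x => ?_) x
    refine Completed.ind (isClosed_eq (continuous_const.mul (repPsi hT).continuous)
      ((repPi hT).continuous_cstar.comp (continuous_ip continuous_const continuous_id')))
      (fun y => ?_) y
    change star (repPsi hT _) * repPsi hT _ = repPi hT (ip (Completed.of _ _ x) _)
    rw [Completed.ip_of, repPsi_of, repPsi_of, star_prePsi_mul]

/-- Relation (4) at α = 0 is covariance at T_v: both coordinates are sums over vΛ^1, with terms
θ_{δ_e,δ_e} and ψ(δ_e)ψ(δ_e)*. -/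
theorem vertProj_mem_inducedGraph {v : Λ.Vert} (h : Regular (0 : Ordinal.{w}) v) :
    (Λ.leftAction (Λ.vertProj v), repPi hT (Λ.vertProj v)) ∈
      inducedGraph (repPsi hT).toLinearMap := by
  have := finite_edges_of_rowFinite h.2
  have := Fintype.ofFinite {e : Λ.Edge 0 // e.1.rng = v}
  rw [leftAction_vertProj_eq_sum, repPi_vertProj, hT.rel4 0 v h, finsum_eq_sum_of_fintype]
  let f : {e : Λ.Edge 0 // e.1.rng = v} → Adj (Λ.below 0).O (Λ.X 0) × B := fun e =>
    (Adj.theta (delta e.1) (delta e.1), T (edgeGen e.1) * star (T (edgeGen e.1)))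
  have hsum : (∑ e, (f e).1, ∑ e, (f e).2) = ∑ e, f e :=
    Prod.ext Prod.fst_sum.symm Prod.snd_sum.symm
  change (∑ e, (f e).1, ∑ e, (f e).2) ∈ _
  rw [hsum]
  refine sum_mem fun e _ => ?_
  change (Adj.theta _ _, T (edgeGen e.1) * star (T (edgeGen e.1))) ∈ _
  rw [← repPsi_delta hT]
  exact theta_mem_inducedGraph _ _

/-- The elements a with (φ_0(a), π(a)) in the closed graph form a closed subspace. An element of the
Katsura ideal lies in the closed span of the T_v at which it is nonzero, and all those vertices are
regular. -/
theorem isCovariant_rep : IsCovariant Λ.leftAction (repPsi hT).toLinearMap (repPi hT) := by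
  refine (isRepresentation_rep hT).isCovariant fun a ha => ?_
  let L : (Λ.below 0).O →ₗ[ℂ] Adj (Λ.below 0).O (Λ.X 0) × B :=
    LinearMap.prod (Λ.leftAction : (Λ.below 0).O →ₗ[ℂ] Adj (Λ.below 0).O (Λ.X 0))
      (repPi hT : (Λ.below 0).O →ₗ[ℂ] B)
  have hL : Continuous L :=
    (Λ.leftAction).continuous_cstar.prodMk (repPi hT).continuous_cstar
  have hcl : IsClosed ((inducedGraph (repPsi hT).toLinearMap).comap L : Set (Λ.below 0).O) :=
    (Submodule.isClosed_topologicalClosure _).preimage hL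
  refine closure_minimal (Submodule.span_le.mpr ?_) hcl (mem_closure_span_vertProj a)
  rintro _ ⟨v, hv, rfl⟩
  exact vertProj_mem_inducedGraph hT (regular_of_mem_katsuraIdeal ha hv)

end Representation

/-! ### The Cuntz-Krieger family of `O(X_0)` -/

variable (Λ) in
open scoped Classical in
/-- The family in `O(X_0)` given by the elements `π_u(T_v)` and `ψ_u(δ_e)`. -/
def pimsnerFamily (g : Λ.Gen) : CuntzPimsner Λ.leftAction :=
  if h : g.1.d = ω ^ (0 : Ordinal.{w}) then psiU Λ.leftAction (delta ⟨g.1, h⟩)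
  -- In a directed graph this branch contains exactly the vertices. Otherwise it also assigns a
  -- default value to generators of length ω^α with α > 0.
  else piU Λ.leftAction (Λ.vertProj g.1.rng)

theorem pimsnerFamily_vertGen (v : Λ.Vert) :
    Λ.pimsnerFamily (Λ.vertGen v) = piU Λ.leftAction (Λ.vertProj v) := by
  have h : (Λ.idPath v).d ≠ ω ^ (0 : Ordinal.{w}) := by
    rw [idPath_d, opow_zero]; exact zero_ne_one
  exact dif_neg h

theorem pimsnerFamily_edgeGen (e : Λ.Edge 0) :
    Λ.pimsnerFamily (edgeGen e) = psiU Λ.leftAction (delta e) := dif_pos e.2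

theorem star_piU_vertProj (v : Λ.Vert) :
    star (piU Λ.leftAction (Λ.vertProj v)) = piU Λ.leftAction (Λ.vertProj v) := by
  change star (piUHom Λ.leftAction _) = piUHom Λ.leftAction _
  rw [← map_star, star_vertProj]

theorem piU_vertProj_mul (v w : Λ.Vert) [Decidable (v = w)] :
    piU Λ.leftAction (Λ.vertProj v) * piU Λ.leftAction (Λ.vertProj w) =
      if v = w then piU Λ.leftAction (Λ.vertProj v) else 0 := by
  change piUHom Λ.leftAction _ * piUHom Λ.leftAction _ = _
  rw [← map_mul]
  split_ifs with h
  · subst h; rw [vertProj_mul_self]; rfl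
  · rw [vertProj_mul_of_ne h, map_zero]

theorem star_psiU_delta_mul_self (e : Λ.Edge 0) :
    star (psiU Λ.leftAction (delta e)) * psiU Λ.leftAction (delta e) =
      piU Λ.leftAction (Λ.vertProj e.1.src) :=
  ((isRepresentation_universal Λ.leftAction).ip _ _).trans
    (congrArg (piU Λ.leftAction) (ip_delta_self e))

theorem star_psiU_delta_mul_of_ne {e f : Λ.Edge 0} (h : e ≠ f) :
    star (psiU Λ.leftAction (delta e)) * psiU Λ.leftAction (delta f) = 0 :=
  ((isRepresentation_universal Λ.leftAction).ip _ _).trans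
    ((congrArg (piUHom Λ.leftAction) (ip_delta_of_ne h)).trans (map_zero _))

theorem piU_mul_psiU_delta (v : Λ.Vert) (e : Λ.Edge 0) [Decidable (e.1.rng = v)] :
    piU Λ.leftAction (Λ.vertProj v) * psiU Λ.leftAction (delta e) =
      if e.1.rng = v then psiU Λ.leftAction (delta e) else 0 := by
  refine ((isRepresentation_universal Λ.leftAction).left _ _).trans ?_
  rw [leftAction_delta, map_smul, belowZeroEquiv_vertProj, c0Single_apply]
  split_ifs
  · rw [one_smul]; rfl
  · rw [zero_smul]

theorem psiU_delta_mul_piU (e : Λ.Edge 0) :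
    psiU Λ.leftAction (delta e) * piU Λ.leftAction (Λ.vertProj e.1.src) =
      psiU Λ.leftAction (delta e) := by
  refine ((isRepresentation_universal Λ.leftAction).right _ _).trans (congrArg _ ?_)
  refine (Completed.act_of (preDelta e) (Λ.vertProj e.1.src)).trans
    (congrArg _ (preX_ext fun f => ?_))
  classical
  change (preDelta e).1 f * _ = _
  rw [preDelta_apply]
  split_ifs
  · rw [vertProj_mul_self]
  · rw [zero_mul]

/-- With only vertices and edges as generators, relations (1)-(3) follow from the inner products of
the δ_e and the left action on them. Relation (4) is covariance of the universal representation at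
T_v. -/
theorem isCuntzKrieger_pimsnerFamily (hΛ : Λ.IsDirectedGraph) :
    IsCuntzKrieger Λ.pimsnerFamily := by
  classical
  have rel1 : ∀ e, star (Λ.pimsnerFamily e) * Λ.pimsnerFamily e =
      Λ.pimsnerFamily (Λ.vertGen e.1.src) := by
    intro g
    obtain ⟨v, rfl⟩ | ⟨e, rfl⟩ := gen_cases hΛ g
    · rw [pimsnerFamily_vertGen, star_piU_vertProj, piU_vertProj_mul, if_pos rfl]
      exact (pimsnerFamily_vertGen v).symm
    · rw [pimsnerFamily_edgeGen, star_psiU_delta_mul_self]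
      exact (pimsnerFamily_vertGen e.1.src).symm
  refine ⟨fun e => ?_, rel1, fun e f g h hd => ?_, fun e f h => ?_, fun α v h => ?_⟩
  · rw [mul_assoc, rel1]
    obtain ⟨v, rfl⟩ | ⟨e, rfl⟩ := gen_cases hΛ e
    · change _ * Λ.pimsnerFamily (Λ.vertGen v) = _
      rw [pimsnerFamily_vertGen, piU_vertProj_mul, if_pos rfl]
    · change _ * Λ.pimsnerFamily (Λ.vertGen e.1.src) = _
      rw [pimsnerFamily_vertGen, pimsnerFamily_edgeGen, psiU_delta_mul_piU]
  -- The strict inequality of lengths leaves only a vertex times an edge, whose composite is the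
  -- edge itself.
  · obtain ⟨v, rfl⟩ | ⟨e, rfl⟩ := gen_cases hΛ e
    · obtain ⟨hv, hg⟩ := Comp.eq_of_idPath h
      obtain rfl : g = f := Subtype.ext hg
      obtain ⟨w, rfl⟩ | ⟨e, rfl⟩ := gen_cases hΛ g
      · exact absurd (hd.trans_eq (idPath_d w)) not_lt_zero
      · rw [pimsnerFamily_vertGen, pimsnerFamily_edgeGen, piU_mul_psiU_delta]
        exact if_pos hv
    · obtain ⟨w, rfl⟩ | ⟨f, rfl⟩ := gen_cases hΛ f
      · exact absurd (hd.trans_eq (idPath_d w)) not_lt_zero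
      · exact absurd (hd.trans_eq (f.2.trans e.2.symm)) (lt_irrefl _)
  · have hve : ∀ v (e : Λ.Edge 0),
        (¬ ∃ g h k : Λ.Path, Comp (Λ.idPath v) g k ∧ Comp e.1 h k) →
          piU Λ.leftAction (Λ.vertProj v) * psiU Λ.leftAction (delta e) = 0 := by
      intro v e h
      rw [piU_mul_psiU_delta, if_neg]
      rintro rfl
      exact h ⟨_, _, _, comp_idPath_left e.1, comp_idPath_right e.1⟩
    obtain ⟨v, rfl⟩ | ⟨e, rfl⟩ := gen_cases hΛ e
    · obtain ⟨w, rfl⟩ | ⟨f, rfl⟩ := gen_cases hΛ f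
      · rw [pimsnerFamily_vertGen, pimsnerFamily_vertGen, star_piU_vertProj, piU_vertProj_mul,
          if_neg]
        rintro rfl
        exact h ⟨_, _, _, comp_idPath_left (Λ.idPath v), comp_idPath_left (Λ.idPath v)⟩
      · rw [pimsnerFamily_vertGen, pimsnerFamily_edgeGen, star_piU_vertProj]
        exact hve v f h
    · obtain ⟨v, rfl⟩ | ⟨f, rfl⟩ := gen_cases hΛ f
      -- The edge-vertex case is the adjoint of the vertex-edge case, with the two extensions
      -- exchanged.
      · rw [pimsnerFamily_vertGen, pimsnerFamily_edgeGen, ← star_piU_vertProj, ← star_mul,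
          hve v e fun ⟨g, h', k, h1, h2⟩ => h ⟨h', g, k, h2, h1⟩, star_zero]
      · rw [pimsnerFamily_edgeGen, pimsnerFamily_edgeGen, star_psiU_delta_mul_of_ne]
        rintro rfl
        exact h ⟨_, _, _, comp_idPath_right e.1, comp_idPath_right e.1⟩
  -- Source-regularity at α produces a path of length ω^α, which in a directed graph forces α = 0.
  · obtain ⟨f, -, hf⟩ := h.1 (Λ.idPath v) rfl (by rw [idPath_d]; exact opow_pos _ omega0_pos)
    obtain rfl := eq_zero_of_isDirectedGraph hΛ hf
    have := finite_edges_of_rowFinite h.2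
    have := Fintype.ofFinite {e : Λ.Edge 0 // e.1.rng = v}
    rw [pimsnerFamily_vertGen, finsum_eq_sum_of_fintype, piU_eq_sum Λ.leftAction Finset.univ _ _
      (vertProj_mem_katsuraIdeal h) (leftAction_vertProj_eq_sum v)]
    simp only [pimsnerFamily_edgeGen]

/-! ### The isomorphism `O(X_0) ≃ O(Λ)` -/

variable (Λ) in
/-- The homomorphism `O(X_0) → O(Λ)` with `π_u(T_v) ↦ T_v` and `ψ_u(δ_e) ↦ T_e`. -/
def pimsnerToO : CuntzPimsner Λ.leftAction →⋆ₙₐ[ℂ] Λ.O :=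
  CStarRelations.lift (R := Correspondence.relations Λ.leftAction)
    (f := Sum.elim (repPsi (isCuntzKrieger_T Λ)) (repPi (isCuntzKrieger_T Λ)))
    ⟨_, _, isCovariant_rep (isCuntzKrieger_T Λ), rfl⟩

theorem pimsnerToO_psiU (x : Λ.X 0) :
    Λ.pimsnerToO (psiU Λ.leftAction x) = repPsi (isCuntzKrieger_T Λ) x :=
  CStarRelations.lift_gen (R := Correspondence.relations Λ.leftAction) _ (Sum.inl x)

theorem pimsnerToO_piU (a : (Λ.below 0).O) :
    Λ.pimsnerToO (piU Λ.leftAction a) = repPi (isCuntzKrieger_T Λ) a :=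
  CStarRelations.lift_gen (R := Correspondence.relations Λ.leftAction) _ (Sum.inr a)

/-- The homomorphism `O(Λ) → O(X_0)` with `T_v ↦ π_u(T_v)` and `T_e ↦ ψ_u(δ_e)`. -/
def toPimsner (hΛ : Λ.IsDirectedGraph) : Λ.O →⋆ₙₐ[ℂ] CuntzPimsner Λ.leftAction :=
  CStarRelations.lift (R := Λ.relations) (isCuntzKrieger_pimsnerFamily hΛ)

theorem toPimsner_T (hΛ : Λ.IsDirectedGraph) (g : Λ.Gen) :
    toPimsner hΛ (Λ.T g) = Λ.pimsnerFamily g := CStarRelations.lift_gen (R := Λ.relations) _ g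

theorem pimsnerToO_comp_toPimsner (hΛ : Λ.IsDirectedGraph) :
    Λ.pimsnerToO.comp (toPimsner hΛ) = NonUnitalStarAlgHom.id ℂ Λ.O := by
  refine CStarRelations.hom_ext fun g => ?_
  obtain ⟨v, rfl⟩ | ⟨e, rfl⟩ := gen_cases hΛ g
  · change Λ.pimsnerToO (toPimsner hΛ (Λ.T _)) = Λ.T _
    rw [toPimsner_T, pimsnerFamily_vertGen, pimsnerToO_piU, repPi_vertProj]
  · change Λ.pimsnerToO (toPimsner hΛ (Λ.T _)) = Λ.T _
    rw [toPimsner_T, pimsnerFamily_edgeGen, pimsnerToO_psiU, repPsi_delta]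

/-- The generators of O(X_0) include every element of O(Λ_0) and of X_0. The former reduce to the
T_v; the latter reduce, by density and the expansion x = ∑ δ_e · x(e), to the δ_e and the former. -/
theorem toPimsner_comp_pimsnerToO (hΛ : Λ.IsDirectedGraph) :
    (toPimsner hΛ).comp Λ.pimsnerToO = NonUnitalStarAlgHom.id ℂ (CuntzPimsner Λ.leftAction) := by
  have hpi : ∀ a, toPimsner hΛ (repPi (isCuntzKrieger_T Λ) a) = piU Λ.leftAction a := by
    intro a
    refine DFunLike.congr_fun (belowZero_hom_ext (φ := (toPimsner hΛ).comp
      (repPi (isCuntzKrieger_T Λ))) (ψ := piUHom Λ.leftAction) fun v => ?_) a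
    change toPimsner hΛ (repPi (isCuntzKrieger_T Λ) _) = piU _ _
    rw [repPi_vertProj, toPimsner_T, pimsnerFamily_vertGen]
  refine CStarRelations.hom_ext ?_
  rintro (x | a)
  · change toPimsner hΛ (Λ.pimsnerToO (psiU Λ.leftAction x)) = psiULin Λ.leftAction x
    rw [pimsnerToO_psiU]
    have hrep := isRepresentation_universal Λ.leftAction
    refine Completed.ind (isClosed_eq ((toPimsner hΛ).continuous_cstar.comp
      (repPsi (isCuntzKrieger_T Λ)).continuous) hrep.continuous) (fun x => ?_) x
    change toPimsner hΛ (repPsi (isCuntzKrieger_T Λ) _) = _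
    rw [repPsi_of, prePsi_eq _ x subset_rfl, of_eq_sum x subset_rfl, map_sum, map_sum]
    refine Finset.sum_congr rfl fun e _ => ?_
    rw [map_mul, hpi, toPimsner_T, pimsnerFamily_edgeGen, ← hrep.right]
    rfl
  · change toPimsner hΛ (Λ.pimsnerToO (piU Λ.leftAction a)) = piU Λ.leftAction a
    rw [pimsnerToO_piU, hpi]

/-- The Cuntz-Pimsner algebra of `X_0` is the algebra of the directed graph `Λ`. -/
def pimsnerEquiv (hΛ : Λ.IsDirectedGraph) : CuntzPimsner Λ.leftAction ≃⋆ₐ[ℂ] Λ.O :=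
  StarAlgEquiv.ofBijective Λ.pimsnerToO (Function.bijective_iff_has_inverse.mpr
    ⟨toPimsner hΛ, DFunLike.congr_fun (toPimsner_comp_pimsnerToO hΛ),
      DFunLike.congr_fun (pimsnerToO_comp_toPimsner hΛ)⟩)

end OrdinalGraph

end

/-! ### The theorem: the isomorphisms θ, U and Φ -/

theorem mainTheorem5 (Λ : OrdinalGraph) (hΛ : Λ.IsDirectedGraph) :
    ∃ θ : (Λ.below 0).O ≃⋆ₐ[ℂ] Λ.c0,
      (∀ v : Λ.Vert, θ ((Λ.below 0).T ((Λ.below 0).vertGen v)) = OrdinalGraph.c0Single v) ∧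
      (∃ U : Λ.X 0 ≃ₗ[ℂ] Λ.Y,
        (∀ e : Λ.Edge 0, U (OrdinalGraph.delta e) = OrdinalGraph.edgeVec e) ∧
        Correspondence.IsIso Λ.leftAction Λ.graphAction θ U) ∧
      ∃ Φ : Correspondence.CuntzPimsner Λ.leftAction ≃⋆ₐ[ℂ] Λ.O,
        (∀ v : Λ.Vert, Φ (Correspondence.piU Λ.leftAction
          ((Λ.below 0).T ((Λ.below 0).vertGen v))) = Λ.T (Λ.vertGen v)) ∧
        ∀ e : Λ.Edge 0, Φ (Correspondence.psiU Λ.leftAction (OrdinalGraph.delta e)) =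
          Λ.T (OrdinalGraph.edgeGen e) := by
  refine ⟨Λ.belowZeroEquiv, OrdinalGraph.belowZeroEquiv_vertProj,
    ⟨Λ.XEquiv, OrdinalGraph.XEquiv_delta, OrdinalGraph.isIso_XEquiv Λ⟩,
    OrdinalGraph.pimsnerEquiv hΛ, fun v => ?_, fun e => ?_⟩
  · exact (OrdinalGraph.pimsnerToO_piU _).trans (OrdinalGraph.repPi_vertProj _ v)
  · exact (OrdinalGraph.pimsnerToO_psiU _).trans (OrdinalGraph.repPsi_delta _ e)
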